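/- Let $\Bbbk=\mathbb{C}$ and $\mathrm{i}=\sqrt{-1}$. For $e\in\{0,1\}$ let $H_e$ be the Hopf algebra generated as an algebra by $x,y,z,w$, where $x,y,z$ are commuting elements with $x^2=y^2=z^2=1$, $$wx=yw,\qquad wy=xw,\qquad wz=zw,\qquad w^2=\tfrac12(1+x+y-xy)\,z^{e},$$ $x,y,z$ are grouplike, $\epsilon(w)=1$, and $$\Delta(w)=\tfrac14\Big(\sum_{b,c,\alpha,\beta\in\{0,1\}}(-1)^{b\alpha+b\beta+c\beta}\,y^bz^c\otimes x^\alpha y^\beta\Big)(w\otimes w).$$ $H_0$ is the semisimple Hopf algebra of dimension sixteen number 1, and $H_1$ is number 3, in Kashina's classification. For $i\in\{1,2\}$ let $\pi_i(u,v)$ be the two-dimensional representation of $H_e$ with basis $u,v$ on which $x\mapsto\mathrm{diag}(1,-1)$, $y\mapsto\mathrm{diag}(-1,1)$, $z\mapsto(-1)^{i+1}I_2$ and $w\mapsto\kappa\begin{bmatrix}0&1\\1&0\end{bmatrix}$, where $\kappa=\mathrm{i}$ if $e=1$ and $i=2$, and $\kappa=1$ otherwise. For $a,c\in\{0,1\}$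 let $T_{(-1)^a,(-1)^a,-1,\gamma}(t)$ be the one-dimensional representation with basis $t$ on which $x,y,z,w$ act by $(-1)^a,(-1)^a,-1,\gamma$, where $\gamma=(-1)^c\,\mathrm{i}^{a}$ for $H_0$ and $\gamma=(-1)^c\,\mathrm{i}^{a+1}$ for $H_1$. **Theorem.** Let $H$ be $H_0$ or $H_1$, let $i\in\{1,2\}$, $a,c\in\{0,1\}$, $\alpha\in\Bbbk^\times$, let $r$ be one of $uv+\mathrm{i}\,vu$, $uv-\mathrm{i}\,vu$, $u^2+v^2$, $u^2-v^2$, and let $$A=\frac{\Bbbk\langle u,v\rangle}{(r)}[t;\sigma],\qquad \sigma(u)=\alpha u,\quad \sigma(v)=(-1)^{a+1}\alpha v,$$ be the Ore extension with $t\,f=\sigma(f)\,t$, graded by $\deg u=\deg v=\deg t=1$. Then $A$ is Artin–Schelter regular, and there is an action of $H$ on $A$ that makes $A$ an $H$-module algebra, preserves the grading, restricts on $A_1=\Bbbk u\oplus\Bbbk v\oplus\Bbbk t$ to the representation $\pi_i(u,v)\oplus T_{(-1)^a,(-1)^a,-1,\gamma}(t)$, and is inner-faithful: the only Hopf ideal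 of $H$ that annihilates $A$ is zero. -/

import Mathlib

open scoped TensorProduct

noncomputable section

namespace Kashina

/-- The two Hopf algebras under consideration: number 1 and number 3 of Kashina's list. -/
inductive Number
  | one
  | three
  deriving DecidableEq

/-- The exponent `e` of `z` in the relation `w ^ 2 = (1 + x + y - x y) z ^ e / 2`. -/
def Number.zExp : Number → ℕ
  | .one => 0
  | .three => 1

/-- Names of the algebra generators. -/
inductive Gen
  | x
  | y
  | z
  | w

open FreeAlgebra in
/-- The defining relations. -/
inductive Rel (K : Number) : FreeAlgebra ℂ Gen → FreeAlgebra ℂ Gen → Prop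
  | xx : Rel K (ι ℂ Gen.x * ι ℂ Gen.x) 1
  | yy : Rel K (ι ℂ Gen.y * ι ℂ Gen.y) 1
  | zz : Rel K (ι ℂ Gen.z * ι ℂ Gen.z) 1
  | yx : Rel K (ι ℂ Gen.y * ι ℂ Gen.x) (ι ℂ Gen.x * ι ℂ Gen.y)
  | zx : Rel K (ι ℂ Gen.z * ι ℂ Gen.x) (ι ℂ Gen.x * ι ℂ Gen.z)
  | zy : Rel K (ι ℂ Gen.z * ι ℂ Gen.y) (ι ℂ Gen.y * ι ℂ Gen.z)
  | wx : Rel K (ι ℂ Gen.w * ι ℂ Gen.x) (ι ℂ Gen.y * ι ℂ Gen.w)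
  | wy : Rel K (ι ℂ Gen.w * ι ℂ Gen.y) (ι ℂ Gen.x * ι ℂ Gen.w)
  | wz : Rel K (ι ℂ Gen.w * ι ℂ Gen.z) (ι ℂ Gen.z * ι ℂ Gen.w)
  | ww : Rel K (ι ℂ Gen.w * ι ℂ Gen.w)
      ((1 / 2 : ℂ) • (1 + ι ℂ Gen.x + ι ℂ Gen.y - ι ℂ Gen.x * ι ℂ Gen.y) * ι ℂ Gen.z ^ K.zExp)

/-- The underlying algebra of the Hopf algebra number `K`. -/
def Alg (K : Number) : Type := RingQuot (Rel K)

instance (K : Number) : Ring (Alg K) := inferInstanceAs (Ring (RingQuot (Rel K)))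

instance (K : Number) : Algebra ℂ (Alg K) := inferInstanceAs (Algebra ℂ (RingQuot (Rel K)))

/-- The quotient map from the free algebra. -/
def mk (K : Number) : FreeAlgebra ℂ Gen →ₐ[ℂ] Alg K := RingQuot.mkAlgHom ℂ (Rel K)

/-- The image of a generator. -/
def gen (K : Number) (g : Gen) : Alg K := mk K (FreeAlgebra.ι ℂ g)

/-- Four elements of a `ℂ`-algebra that satisfy the defining relations. -/
structure Sat (K : Number) {B : Type} [Ring B] [Algebra ℂ B] (v : Gen → B) : Prop where
  xx : v .x * v .x = 1
  yy : v .y * v .y = 1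
  zz : v .z * v .z = 1
  yx : v .y * v .x = v .x * v .y
  zx : v .z * v .x = v .x * v .z
  zy : v .z * v .y = v .y * v .z
  wx : v .w * v .x = v .y * v .w
  wy : v .w * v .y = v .x * v .w
  wz : v .w * v .z = v .z * v .w
  ww : v .w * v .w = (1 / 2 : ℂ) • (1 + v .x + v .y - v .x * v .y) * v .z ^ K.zExp

section

variable {K : Number} {B : Type} [Ring B] [Algebra ℂ B]

/-- The algebra homomorphism given by the images of the generators. -/
def lift (v : Gen → B) (h : Sat K v) : Alg K →ₐ[ℂ] B :=
  RingQuot.liftAlgHom ℂ ⟨FreeAlgebra.lift ℂ v, by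
    intro a b r
    cases r <;> simp [h.xx, h.yy, h.zz, h.yx, h.zx, h.zy, h.wx, h.wy, h.wz, h.ww]⟩

@[simp] theorem lift_gen (v : Gen → B) (h : Sat K v) (g : Gen) : lift v h (gen K g) = v g := by
  have := RingQuot.liftAlgHom_mkAlgHom_apply ℂ (s := Rel K) (FreeAlgebra.lift ℂ v) (by
    intro a b r
    cases r <;> simp [h.xx, h.yy, h.zz, h.yx, h.zx, h.zy, h.wx, h.wy, h.wz, h.ww])
    (FreeAlgebra.ι ℂ g)
  exact this.trans (FreeAlgebra.lift_ι_apply v g)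

theorem algHom_ext {f g : Alg K →ₐ[ℂ] B} (h : ∀ s, f (gen K s) = g (gen K s)) : f = g := by
  refine RingQuot.ringQuot_ext' ℂ f g (FreeAlgebra.hom_ext ?_)
  funext s
  exact h s

theorem induct {p : Alg K → Prop} (hc : ∀ c : ℂ, p (algebraMap ℂ _ c)) (hg : ∀ s, p (gen K s))
    (ha : ∀ a b, p a → p b → p (a + b)) (hm : ∀ a b, p a → p b → p (a * b)) (a : Alg K) : p a := by
  obtain ⟨a, rfl⟩ := RingQuot.mkAlgHom_surjective ℂ (Rel K) a
  induction a using FreeAlgebra.induction with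
  | grade0 r => rw [AlgHom.commutes]; exact hc r
  | grade1 s => exact hg s
  | mul a b h1 h2 => rw [map_mul]; exact hm _ _ h1 h2
  | add a b h1 h2 => rw [map_add]; exact ha _ _ h1 h2

theorem sat_gen (K : Number) : Sat K (gen K) := by
  have key : ∀ {a b}, Rel K a b → mk K a = mk K b := fun h => RingQuot.mkAlgHom_rel ℂ h
  constructor
  · simpa [gen] using key .xx
  · simpa [gen] using key .yy
  · simpa [gen] using key .zz
  · simpa [gen] using key .yx
  · simpa [gen] using key .zx
  · simpa [gen] using key .zy
  · simpa [gen] using key .wx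
  · simpa [gen] using key .wy
  · simpa [gen] using key .wz
  · simpa [gen] using key .ww

end

section

variable (K : Number)

@[simp] theorem xx : gen K .x * gen K .x = 1 := (sat_gen K).xx
@[simp] theorem yy : gen K .y * gen K .y = 1 := (sat_gen K).yy
@[simp] theorem zz : gen K .z * gen K .z = 1 := (sat_gen K).zz
@[simp] theorem yx : gen K .y * gen K .x = gen K .x * gen K .y := (sat_gen K).yx
@[simp] theorem zx : gen K .z * gen K .x = gen K .x * gen K .z := (sat_gen K).zx
@[simp] theorem zy : gen K .z * gen K .y = gen K .y * gen K .z := (sat_gen K).zy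
@[simp] theorem wx : gen K .w * gen K .x = gen K .y * gen K .w := (sat_gen K).wx
@[simp] theorem wy : gen K .w * gen K .y = gen K .x * gen K .w := (sat_gen K).wy
@[simp] theorem wz : gen K .w * gen K .z = gen K .z * gen K .w := (sat_gen K).wz
theorem ww : gen K .w * gen K .w =
    (1 / 2 : ℂ) • (1 + gen K .x + gen K .y - gen K .x * gen K .y) * gen K .z ^ K.zExp :=
  (sat_gen K).ww

variable {K} (m : Alg K)

@[simp] theorem xx' : gen K .x * (gen K .x * m) = m := by rw [← mul_assoc, xx, one_mul]
@[simp] theorem yy' : gen K .y * (gen K .y * m) = m := by rw [← mul_assoc, yy, one_mul]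
@[simp] theorem zz' : gen K .z * (gen K .z * m) = m := by rw [← mul_assoc, zz, one_mul]
@[simp] theorem yx' : gen K .y * (gen K .x * m) = gen K .x * (gen K .y * m) := by
  rw [← mul_assoc, yx, mul_assoc]
@[simp] theorem zx' : gen K .z * (gen K .x * m) = gen K .x * (gen K .z * m) := by
  rw [← mul_assoc, zx, mul_assoc]
@[simp] theorem zy' : gen K .z * (gen K .y * m) = gen K .y * (gen K .z * m) := by
  rw [← mul_assoc, zy, mul_assoc]
@[simp] theorem wx' : gen K .w * (gen K .x * m) = gen K .y * (gen K .w * m) := by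
  rw [← mul_assoc, wx, mul_assoc]
@[simp] theorem wy' : gen K .w * (gen K .y * m) = gen K .x * (gen K .w * m) := by
  rw [← mul_assoc, wy, mul_assoc]
@[simp] theorem wz' : gen K .w * (gen K .z * m) = gen K .z * (gen K .w * m) := by
  rw [← mul_assoc, wz, mul_assoc]

end

/-- The factor `(1 / 4) ∑ (-1) ^ (b α + b β + c β) y ^ b z ^ c ⊗ x ^ α y ^ β`. -/
def twist (K : Number) : Alg K ⊗[ℂ] Alg K :=
  (1 / 4 : ℂ) • ∑ b : Fin 2, ∑ c : Fin 2, ∑ α : Fin 2, ∑ β : Fin 2,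
    ((-1) ^ (b * α + b * β + c * β : ℕ) : ℂ) •
      ((gen K .y ^ (b : ℕ) * gen K .z ^ (c : ℕ)) ⊗ₜ[ℂ] (gen K .x ^ (α : ℕ) * gen K .y ^ (β : ℕ)))

/-- The comultiplication on the generators. -/
def comulGen (K : Number) : Gen → Alg K ⊗[ℂ] Alg K
  | .x => gen K .x ⊗ₜ gen K .x
  | .y => gen K .y ⊗ₜ gen K .y
  | .z => gen K .z ⊗ₜ gen K .z
  | .w => twist K * (gen K .w ⊗ₜ gen K .w)

section

variable {B : Type} [Ring B] [Algebra ℂ B]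

/-- For commuting involutions, the element `(1 + g + h - g h) / 2`, which is bimultiplicative. -/
def bich (g h : B) : B := (1 / 2 : ℂ) • (1 + g + h - g * h)

theorem map_bich {C : Type} [Ring C] [Algebra ℂ C] (f : B →ₐ[ℂ] C) (g h : B) :
    f (bich g h) = bich (f g) (f h) := by simp [bich]

theorem bich_mul_left {g g' h : B} (hh : h * h = 1) (h3 : Commute g' h) :
    bich (g * g') h = bich g h * bich g' h := by
  have e3 : ∀ m, h * (g' * m) = g' * (h * m) := fun m => by rw [← mul_assoc, ← h3.eq, mul_assoc]
  simp only [bich, add_mul, mul_add, sub_mul, mul_sub, mul_assoc, smul_mul_assoc, mul_smul_comm,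
    hh, ← h3.eq, e3, one_mul, mul_one]
  module

theorem bich_comm {g h : B} (h1 : Commute g h) : bich g h = bich h g := by
  rw [bich, bich, h1.eq]
  module

theorem bich_mul_right {g h h' : B} (hg : g * g = 1) (h2 : Commute g h) (h3 : Commute g h') :
    bich g (h * h') = bich g h * bich g h' := by
  rw [bich_comm (h2.mul_right h3), bich_mul_left hg h3.symm, bich_comm h2, bich_comm h3]

theorem bich_commute_left {g h k : B} (h1 : Commute g k) (h2 : Commute h k) :
    Commute (bich g h) k :=
  ((((Commute.one_left _).add_left h1).add_left h2).sub_left (h1.mul_left h2)).smul_left _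

theorem bich_commute {g h g' h' : B} (h1 : Commute g g') (h2 : Commute g h') (h3 : Commute h g')
    (h4 : Commute h h') : Commute (bich g h) (bich g' h') :=
  bich_commute_left (bich_commute_left h1.symm h2.symm).symm
    (bich_commute_left h3.symm h4.symm).symm

theorem bich_sq {g h : B} (hg : g * g = 1) (hh : h * h = 1) (h1 : Commute g h) :
    bich g h * bich g h = 1 := by
  rw [← bich_mul_left hh h1, hg]
  simp only [bich, one_mul, add_sub_cancel_right]
  module

theorem sq_aux {t t' W F Z D : B} (h1 : W * t = t' * W) (h2 : W * W = F * Z)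
    (h3 : D = t * t' * F) : t * W * (t * W) = D * Z := by
  rw [mul_assoc, ← mul_assoc W, h1, mul_assoc t', h2, h3]
  simp only [mul_assoc]

theorem reorder {a b c d e f : B} (hde : Commute d e) (hdf : Commute d f) (hbe : Commute b e)
    (hbf : Commute b f) (hce : Commute c e) (hcf : Commute c f) (hcb : Commute c b)
    (hae : Commute a e) : a * c * (b * d) * (e * f) = e * a * (f * b) * (c * d) := by
  simp only [mul_assoc]
  rw [hde.left_comm, hdf.eq, hbe.left_comm, hbf.left_comm, hce.left_comm, hcf.left_comm,
    hcb.left_comm, hae.left_comm]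

theorem reorder' {a q c d e : B} (hq : q * q = 1) (hqc : Commute q c) (hdc : Commute d c)
    (hda : Commute d a) (hca : Commute c a) :
    d * c * (a * e) = a * q * (c * q) * (d * e) := by
  have h : q * (c * (q * (d * e))) = c * (d * e) := by
    rw [hqc.left_comm, ← mul_assoc q q, hq, one_mul]
  simp only [mul_assoc]
  rw [h, hca.left_comm, hda.left_comm, hdc.left_comm]

end

theorem twist_eq (K : Number) : twist K =
    bich (gen K .y ⊗ₜ 1) (1 ⊗ₜ gen K .x) * bich (gen K .z ⊗ₜ 1) (1 ⊗ₜ (gen K .x * gen K .y)) := by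
  simp [twist, bich, Fin.sum_univ_two, add_mul, mul_add, mul_assoc, sub_mul, mul_sub,
    Algebra.TensorProduct.one_def]
  module

theorem w_mul_twist (K : Number) : (gen K .w ⊗ₜ[ℂ] gen K .w) * twist K =
    bich (gen K .x ⊗ₜ 1) (1 ⊗ₜ gen K .y) * bich (gen K .z ⊗ₜ 1) (1 ⊗ₜ (gen K .x * gen K .y)) *
      (gen K .w ⊗ₜ[ℂ] gen K .w) := by
  simp [twist, bich, Fin.sum_univ_two, add_mul, mul_add, mul_assoc, sub_mul, mul_sub,
    Algebra.TensorProduct.one_def]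
  module

theorem bich_tmul {C : Type} [Ring C] [Algebra ℂ C] (g h : C) :
    bich g h ⊗ₜ[ℂ] bich g h = bich (g ⊗ₜ 1) (h ⊗ₜ 1) * bich (1 ⊗ₜ g) (1 ⊗ₜ h) := by
  have h1 := map_bich (Algebra.TensorProduct.includeLeft (S := ℂ) (R := ℂ) (A := C) (B := C)) g h
  have h2 := map_bich (Algebra.TensorProduct.includeRight (R := ℂ) (A := C) (B := C)) g h
  simp only [Algebra.TensorProduct.includeLeft_apply,
    Algebra.TensorProduct.includeRight_apply] at h1 h2
  rw [← h1, ← h2, Algebra.TensorProduct.tmul_mul_tmul, one_mul, mul_one]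

theorem bich_comul (K : Number) :
    bich (gen K .x ⊗ₜ[ℂ] gen K .x) (gen K .y ⊗ₜ[ℂ] gen K .y) =
    twist K * (bich (gen K .x ⊗ₜ 1) (1 ⊗ₜ gen K .y) *
      bich (gen K .z ⊗ₜ 1) (1 ⊗ₜ (gen K .x * gen K .y))) *
      (bich (gen K .x) (gen K .y) ⊗ₜ bich (gen K .x) (gen K .y)) := by
  have s1 : gen K .x ⊗ₜ[ℂ] gen K .x = gen K .x ⊗ₜ 1 * 1 ⊗ₜ gen K .x := by simp
  have s2 : gen K .y ⊗ₜ[ℂ] gen K .y = gen K .y ⊗ₜ 1 * 1 ⊗ₜ gen K .y := by simp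
  rw [bich_tmul, twist_eq, s1, s2, bich_mul_left, bich_mul_right, bich_mul_right,
    bich_comm (g := 1 ⊗ₜ[ℂ] gen K .x) (h := gen K .y ⊗ₜ 1)]
  · apply reorder'
    · apply bich_sq
      all_goals simp [commute_iff_eq, mul_assoc, Algebra.TensorProduct.one_def]
    all_goals apply bich_commute
    all_goals simp [commute_iff_eq, mul_assoc]
  all_goals simp [commute_iff_eq, mul_assoc, Algebra.TensorProduct.one_def]

theorem commute_twist (K : Number) (g : Alg K) (hx : gen K .x * g = g * gen K .x)
    (hy : gen K .y * g = g * gen K .y) (hz : gen K .z * g = g * gen K .z) :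
    twist K * (g ⊗ₜ g) = (g ⊗ₜ g) * twist K := by
  rw [twist_eq]
  have h1 : ∀ a b : Alg K, a * g = g * a → b * g = g * b →
      Commute (bich (a ⊗ₜ[ℂ] (1 : Alg K)) ((1 : Alg K) ⊗ₜ[ℂ] b)) (g ⊗ₜ g) := fun a b ha hb =>
    bich_commute_left (by simp [commute_iff_eq, ha]) (by simp [commute_iff_eq, hb])
  exact (h1 _ _ hy hx).mul_left (h1 _ _ hz (by rw [mul_assoc, hy, ← mul_assoc, hx, mul_assoc]))

theorem comulGen_mul_w (K : Number) (g g' : Alg K) (hx : gen K .x * g' = g' * gen K .x)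
    (hy : gen K .y * g' = g' * gen K .y) (hz : gen K .z * g' = g' * gen K .z)
    (h : gen K .w * g = g' * gen K .w) :
    twist K * gen K .w ⊗ₜ gen K .w * g ⊗ₜ g = g' ⊗ₜ g' * (twist K * gen K .w ⊗ₜ gen K .w) := by
  rw [← mul_assoc, ← commute_twist K g' hx hy hz, mul_assoc, mul_assoc,
    Algebra.TensorProduct.tmul_mul_tmul, Algebra.TensorProduct.tmul_mul_tmul, h]

theorem comulGen_w_sq (K : Number) :
    twist K * (gen K .w ⊗ₜ gen K .w) * (twist K * (gen K .w ⊗ₜ gen K .w)) =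
      bich (gen K .x ⊗ₜ[ℂ] gen K .x) (gen K .y ⊗ₜ[ℂ] gen K .y) *
        (gen K .z ⊗ₜ gen K .z) ^ K.zExp := by
  have h : (gen K .w ⊗ₜ[ℂ] gen K .w) * (gen K .w ⊗ₜ gen K .w) =
      (bich (gen K .x) (gen K .y) ⊗ₜ[ℂ] bich (gen K .x) (gen K .y)) *
      (gen K .z ⊗ₜ gen K .z) ^ K.zExp := by
    rw [Algebra.TensorProduct.tmul_mul_tmul, ww, Algebra.TensorProduct.tmul_pow,
      Algebra.TensorProduct.tmul_mul_tmul, bich]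
  exact sq_aux (w_mul_twist K) h (bich_comul K)

theorem sat_comulGen (K : Number) : Sat K (comulGen K) := by
  constructor <;> simp only [comulGen]
  · simp [Algebra.TensorProduct.one_def]
  · simp [Algebra.TensorProduct.one_def]
  · simp [Algebra.TensorProduct.one_def]
  · simp
  · simp
  · simp
  · exact comulGen_mul_w K _ _ (by simp) (by simp) (by simp) (by simp)
  · exact comulGen_mul_w K _ _ (by simp) (by simp) (by simp) (by simp)
  · exact comulGen_mul_w K _ _ (by simp) (by simp) (by simp) (by simp)
  · rw [comulGen_w_sq, bich]

/-- The comultiplication, an algebra homomorphism. -/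
def comulHom (K : Number) : Alg K →ₐ[ℂ] Alg K ⊗[ℂ] Alg K := lift (comulGen K) (sat_comulGen K)

theorem sat_counit (K : Number) : Sat K (fun _ => (1 : ℂ)) := by
  constructor <;> norm_num

/-- The counit, which sends every generator to `1`. -/
def counitHom (K : Number) : Alg K →ₐ[ℂ] ℂ := lift (fun _ => 1) (sat_counit K)

theorem coassoc_w (K : Number) :
    Algebra.TensorProduct.assoc ℂ ℂ ℂ _ _ _
      (Algebra.TensorProduct.map (comulHom K) (.id ℂ _) (twist K) * twist K ⊗ₜ 1) =
    Algebra.TensorProduct.map (.id ℂ _) (comulHom K) (twist K) * 1 ⊗ₜ twist K := by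
  have cx : comulHom K (gen K .x) = gen K .x ⊗ₜ gen K .x := by simp [comulHom, comulGen]
  have cy : comulHom K (gen K .y) = gen K .y ⊗ₜ gen K .y := by simp [comulHom, comulGen]
  have cz : comulHom K (gen K .z) = gen K .z ⊗ₜ gen K .z := by simp [comulHom, comulGen]
  have e1 : (twist K ⊗ₜ[ℂ] 1 : (Alg K ⊗[ℂ] Alg K) ⊗[ℂ] Alg K) =
    Algebra.TensorProduct.includeLeft (S := ℂ) (twist K) := rfl
  have e2 : (1 ⊗ₜ[ℂ] twist K : Alg K ⊗[ℂ] (Alg K ⊗[ℂ] Alg K)) =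
    Algebra.TensorProduct.includeRight (twist K) := rfl
  rw [e1, e2]
  simp only [twist_eq, map_mul, map_bich, ← AlgEquiv.coe_toAlgHom]
  simp only [AlgEquiv.coe_toAlgHom, Algebra.TensorProduct.map_tmul, map_one, cx, cy, cz, map_mul,
    AlgHom.id_apply, Algebra.TensorProduct.tmul_mul_tmul, Algebra.TensorProduct.includeLeft_apply,
    Algebra.TensorProduct.includeRight_apply, Algebra.TensorProduct.one_def,
    Algebra.TensorProduct.assoc_tmul]
  have s1 : ∀ g : Alg K, g ⊗ₜ[ℂ] (g ⊗ₜ[ℂ] (1 : Alg K)) = g ⊗ₜ (1 ⊗ₜ 1) * 1 ⊗ₜ (g ⊗ₜ 1) := by simp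
  have s2 : ∀ g : Alg K, (1 : Alg K) ⊗ₜ[ℂ] (g ⊗ₜ[ℂ] g) = 1 ⊗ₜ (g ⊗ₜ 1) * 1 ⊗ₜ (1 ⊗ₜ g) := by simp
  rw [s1, s1, s2, s2, bich_mul_left, bich_mul_left, bich_mul_right, bich_mul_right]
  · apply reorder
    all_goals apply bich_commute
    all_goals simp [commute_iff_eq, mul_assoc]
  all_goals simp [commute_iff_eq, mul_assoc, Algebra.TensorProduct.one_def]

instance (K : Number) : Bialgebra ℂ (Alg K) :=
  Bialgebra.ofAlgHom (comulHom K) (counitHom K)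
    (by
      refine algHom_ext fun s => ?_
      cases s
      · simp [comulHom, comulGen]
      · simp [comulHom, comulGen]
      · simp [comulHom, comulGen]
      · have cw : comulHom K (gen K .w) = twist K * (gen K .w ⊗ₜ gen K .w) := by
          simp [comulHom, comulGen]
        have e1 : (twist K * gen K .w ⊗ₜ gen K .w) ⊗ₜ[ℂ] gen K .w =
            twist K ⊗ₜ 1 * (gen K .w ⊗ₜ gen K .w) ⊗ₜ gen K .w := by simp
        have e2 : gen K .w ⊗ₜ[ℂ] (twist K * gen K .w ⊗ₜ gen K .w) =
            1 ⊗ₜ twist K * gen K .w ⊗ₜ (gen K .w ⊗ₜ gen K .w) := by simp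
        simp only [AlgHom.comp_apply, cw, map_mul, Algebra.TensorProduct.map_tmul, AlgHom.id_apply,
          e1, e2]
        rw [← mul_assoc, ← mul_assoc, ← coassoc_w, map_mul]
        rfl)
    (by
      refine algHom_ext fun s => ?_
      cases s
      · simp [comulHom, comulGen, counitHom]
      · simp [comulHom, comulGen, counitHom]
      · simp [comulHom, comulGen, counitHom]
      · simp [comulHom, comulGen, counitHom, twist, Fin.sum_univ_two, add_mul, mul_add, mul_assoc]
        module)
    (by
      refine algHom_ext fun s => ?_
      cases s
      · simp [comulHom, comulGen, counitHom]
      · simp [comulHom, comulGen, counitHom]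
      · simp [comulHom, comulGen, counitHom]
      · simp [comulHom, comulGen, counitHom, twist, Fin.sum_univ_two, add_mul, mul_add, mul_assoc]
        module)

@[simp] theorem comul_x (K : Number) : Coalgebra.comul (R := ℂ) (gen K .x) = gen K .x ⊗ₜ gen K .x :=
  lift_gen _ _ _

@[simp] theorem comul_y (K : Number) : Coalgebra.comul (R := ℂ) (gen K .y) = gen K .y ⊗ₜ gen K .y :=
  lift_gen _ _ _

@[simp] theorem comul_z (K : Number) : Coalgebra.comul (R := ℂ) (gen K .z) = gen K .z ⊗ₜ gen K .z :=
  lift_gen _ _ _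

theorem comul_w (K : Number) : Coalgebra.comul (R := ℂ) (gen K .w) =
    twist K * gen K .w ⊗ₜ gen K .w :=
  lift_gen _ _ _

@[simp] theorem counit_gen (K : Number) (s : Gen) : Coalgebra.counit (R := ℂ) (gen K s) = 1 :=
  lift_gen _ _ _

open MulOpposite

/-- The antipode on the generators: it fixes the grouplike elements `x, y, z`, and
`S(w) = w⁻¹ · j` for the element `j` of the group algebra of `⟨x, y, z⟩` obtained from `twist` by
multiplication. -/
def antipodeGen (K : Number) : Gen → (Alg K)ᵐᵒᵖ
  | .x => op (gen K .x)
  | .y => op (gen K .y)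
  | .z => op (gen K .z)
  | .w => op (gen K .w * bich (gen K .z) (gen K .x * gen K .y) * gen K .z ^ K.zExp)

theorem sat_antipodeGen (K : Number) : Sat K (antipodeGen K) := by
  constructor
  all_goals apply unop_injective
  · simp [antipodeGen]
  · simp [antipodeGen]
  · simp [antipodeGen]
  · simp [antipodeGen]
  · simp [antipodeGen]
  · simp [antipodeGen]
  · cases K <;> simp [antipodeGen, bich, mul_assoc, add_mul, mul_add, sub_mul, mul_sub, Number.zExp] 
  · cases K <;> simp [antipodeGen, bich, mul_assoc, add_mul, mul_add, sub_mul, mul_sub, Number.zExp] 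
  · cases K <;> simp [antipodeGen, bich, mul_assoc, add_mul, mul_add, sub_mul, mul_sub, Number.zExp] 
  · cases K <;> simp [antipodeGen, bich, mul_assoc, add_mul, mul_add, sub_mul, mul_sub, Number.zExp, ww] <;> module

/-- The antipode, as a homomorphism to the opposite algebra. -/
def antipodeHom (K : Number) : Alg K →ₐ[ℂ] (Alg K)ᵐᵒᵖ := lift (antipodeGen K) (sat_antipodeGen K)

/-- The antipode, as a linear map. -/
def anti (K : Number) : Alg K →ₗ[ℂ] Alg K :=
  (opLinearEquiv ℂ).symm.toLinearMap ∘ₗ (antipodeHom K).toLinearMap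

theorem anti_one (K : Number) : anti K 1 = 1 := by simp [anti]

theorem anti_mul (K : Number) (a b : Alg K) : anti K (a * b) = anti K b * anti K a := by
  simp [anti]

theorem anti_gen (K : Number) (s : Gen) : anti K (gen K s) = unop (antipodeGen K s) := by
  simp [anti, antipodeHom]

theorem anti_left_mul (K : Number) (P Q : Alg K ⊗[ℂ] Alg K) (c : ℂ)
    (hP : LinearMap.mul' ℂ _ ((anti K).rTensor _ P) = algebraMap ℂ _ c) :
    LinearMap.mul' ℂ _ ((anti K).rTensor _ (P * Q)) =
      c • LinearMap.mul' ℂ _ ((anti K).rTensor _ Q) := by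
  induction Q with
  | zero => simp
  | add a b h1 h2 => simp only [mul_add, map_add, h1, h2, smul_add]
  | tmul q r =>
    have : ∀ P : Alg K ⊗[ℂ] Alg K, LinearMap.mul' ℂ _ ((anti K).rTensor _ (P * q ⊗ₜ r)) =
        anti K q * LinearMap.mul' ℂ _ ((anti K).rTensor _ P) * r := by
      intro P
      induction P with
      | zero => simp
      | add a b h1 h2 => simp only [add_mul, mul_add, map_add, h1, h2]
      | tmul a b => simp [anti_mul, mul_assoc]
    rw [this, hP, ← Algebra.commutes, mul_assoc, ← Algebra.smul_def]
    simp

theorem anti_right_mul (K : Number) (P Q : Alg K ⊗[ℂ] Alg K) (c : ℂ)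
    (hQ : LinearMap.mul' ℂ _ ((anti K).lTensor _ Q) = algebraMap ℂ _ c) :
    LinearMap.mul' ℂ _ ((anti K).lTensor _ (P * Q)) =
      c • LinearMap.mul' ℂ _ ((anti K).lTensor _ P) := by
  induction P with
  | zero => simp
  | add a b h1 h2 => simp only [add_mul, map_add, h1, h2, smul_add]
  | tmul q r =>
    have : ∀ Q : Alg K ⊗[ℂ] Alg K, LinearMap.mul' ℂ _ ((anti K).lTensor _ (q ⊗ₜ r * Q)) =
        q * LinearMap.mul' ℂ _ ((anti K).lTensor _ Q) * anti K r := by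
      intro P
      induction P with
      | zero => simp
      | add a b h1 h2 => simp only [add_mul, mul_add, map_add, h1, h2]
      | tmul a b => simp [anti_mul, mul_assoc]
    rw [this, hQ, ← Algebra.commutes, mul_assoc, ← Algebra.smul_def]
    simp

instance (K : Number) : HopfAlgebra ℂ (Alg K) where
  antipode := anti K
  mul_antipode_rTensor_comul := by
    ext a
    simp only [LinearMap.comp_apply, Algebra.linearMap_apply]
    induction a using induct with
    | hc c => simp [Algebra.algebraMap_eq_smul_one, Algebra.TensorProduct.one_def, anti_one]
    | hg s =>
      cases s
      · simp [anti_gen, antipodeGen]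
      · simp [anti_gen, antipodeGen]
      · simp [anti_gen, antipodeGen]
      · cases K <;>
          simp [comul_w, twist, bich, Fin.sum_univ_two, anti_gen, anti_mul, antipodeGen, add_mul,
            mul_add, mul_sub, sub_mul, mul_assoc, Number.zExp, ww] <;>
          module
    | ha a b h1 h2 => simp only [map_add, h1, h2]
    | hm a b h1 h2 =>
      rw [Bialgebra.comul_mul, anti_left_mul K _ _ _ h1, h2, Bialgebra.counit_mul, map_mul,
        Algebra.smul_def]
  mul_antipode_lTensor_comul := by
    ext a
    simp only [LinearMap.comp_apply, Algebra.linearMap_apply]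
    induction a using induct with
    | hc c => simp [Algebra.algebraMap_eq_smul_one, Algebra.TensorProduct.one_def, anti_one]
    | hg s =>
      cases s
      · simp [anti_gen, antipodeGen]
      · simp [anti_gen, antipodeGen]
      · simp [anti_gen, antipodeGen]
      · cases K <;>
          simp [comul_w, twist, bich, Fin.sum_univ_two, anti_gen, anti_mul, antipodeGen, add_mul,
            mul_add, mul_sub, sub_mul, mul_assoc, Number.zExp, ww] <;>
          module
    | ha a b h1 h2 => simp only [map_add, h1, h2]
    | hm a b h1 h2 =>
      rw [Bialgebra.comul_mul, anti_right_mul K _ _ _ h2, h1, Bialgebra.counit_mul, map_mul,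
        Algebra.smul_def, Algebra.commutes]

section

variable {K : Number}

theorem sat_pi (K : Number) (j : Fin 2) : Sat K (B := Matrix (Fin 2) (Fin 2) ℂ) (fun
    | .x => !![1, 0; 0, -1]
    | .y => !![-1, 0; 0, 1]
    | .z => !![(-1) ^ (j : ℕ), 0; 0, (-1) ^ (j : ℕ)]
    | .w => !![0, Complex.I ^ (j * K.zExp : ℕ); Complex.I ^ (j * K.zExp : ℕ), 0]) := by
  constructor
  all_goals
    cases K <;> fin_cases j <;> ext p q <;> fin_cases p <;> fin_cases q <;>
      simp [Number.zExp, Matrix.mul_apply, Fin.sum_univ_two] <;> norm_num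

/-- The two-dimensional irreducible representations: `j = 0` is `π₁` and `j = 1` is `π₂`. -/
def piRep (K : Number) (j : Fin 2) : Alg K →ₐ[ℂ] Matrix (Fin 2) (Fin 2) ℂ :=
  lift _ (sat_pi K j)

theorem sat_char (K : Number) (a b c : Fin 2) : Sat K (B := ℂ) (fun
    | .x => (-1) ^ (a : ℕ)
    | .y => (-1) ^ (a : ℕ)
    | .z => (-1) ^ (b : ℕ)
    | .w => (-1) ^ (c : ℕ) * Complex.I ^ (a + b * K.zExp : ℕ)) := by
  constructor
  all_goals
    cases K <;> fin_cases a <;> fin_cases b <;> fin_cases c <;> simp [Number.zExp] <;> norm_num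

/-- The one-dimensional representations `T_{(-1)^a, (-1)^a, (-1)^b, γ}`, where `γ = (-1)^c i^a` for
number 1 and `γ = (-1)^c i^(a + b)` for number 3. -/
def charRep (K : Number) (a b c : Fin 2) : Alg K →ₐ[ℂ] ℂ := lift _ (sat_char K a b c)

end

end Kashina

section HopfActions

variable {H A : Type} [Ring H] [HopfAlgebra ℂ H] [Ring A] [Algebra ℂ A]

/-- An action of `H` on the vector space `A` that makes `A` an `H`-module algebra:
`h . 1 = ε(h) 1` and `h . (a b) = ∑ (h₁ . a) (h₂ . b)`. -/
structure IsModuleAlgebra (ρ : H →ₐ[ℂ] Module.End ℂ A) : Prop where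
  act_one : ∀ h : H, ρ h 1 = algebraMap ℂ A (Coalgebra.counit h)
  act_mul : ∀ (h : H) (a b : A), ρ h (a * b) =
    LinearMap.mul' ℂ A (TensorProduct.map (ρ.toLinearMap.flip a) (ρ.toLinearMap.flip b)
      (Coalgebra.comul h))

/-- The only Hopf ideal of `H` that annihilates `A` is the zero ideal. -/
def IsInnerFaithful (ρ : H →ₐ[ℂ] Module.End ℂ A) : Prop :=
  ∀ I : Ideal H, I.IsTwoSided → I.IsHopfIdeal ℂ → (∀ h ∈ I, ρ h = 0) → I = ⊥

end HopfActions

section ASRegular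

open CategoryTheory

variable {A : Type} [Ring A] [Algebra ℂ A] (𝒜 : ℕ → Submodule ℂ A)

/-- The subspaces `𝒜 n` form a connected `ℕ`-grading of the algebra `A`. -/
def IsConnectedGraded : Prop :=
  Nonempty (GradedAlgebra 𝒜) ∧ Nontrivial A ∧ 𝒜 0 = 1

/-- The Gelfand–Kirillov dimension: the supremum over the finite-dimensional subspaces `V` of
`limsup log dim (ℂ + V + ⋯ + V ^ n) / log n`. -/
def gkDim (A : Type) [Ring A] [Algebra ℂ A] : EReal :=
  ⨆ V : {V : Submodule ℂ A // FiniteDimensional ℂ V}, Filter.limsup (fun n : ℕ =>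
    ((Real.log (Module.finrank ℂ ↥((1 ⊔ V.1) ^ n)) / Real.log n : ℝ) : EReal)) Filter.atTop

/-- The left ideal generated by the elements of positive degree. -/
def augIdeal : Ideal A := Ideal.span (⋃ n ∈ Set.Ici 1, (𝒜 n : Set A))

/-- The trivial left module `ℂ = A / A_{≥ 1}`. -/
def trivialModule : ModuleCat.{0} A := ModuleCat.of A (A ⧸ augIdeal 𝒜)

/-- Right multiplication by `a`, an endomorphism of the left module `A`. -/
def rightMul (a : A) : ModuleCat.of A A ⟶ ModuleCat.of A A :=
  ModuleCat.ofHom (LinearMap.toSpanSingleton A A a)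

/-- The conditions of Artin and Schelter, for left modules. In the last condition the right
`A`-module `Ext^d(ℂ, A)` is one-dimensional over `ℂ` and is annihilated by `A_{≥ 1}`, which means
that it is the trivial module `ℂ` up to a shift of the grading. -/
structure IsLeftASRegular : Prop where
  connected : IsConnectedGraded 𝒜
  globalDim : ∃ n : ℕ, ∀ M : ModuleCat.{0} A, HasProjectiveDimensionLE M n
  gkDim : gkDim A < ⊤
  gorenstein : ∃ d : ℕ, injectiveDimension (ModuleCat.of A A) = d ∧
    (∀ i : ℕ, i ≠ d → Subsingleton (Abelian.Ext (trivialModule 𝒜) (ModuleCat.of A A) i)) ∧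
    Module.finrank ℂ (Abelian.Ext (trivialModule 𝒜) (ModuleCat.of A A) d) = 1 ∧
    ∀ a ∈ augIdeal 𝒜, ∀ e : Abelian.Ext (trivialModule 𝒜) (ModuleCat.of A A) d,
      e.comp (Abelian.Ext.mk₀ (rightMul a)) (add_zero d) = 0

/-- The graded algebra `A` is Artin–Schelter regular: the conditions hold for left modules and for
right modules, that is, for left modules over the opposite algebra. -/
def IsASRegular : Prop :=
  IsLeftASRegular 𝒜 ∧
    IsLeftASRegular (fun n => (𝒜 n).map (MulOpposite.opLinearEquiv ℂ : A ≃ₗ[ℂ] Aᵐᵒᵖ).toLinearMap)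

end ASRegular

section Ore

variable {R : Type} [Ring R] [Algebra ℂ R]

/-- A copy of `R` on which the monoid `ℕ` acts through the powers of `σ`. -/
def Twisted (_σ : R →ₐ[ℂ] R) : Type := R

instance (σ : R →ₐ[ℂ] R) : Ring (Twisted σ) := inferInstanceAs (Ring R)

instance (σ : R →ₐ[ℂ] R) : Algebra ℂ (Twisted σ) := inferInstanceAs (Algebra ℂ R)

/-- The identity map. -/
def Twisted.of (σ : R →ₐ[ℂ] R) : R ≃ₐ[ℂ] Twisted σ := AlgEquiv.refl

instance (σ : R →ₐ[ℂ] R) : MulSemiringAction (Multiplicative ℕ) (Twisted σ) where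
  smul n r := (σ ^ n.toAdd : R →ₐ[ℂ] R) r
  one_smul r := by rfl
  mul_smul m n r := congrArg (fun f : R →ₐ[ℂ] R => f r) (pow_add σ m.toAdd n.toAdd)
  smul_zero n := map_zero (σ ^ n.toAdd : R →ₐ[ℂ] R)
  smul_add n r s := map_add (σ ^ n.toAdd : R →ₐ[ℂ] R) r s
  smul_one n := map_one (σ ^ n.toAdd : R →ₐ[ℂ] R)
  smul_mul n r s := map_mul (σ ^ n.toAdd : R →ₐ[ℂ] R) r s

instance (σ : R →ₐ[ℂ] R) : SMulCommClass (Multiplicative ℕ) ℂ (Twisted σ) where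
  smul_comm n c r := map_smul (σ ^ n.toAdd : R →ₐ[ℂ] R) c r

/-- The Ore extension `R[t; σ]`, with the multiplication rule `t r = σ(r) t`. -/
abbrev OreExt (σ : R →ₐ[ℂ] R) : Type := SkewPolynomial (Twisted σ)

theorem OreExt.X_mul (σ : R →ₐ[ℂ] R) (r : R) :
    (SkewPolynomial.X * SkewPolynomial.C (Twisted.of σ r) : OreExt σ) =
      SkewPolynomial.C (Twisted.of σ (σ r)) * SkewPolynomial.X := by
  rw [← SkewPolynomial.monomial_zero_left, ← SkewPolynomial.monomial_zero_left,
    SkewPolynomial.X_mul_monomial, SkewPolynomial.monomial_mul_X]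
  rfl

end Ore

section Quadratic

/-- The quadratic relations `uv + i vu`, `uv - i vu`, `u² + v²`, `u² - v²`. -/
inductive QuadRel
  | uvAdd
  | uvSub
  | sqAdd
  | sqSub

open FreeAlgebra in
/-- The relation `r`, in the free algebra on `u = ι 0` and `v = ι 1`. -/
def QuadRel.poly : QuadRel → FreeAlgebra ℂ (Fin 2)
  | .uvAdd => ι ℂ 0 * ι ℂ 1 + Complex.I • (ι ℂ 1 * ι ℂ 0)
  | .uvSub => ι ℂ 0 * ι ℂ 1 - Complex.I • (ι ℂ 1 * ι ℂ 0)
  | .sqAdd => ι ℂ 0 ^ 2 + ι ℂ 1 ^ 2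
  | .sqSub => ι ℂ 0 ^ 2 - ι ℂ 1 ^ 2

/-- The relation `r = 0`. -/
def QuadRel.Rel (s : QuadRel) : FreeAlgebra ℂ (Fin 2) → FreeAlgebra ℂ (Fin 2) → Prop :=
  fun p q => p = s.poly ∧ q = 0

/-- The algebra `ℂ⟨u, v⟩ / (r)`. -/
def QuadAlg (s : QuadRel) : Type := RingQuot s.Rel

instance (s : QuadRel) : Ring (QuadAlg s) := inferInstanceAs (Ring (RingQuot s.Rel))

instance (s : QuadRel) : Algebra ℂ (QuadAlg s) := inferInstanceAs (Algebra ℂ (RingQuot s.Rel))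

/-- The quotient map from the free algebra. -/
def QuadAlg.mk (s : QuadRel) : FreeAlgebra ℂ (Fin 2) →ₐ[ℂ] QuadAlg s := RingQuot.mkAlgHom ℂ s.Rel

theorem QuadAlg.mk_poly (s : QuadRel) : QuadAlg.mk s s.poly = 0 :=
  (RingQuot.mkAlgHom_rel ℂ (s := QuadRel.Rel s) (x := s.poly) (y := 0) ⟨rfl, rfl⟩).trans
    (map_zero _)

/-- The generators `u` and `v`. -/
def QuadAlg.gen (s : QuadRel) (k : Fin 2) : QuadAlg s := QuadAlg.mk s (FreeAlgebra.ι ℂ k)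

/-- The entries of the diagonal matrix `σ = diag(α, (-1)^(a+1) α)`. -/
def sigmaEntry (α : ℂ) (a : Fin 2) : Fin 2 → ℂ := ![α, (-1) ^ ((a : ℕ) + 1) * α]

/-- The endomorphism of the free algebra given by `σ`. -/
def freeSigma (α : ℂ) (a : Fin 2) : FreeAlgebra ℂ (Fin 2) →ₐ[ℂ] FreeAlgebra ℂ (Fin 2) :=
  FreeAlgebra.lift ℂ (fun k => sigmaEntry α a k • FreeAlgebra.ι ℂ k)

theorem freeSigma_poly (s : QuadRel) (α : ℂ) (a : Fin 2) :
    ∃ c : ℂ, freeSigma α a s.poly = c • s.poly := by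
  have h : ((-1 : ℂ) ^ ((a : ℕ) + 1)) ^ 2 = 1 := by rw [← pow_mul, mul_comm, pow_mul]; simp
  have e : ((-1 : ℂ) ^ ((a : ℕ) + 1) * α) ^ 2 = α ^ 2 := by rw [mul_pow, h, one_mul]
  cases s
  · refine ⟨sigmaEntry α a 0 * sigmaEntry α a 1, ?_⟩
    simp only [freeSigma, QuadRel.poly, map_add, map_mul, map_smul, FreeAlgebra.lift_ι_apply,
      smul_mul_smul_comm]
    module
  · refine ⟨sigmaEntry α a 0 * sigmaEntry α a 1, ?_⟩
    simp only [freeSigma, QuadRel.poly, map_sub, map_mul, map_smul, FreeAlgebra.lift_ι_apply,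
      smul_mul_smul_comm]
    module
  · refine ⟨α ^ 2, ?_⟩
    simp [freeSigma, QuadRel.poly, sigmaEntry, smul_pow, e]
  · refine ⟨α ^ 2, ?_⟩
    simp [freeSigma, QuadRel.poly, sigmaEntry, smul_pow, e, smul_sub]

/-- The map `σ` on `ℂ⟨u, v⟩ / (r)`, with `σ(u) = α u` and `σ(v) = (-1)^(a+1) α v`. -/
def sigma (s : QuadRel) (α : ℂ) (a : Fin 2) : QuadAlg s →ₐ[ℂ] QuadAlg s :=
  RingQuot.liftAlgHom ℂ ⟨(QuadAlg.mk s).comp (freeSigma α a), by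
    rintro p q ⟨rfl, rfl⟩
    obtain ⟨c, hc⟩ := freeSigma_poly s α a
    rw [AlgHom.comp_apply, hc, map_smul, QuadAlg.mk_poly, smul_zero, map_zero]⟩

theorem sigma_gen (s : QuadRel) (α : ℂ) (a k : Fin 2) :
    sigma s α a (QuadAlg.gen s k) = sigmaEntry α a k • QuadAlg.gen s k := by
  refine (RingQuot.liftAlgHom_mkAlgHom_apply ℂ _ _ _).trans ?_
  simp [freeSigma, QuadAlg.gen]

/-- The algebra `A = (ℂ⟨u, v⟩ / (r))[t; σ]`. -/
abbrev ThreeAlg (s : QuadRel) (α : ℂ) (a : Fin 2) : Type := OreExt (sigma s α a)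

namespace ThreeAlg

variable (s : QuadRel) (α : ℂ) (a : Fin 2)

/-- The generator `u`. -/
def u : ThreeAlg s α a := SkewPolynomial.C (Twisted.of _ (QuadAlg.gen s 0))

/-- The generator `v`. -/
def v : ThreeAlg s α a := SkewPolynomial.C (Twisted.of _ (QuadAlg.gen s 1))

/-- The generator `t`. -/
def t : ThreeAlg s α a := SkewPolynomial.X

/-- The homogeneous component of degree `n`, where `u`, `v`, `t` have degree one. -/
def deg (n : ℕ) : Submodule ℂ (ThreeAlg s α a) :=
  Submodule.span ℂ {u s α a, v s α a, t s α a} ^ n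

end ThreeAlg

end Quadratic

end

/-!
The proof has three independent parts.

*Regularity.* In suitable linear combinations `p`, `q` of `u` and `v` the relation `r` becomes
`q p = λ p q` with `λ ≠ 0`. So `A` is an iterated Ore extension `ℂ[p][q; σ₂][t; σ]`
(`ThreeAlg.isOreTower`), and the conditions of Artin and Schelter are proved for every such tower
(`IsOreTower.isLeftASRegular`). Ore extensions are treated through their universal property
(`IsOreExtension`), which is symmetric under passage to the opposite algebra; this reduces the
conditions for right modules to those for left modules. The global dimension rises by at most one in
each step, because every module `M` over `R[t; σ]` has a resolution
`0 → Ind(M^σ) → Ind(M) → M → 0` by induced modules. The extension groups `Ext(ℂ, A)` are computed by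
killing the variables `t`, `q`, `p` one after the other: the quotient of `A` by the first few of them
has extension groups in a single degree only, where they form a cyclic right `A`-module, and the
annihilator of the generator is followed through the connecting homomorphisms
(`isExtGenerator_next`). In the end the annihilator is the augmentation ideal. The Gelfand–Kirillov
dimension is finite because the monomials `p^i q^j t^k` span.

*The action.* Linear maps from `H` to `A` form an algebra under convolution, on which `H` acts by
translation. A module algebra structure on `A` is the same as a suitable algebra homomorphism from
`A` to this convolution algebra (`exists_isModuleAlgebra`), and such a homomorphism is determined by
the images of `u`, `v`, `t`. That these images satisfy the relations of `A` follows without a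
computation with elements of `H`: the three relations span a subspace that is stable under
translations (`Kashina.IsBasicTriple.relations_mem`), and they hold after evaluation at `1`.

*Inner-faithfulness.* The functionals on `H` that vanish on a Hopf ideal are closed under
convolution. The diagonal matrix entries of `π_i` and the character of the one-dimensional
representation generate, under convolution, functionals that vanish at `w` and restrict to all eight
characters of the group `{x^a y^b z^c}`. Since `H` is spanned by the group and its translate by `w`,
and `w` is invertible, a Hopf ideal on which all of them vanish is zero
(`Kashina.eq_bot_of_isWeightFunctional`).
-/

/-! ### Ore extensions and induced modules -/

section OreExtension

variable {k : Type} [CommRing k] {R A : Type} [Ring R] [Algebra k R] [Ring A] [Algebra k A]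

/-- The algebra `A` is the Ore extension `R[t; σ]` of the automorphism type, by way of the structure
map `φ : R → A`: it is generated by `φ R` and `t`, the rule `t r = σ(r) t` holds, and `A` is
universal with this property among the `k`-algebras. -/
structure IsOreExtension (φ : R →ₐ[k] A) (t : A) (σ : R ≃ₐ[k] R) : Prop where
  comm : ∀ r, t * φ r = φ (σ r) * t
  adjoin_eq_top : Algebra.adjoin k (insert t (Set.range φ)) = ⊤
  exists_lift : ∀ {S : Type} [Ring S] [Algebra k S] (f : R →ₐ[k] S) (x : S),
    (∀ r, x * f r = f (σ r) * x) → ∃ g : A →ₐ[k] S, (∀ r, g (φ r) = f r) ∧ g t = x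

namespace IsOreExtension

variable {φ : R →ₐ[k] A} {t : A} {σ : R ≃ₐ[k] R} (h : IsOreExtension φ t σ)
include h

theorem induction {p : A → Prop} (hφ : ∀ r, p (φ r)) (ht : p t)
    (add : ∀ a b, p a → p b → p (a + b)) (mul : ∀ a b, p a → p b → p (a * b)) (a : A) : p a := by
  have ha : a ∈ Algebra.adjoin k (insert t (Set.range φ)) := h.adjoin_eq_top ▸ Algebra.mem_top
  induction ha using Algebra.adjoin_induction with
  | mem x hx =>
    rcases hx with rfl | ⟨r, rfl⟩
    exacts [ht, hφ r]
  | algebraMap c => simpa using hφ (algebraMap k R c)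
  | add x y _ _ hx hy => exact add x y hx hy
  | mul x y _ _ hx hy => exact mul x y hx hy

theorem comm_symm (r : R) : φ r * t = t * φ (σ.symm r) := by simp [h.comm]

theorem comm_symm_pow (r : R) (n : ℕ) : φ r * t ^ n = t ^ n * φ ((σ.symm ^ n) r) := by
  induction n with
  | zero => simp
  | succ n ih =>
    rw [pow_succ, ← mul_assoc, ih, mul_assoc, h.comm_symm, ← mul_assoc, pow_succ']
    rfl

omit h in
theorem map_op_comm {S : Type} [Ring S] [Algebra k S] (f : Rᵐᵒᵖ →ₐ[k] S) (x : S)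
    (hx : ∀ r, x * f r = f (AlgEquiv.op σ.symm r) * x) (r : R) :
    MulOpposite.op x * AlgHom.opComm.symm f r = AlgHom.opComm.symm f (σ r) * MulOpposite.op x := by
  apply MulOpposite.unop_injective
  have := hx (MulOpposite.op (σ r))
  simpa using this.symm

/-- The opposite of the Ore extension `R[t; σ]` is the Ore extension `Rᵒᵖ[t; σ⁻¹]`. -/
theorem op : IsOreExtension (AlgHom.op φ) (MulOpposite.op t) (AlgEquiv.op σ.symm) where
  comm r := by
    apply MulOpposite.unop_injective
    simpa using h.comm_symm r.unop
  adjoin_eq_top := by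
    rw [eq_top_iff]
    rintro ⟨a⟩ -
    change MulOpposite.op a ∈ _
    induction a using h.induction with
    | hφ r => exact Algebra.subset_adjoin (Or.inr ⟨MulOpposite.op r, rfl⟩)
    | ht => exact Algebra.subset_adjoin (Or.inl rfl)
    | add a b ha hb => exact add_mem ha hb
    | mul a b ha hb => exact mul_mem hb ha
  exists_lift f x hx := by
    obtain ⟨g, hg, hgt⟩ := h.exists_lift (AlgHom.opComm.symm f) (MulOpposite.op x) (map_op_comm f x hx)
    refine ⟨AlgHom.opComm g, fun r => ?_, ?_⟩
    · exact congrArg MulOpposite.unop (hg r.unop)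
    · exact congrArg MulOpposite.unop hgt

end IsOreExtension

variable {φ : R →ₐ[k] A} {t : A} {σ : R ≃ₐ[k] R}

/-- The action of `R` on `N[t] = ⨁ tⁿ N`, where `r tⁿ x = tⁿ σ⁻ⁿ(r) x`. -/
noncomputable def inducedSMul (σ : R ≃ₐ[k] R) (N : Type) [AddCommGroup N] [Module R N] [Module k N]
    [IsScalarTower k R N] : R →ₐ[k] Module.End k (ℕ →₀ N) where
  toFun r := Finsupp.lsum k fun n =>
    Finsupp.lsingle n ∘ₗ Algebra.lsmul k k N ((σ.symm ^ n : R ≃ₐ[k] R) r)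
  map_one' := by ext; simp
  map_mul' r s := by ext; simp
  map_zero' := by ext; simp
  map_add' r s := by ext; simp
  commutes' c := by ext n x m; simp [Module.algebraMap_end_apply, Finsupp.single_apply]

theorem inducedSMul_single (σ : R ≃ₐ[k] R) (N : Type) [AddCommGroup N] [Module R N] [Module k N]
    [IsScalarTower k R N] (r : R) (n : ℕ) (x : N) :
    inducedSMul σ N r (Finsupp.single n x) =
      Finsupp.single n ((σ.symm ^ n : R ≃ₐ[k] R) r • x) := by
  simp [inducedSMul]

theorem exists_inducedAction (h : IsOreExtension φ t σ) (N : Type) [AddCommGroup N] [Module R N]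
    [Module k N] [IsScalarTower k R N] : ∃ g : A →ₐ[k] Module.End k (ℕ →₀ N),
      (∀ r, g (φ r) = inducedSMul σ N r) ∧ g t = Finsupp.lmapDomain N k (· + 1) := by
  refine h.exists_lift (inducedSMul σ N) _ fun r => ?_
  ext n x : 3
  have : (σ.symm ^ (n + 1) : R ≃ₐ[k] R) (σ r) = (σ.symm ^ n : R ≃ₐ[k] R) r := by
    rw [pow_succ, AlgEquiv.mul_apply, AlgEquiv.symm_apply_apply]
  simp [inducedSMul_single, this]

/-- The `A`-module `A ⊗_R N = N[t]` induced from an `R`-module `N`; the function `f` stands for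
`∑ tⁿ f(n)`. -/
def Induced (_h : IsOreExtension φ t σ) (N : Type) [AddCommGroup N] : Type := ℕ →₀ N

namespace Induced

variable (h : IsOreExtension φ t σ) (N : Type) [AddCommGroup N] [Module R N]

noncomputable instance : AddCommGroup (Induced h N) := inferInstanceAs (AddCommGroup (ℕ →₀ N))

/-- The action of `A` on the induced module. -/
noncomputable def act : A →+* AddMonoid.End (ℕ →₀ N) :=
  letI : Module k N := Module.compHom N (algebraMap k R)
  haveI : IsScalarTower k R N := ⟨fun c r x => by
    rw [Algebra.smul_def, mul_smul]; rfl⟩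
  (Module.toAddMonoidEnd (Module.End k (ℕ →₀ N)) (ℕ →₀ N)).comp
    (exists_inducedAction h N).choose.toRingHom

noncomputable instance : Module A (Induced h N) := Module.compHom (ℕ →₀ N) (act h N)

variable {N}

/-- The element `tⁿ x` of the induced module. -/
noncomputable def single (n : ℕ) : N →+ Induced h N := Finsupp.singleAddHom n

theorem map_smul_single (r : R) (n : ℕ) (x : N) :
    φ r • single h n x = single h n ((σ.symm ^ n : R ≃ₐ[k] R) r • x) := by
  let : Module k N := Module.compHom N (algebraMap k R)
  have : IsScalarTower k R N := ⟨fun c r x => by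
    rw [Algebra.smul_def, mul_smul]; rfl⟩
  refine Eq.trans ?_ (inducedSMul_single σ N r n x)
  rw [← (exists_inducedAction h N).choose_spec.1]
  rfl

theorem smul_single (n : ℕ) (x : N) : t • single h n x = single h (n + 1) x := by
  let : Module k N := Module.compHom N (algebraMap k R)
  have : IsScalarTower k R N := ⟨fun c r x => by
    rw [Algebra.smul_def, mul_smul]; rfl⟩
  have := (exists_inducedAction h N).choose_spec.2
  have h2 : (exists_inducedAction h N).choose t (Finsupp.single n x) = Finsupp.single (n + 1) x := by
    rw [this]; simp
  exact h2

theorem pow_smul_single (n : ℕ) (x : N) : t ^ n • single h 0 x = single h n x := by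
  induction n with
  | zero => simp
  | succ n ih => rw [pow_succ', mul_smul, ih, smul_single]

variable {h} in
omit [Module R N] in
theorem induction_on {p : Induced h N → Prop} (f : Induced h N) (zero : p 0)
    (single : ∀ n x, p (single h n x)) (add : ∀ f g, p f → p g → p (f + g)) : p f :=
  Finsupp.induction_linear (motive := p) f zero add single

section lift

variable {M : Type} [AddCommGroup M] [Module A M]

/-- The additive map `∑ tⁿ xₙ ↦ ∑ tⁿ g(xₙ)`. -/
noncomputable def liftAux (g : N →+ M) : Induced h N →+ M :=
  Finsupp.liftAddHom fun n => (DistribSMul.toAddMonoidHom M (t ^ n)).comp g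

omit [Module R N] in
theorem liftAux_single (g : N →+ M) (n : ℕ) (x : N) :
    liftAux h g (single h n x) = t ^ n • g x :=
  Finsupp.liftAddHom_apply_single _ _ _

/-- The universal property of the induced module. -/
noncomputable def lift (g : N →ₛₗ[(φ : R →+* A)] M) : Induced h N →ₗ[A] M where
  __ := liftAux h g.toAddMonoidHom
  map_smul' a f := by
    change liftAux h g.toAddMonoidHom (a • f) = a • liftAux h g.toAddMonoidHom f
    induction a using h.induction generalizing f with
    | hφ r =>
      induction f using induction_on with
      | zero => simp
      | single n x =>
        rw [map_smul_single, liftAux_single, liftAux_single, smul_smul, h.comm_symm_pow, mul_smul]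
        exact congrArg _ (g.map_smulₛₗ _ _)
      | add f f' h1 h2 => simp only [smul_add, map_add, h1, h2]
    | ht =>
      induction f using induction_on with
      | zero => simp
      | single n x => rw [smul_single, liftAux_single, liftAux_single, smul_smul, pow_succ']
      | add f f' h1 h2 => simp only [smul_add, map_add, h1, h2]
    | add a b h1 h2 => rw [add_smul, map_add, h1, h2, add_smul]
    | mul a b h1 h2 => rw [mul_smul, h1, h2, mul_smul]

theorem lift_single (g : N →ₛₗ[(φ : R →+* A)] M) (n : ℕ) (x : N) :
    lift h g (single h n x) = t ^ n • g x :=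
  liftAux_single h _ n x

variable {h} in
theorem hom_ext {f g : Induced h N →ₗ[A] M} (hfg : ∀ x, f (single h 0 x) = g (single h 0 x)) :
    f = g := by
  ext a
  induction a using induction_on with
  | zero => simp
  | single n x => rw [← pow_smul_single, map_smul, map_smul, hfg]
  | add a b h1 h2 => rw [map_add, map_add, h1, h2]

end lift

/-- The inclusion of `N` into the induced module. -/
noncomputable def incl (N : Type) [AddCommGroup N] [Module R N] :
    N →ₛₗ[(φ : R →+* A)] Induced h N where
  __ := single h 0
  map_smul' r x := by
    have := map_smul_single h r 0 x
    simpa using this.symm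

/-- The functoriality of the induced module. -/
noncomputable def map {N' : Type} [AddCommGroup N'] [Module R N'] (g : N →ₗ[R] N') :
    Induced h N →ₗ[A] Induced h N' :=
  lift h ((incl h N').comp g)

theorem map_single {N' : Type} [AddCommGroup N'] [Module R N'] (g : N →ₗ[R] N') (n : ℕ) (x : N) :
    map h g (single h n x) = single h n (g x) :=
  (lift_single h _ n x).trans (pow_smul_single h n (g x))

/-- Induction preserves projectivity, since restriction of scalars preserves surjections. -/
theorem projective [Module.Projective R N] : Module.Projective A (Induced h N) := by
  apply Module.Projective.of_lifting_property''
  intro f hf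
  let : Module R (Induced h N →₀ A) := Module.compHom _ (φ : R →+* A)
  let : Module R (Induced h N) := Module.compHom _ (φ : R →+* A)
  let f' : (Induced h N →₀ A) →ₗ[R] Induced h N := { f with map_smul' := fun r x => f.map_smul _ _ }
  let i' : N →ₗ[R] Induced h N := { incl h N with map_smul' := fun r x => (incl h N).map_smulₛₗ r x }
  obtain ⟨g, hg⟩ := Module.projective_lifting_property f' i' hf
  let g' : N →ₛₗ[(φ : R →+* A)] (Induced h N →₀ A) :=
    { g with map_smul' := fun r x => g.map_smul r x }
  refine ⟨lift h g', hom_ext fun x => ?_⟩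
  rw [LinearMap.comp_apply, lift_single, pow_zero, one_smul]
  exact congr($hg x)

end Induced

end OreExtension

/-! ### Global dimension of an Ore extension -/

section OreGlobalDimension

open CategoryTheory

variable {k : Type} [CommRing k] {R A : Type} [Ring R] [Algebra k R] [Ring A] [Algebra k A]
  {φ : R →ₐ[k] A} {t : A} {σ : R ≃ₐ[k] R}

namespace Induced

variable (h : IsOreExtension φ t σ) {N : Type} [AddCommGroup N] [Module R N]

theorem map_comp_zero {N' N'' : Type} [AddCommGroup N'] [Module R N'] [AddCommGroup N'']
    [Module R N''] (f : N →ₗ[R] N') (g : N' →ₗ[R] N'') (hfg : g.comp f = 0) :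
    (map h g).comp (map h f) = 0 := by
  refine hom_ext fun x => ?_
  rw [LinearMap.comp_apply, map_single, map_single, LinearMap.zero_apply]
  exact (congrArg _ congr($hfg x)).trans (map_zero _)

variable {h} in
/-- The coefficient of `tⁿ`. -/
noncomputable def coeff (n : ℕ) : Induced h N →+ N := Finsupp.applyAddHom n

omit [Module R N] in
theorem coeff_single (m n : ℕ) (x : N) : coeff n (single h m x) = if m = n then x else 0 :=
  Finsupp.single_apply

omit [Module R N] in
variable {h} in
theorem coeff_ext {f g : Induced h N} (hfg : ∀ n, coeff n f = coeff n g) : f = g :=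
  Finsupp.ext hfg

omit [Module R N] in
variable {h} in
theorem exists_coeff_eq_zero (f : Induced h N) : ∃ b, ∀ n, b ≤ n → coeff n f = 0 := by
  obtain ⟨b, hb⟩ := (show ℕ →₀ N from f).support.exists_nat_subset_range
  exact ⟨b, fun n hn => Finsupp.notMem_support_iff.1 fun hm =>
    (Finset.mem_range.1 (hb hm)).not_ge hn⟩

omit [Module R N] in
/-- Finitely many coefficients may be prescribed at will. -/
theorem exists_coeff_eq (x : ℕ → N) (b : ℕ) (hx : ∀ n, b ≤ n → x n = 0) :
    ∃ f : Induced h N, ∀ n, coeff n f = x n :=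
  ⟨Finsupp.onFinset (Finset.range b) x fun n hn =>
    Finset.mem_range.2 (not_le.1 fun hb => hn (hx n hb)), fun _ => rfl⟩

theorem coeff_map {N' : Type} [AddCommGroup N'] [Module R N'] (g : N →ₗ[R] N')
    (f : Induced h N) (n : ℕ) : coeff n (map h g f) = g (coeff n f) := by
  induction f using induction_on with
  | zero => simp
  | single m x =>
    rw [map_single, coeff_single, coeff_single]
    split_ifs <;> simp
  | add a b h1 h2 => simp only [map_add, h1, h2]

/-- Induction is exact. -/
theorem shortExact {S : ShortComplex (ModuleCat.{0} R)} (hS : S.ShortExact) :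
    (ShortComplex.mk (ModuleCat.ofHom (map h S.f.hom)) (ModuleCat.ofHom (map h S.g.hom)) (by
      rw [← ModuleCat.ofHom_comp, map_comp_zero h _ _
        (by rw [← ModuleCat.hom_comp, S.zero, ModuleCat.hom_zero])]; rfl)).ShortExact := by
  have hf : Function.Injective S.f.hom := (ModuleCat.mono_iff_injective _).1 hS.mono_f
  have hg : Function.Surjective S.g.hom := (ModuleCat.epi_iff_surjective _).1 hS.epi_g
  have he := (ShortComplex.ShortExact.moduleCat_exact_iff_function_exact S).1 hS.exact
  refine ShortComplex.ShortExact.mk' ?_ ((ModuleCat.mono_iff_injective _).2 ?_)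
    ((ModuleCat.epi_iff_surjective _).2 ?_)
  · refine (ShortComplex.ShortExact.moduleCat_exact_iff_function_exact _).2
      fun (y : Induced h S.X₂) => ⟨fun hy => ?_, ?_⟩
    · have hy' : map h S.g.hom y = 0 := hy
      have hy2 : ∀ n, S.g.hom (coeff n y) = 0 := fun n => by rw [← coeff_map h, hy', map_zero]
      choose x hx using fun n => (he _).1 (hy2 n)
      obtain ⟨b, hb⟩ := exists_coeff_eq_zero y
      obtain ⟨f, hf'⟩ := exists_coeff_eq h x b fun n hn =>
        hf ((hx n).trans ((hb n hn).trans (map_zero _).symm))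
      refine ⟨f, coeff_ext fun n => ?_⟩
      exact (coeff_map h S.f.hom f n).trans ((congrArg _ (hf' n)).trans (hx n))
    · rintro ⟨x, rfl⟩
      have := map_comp_zero h S.f.hom S.g.hom
        (by rw [← ModuleCat.hom_comp, S.zero, ModuleCat.hom_zero])
      exact congr($this x)
  · intro (x : Induced h S.X₁) (y : Induced h S.X₁) hxy
    refine coeff_ext fun n => hf ?_
    rw [← coeff_map h S.f.hom, ← coeff_map h S.f.hom]
    exact congrArg _ hxy
  · intro (y : Induced h S.X₃)
    choose x hx using fun n => hg (coeff n y)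
    obtain ⟨b, hb⟩ := exists_coeff_eq_zero y
    obtain ⟨f, hf'⟩ := exists_coeff_eq h (fun n => if n < b then x n else 0) b
      fun n hn => if_neg (by omega)
    refine ⟨f, coeff_ext fun n => (coeff_map h S.g.hom f n).trans ?_⟩
    rw [hf']
    split_ifs with hn
    · exact hx n
    · rw [map_zero, hb n (by omega)]

theorem hasProjectiveDimensionLE (d : ℕ) (N : ModuleCat.{0} R) (hN : HasProjectiveDimensionLE N d) :
    HasProjectiveDimensionLE (ModuleCat.of A (Induced h N)) d := by
  induction d generalizing N with
  | zero =>
    rw [← projective_iff_hasProjectiveDimensionLE_zero] at hN ⊢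
    have := (IsProjective.iff_projective (R := R) N).2 hN
    exact (IsProjective.iff_projective (R := A) (Induced h N)).1 (projective h)
  | succ d ih =>
    have hS := ModuleCat.shortExact_projectiveShortComplex N
    have h1 : HasProjectiveDimensionLE N.projectiveShortComplex.X₁ d :=
      hS.hasProjectiveDimensionLT_X₁ (d + 1)
        (hasProjectiveDimensionLT_of_ge _ 1 (d + 1) (by omega)) hN
    have := Module.Projective.of_free (R := R) (P := N.projectiveShortComplex.X₂)
    have h2 := projective h (N := N.projectiveShortComplex.X₂)
    have h3 := (IsProjective.iff_projective (R := A) (Induced h N.projectiveShortComplex.X₂)).1 h2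
    exact (shortExact h hS).hasProjectiveDimensionLT_X₃ (d + 1) (ih _ h1)
      (hasProjectiveDimensionLT_of_ge
        (ModuleCat.of A (Induced h N.projectiveShortComplex.X₂)) 1 (d + 2) (by omega))

section resolution

/-! In the standard resolution of an `A`-module `M`, two `R`-modules have the underlying group `M`:
`N`, on which `R` acts through `φ`, and `N'`, on which it acts through `φ ∘ σ⁻¹`. -/

variable {M N' : Type} [AddCommGroup M] [Module A M] [AddCommGroup N'] [Module R N']
  (e : N ≃+ M) (he : ∀ (r : R) (x : N), e (r • x) = φ r • e x)
  (e' : N' ≃+ M) (he' : ∀ (r : R) (x : N'), e' (r • x) = φ (σ.symm r) • e' x)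

/-- The counit `∑ tⁿ ⊗ xₙ ↦ ∑ tⁿ xₙ`. -/
noncomputable def counit : Induced h N →ₗ[A] M :=
  lift h { (e : N →+ M) with map_smul' := he }

theorem counit_single (n : ℕ) (x : N) : counit h e he (single h n x) = t ^ n • e x :=
  lift_single h _ n x

include he in
theorem symm_smul (r : R) (y : M) : e.symm (φ r • y) = r • e.symm y := by
  rw [AddEquiv.symm_apply_eq, he, AddEquiv.apply_symm_apply]

/-- The map `tⁿ ⊗ x ↦ tⁿ⁺¹ ⊗ x - tⁿ ⊗ t x`. -/
noncomputable def diff : Induced h N' →ₗ[A] Induced h N :=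
  lift h
    { toFun := fun x => single h 1 (e.symm (e' x)) - single h 0 (e.symm (t • e' x))
      map_add' := fun x y => by simp only [map_add, smul_add]; abel
      map_smul' := fun r x => by
        change _ = φ r • _
        rw [smul_sub, map_smul_single, map_smul_single, he', symm_smul e he, smul_smul, h.comm,
          AlgEquiv.apply_symm_apply, mul_smul, symm_smul e he]
        simp }

theorem diff_single (n : ℕ) (x : N') :
    diff h e he e' he' (single h n x) =
      single h (n + 1) (e.symm (e' x)) - single h n (e.symm (t • e' x)) := by
  refine (lift_single h _ n _).trans ?_
  change t ^ n • (single h 1 _ - single h 0 _) = _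
  rw [smul_sub, pow_smul_single, ← pow_smul_single h 1, smul_smul, ← pow_add, pow_smul_single]

theorem coeff_diff (f : Induced h N') (n : ℕ) :
    e (coeff (n + 1) (diff h e he e' he' f)) = e' (coeff n f) - t • e' (coeff (n + 1) f) := by
  induction f using induction_on with
  | zero => simp
  | single m x =>
    rw [diff_single, map_sub, map_sub, coeff_single, coeff_single, coeff_single, coeff_single]
    simp only [Nat.add_right_cancel_iff]
    split_ifs <;> simp
  | add f g h1 h2 => simp only [map_add, h1, h2, smul_add]; abel

theorem diff_injective : Function.Injective (diff h e he e' he') := by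
  rw [injective_iff_map_eq_zero]
  intro f hf
  have h1 : ∀ n, e' (coeff n f) = t • e' (coeff (n + 1) f) := fun n => by
    rw [← sub_eq_zero, ← coeff_diff h e he e' he', hf, map_zero, map_zero]
  have h2 : ∀ m n, e' (coeff n f) = t ^ m • e' (coeff (n + m) f) := by
    intro m
    induction m with
    | zero => simp
    | succ m ih => intro n; rw [ih, h1 (n + m), smul_smul, pow_succ, add_assoc]
  obtain ⟨b, hb⟩ := exists_coeff_eq_zero f
  refine coeff_ext fun n => e'.injective ?_
  rw [h2 b n, hb _ (Nat.le_add_left b n), map_zero, smul_zero, map_zero, map_zero]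

theorem exists_eq_diff_add (f : Induced h N) :
    ∃ g, f = diff h e he e' he' g + single h 0 (e.symm (counit h e he f)) := by
  induction f using induction_on with
  | zero => exact ⟨0, by simp⟩
  | single n x =>
    rw [counit_single]
    induction n generalizing x with
    | zero => exact ⟨0, by simp⟩
    | succ n ih =>
      obtain ⟨g, hg⟩ := ih (e.symm (t • e x))
      refine ⟨g + single h n (e'.symm (e x)), ?_⟩
      rw [AddEquiv.apply_symm_apply, smul_smul, ← pow_succ] at hg
      rw [map_add, diff_single, add_right_comm, AddEquiv.apply_symm_apply, ← hg,
        AddEquiv.symm_apply_apply]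
      abel
  | add f₁ f₂ h₁ h₂ =>
    obtain ⟨g₁, e₁⟩ := h₁
    obtain ⟨g₂, e₂⟩ := h₂
    refine ⟨g₁ + g₂, ?_⟩
    rw [map_add, map_add, map_add, map_add, add_add_add_comm, ← e₁, ← e₂]

theorem counit_comp_diff : (counit h e he).comp (diff h e he e' he') = 0 := by
  refine hom_ext fun x => ?_
  rw [LinearMap.comp_apply, diff_single, map_sub, counit_single, counit_single]
  simp

/-- The standard resolution `0 → A ⊗_R M^σ → A ⊗_R M → M → 0` of a module over an Ore extension. -/
theorem shortExact_diff_counit :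
    (ShortComplex.mk (ModuleCat.ofHom (diff h e he e' he')) (ModuleCat.ofHom (counit h e he)) (by
      rw [← ModuleCat.ofHom_comp, counit_comp_diff]; rfl)).ShortExact := by
  refine ShortComplex.ShortExact.mk' ?_
    ((ModuleCat.mono_iff_injective _).2 (diff_injective h e he e' he'))
    ((ModuleCat.epi_iff_surjective _).2 fun x =>
      ⟨single h 0 (e.symm x), (counit_single h e he 0 _).trans (by simp)⟩)
  refine (ShortComplex.ShortExact.moduleCat_exact_iff_function_exact _).2
    fun y => ⟨fun hy => ?_, ?_⟩
  · obtain ⟨g, hg⟩ := exists_eq_diff_add h e he e' he' y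
    rw [show counit h e he y = 0 from hy, map_zero, map_zero, add_zero] at hg
    exact ⟨g, hg.symm⟩
  · rintro ⟨x, rfl⟩
    exact congr($(counit_comp_diff h e he e' he') x)

end resolution

end Induced

/-- Passing to an Ore extension raises the global dimension by at most one. -/
theorem IsOreExtension.hasProjectiveDimensionLE_succ (h : IsOreExtension φ t σ) {d : ℕ}
    (hR : ∀ N : ModuleCat.{0} R, HasProjectiveDimensionLE N d) (M : ModuleCat.{0} A) :
    HasProjectiveDimensionLE M (d + 1) :=
  (Induced.shortExact_diff_counit h
    (N := (ModuleCat.restrictScalars (φ : R →+* A)).obj M)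
    (N' := (ModuleCat.restrictScalars ((φ : R →+* A).comp (σ.symm : R →+* R))).obj M) (M := M)
    (.refl M) (fun _ _ => rfl) (.refl M) (fun _ _ => rfl)).hasProjectiveDimensionLT_X₃ (d + 1)
      (Induced.hasProjectiveDimensionLE h d _ (hR _))
      (@hasProjectiveDimensionLT_of_ge _ _ _ _ (d + 1) (d + 2) (by omega)
        (Induced.hasProjectiveDimensionLE h d _ (hR _)))

end OreGlobalDimension

/-! ### The normal regular element of an Ore extension -/

namespace IsOreExtension

variable {k : Type} [CommRing k] {R A : Type} [Ring R] [Algebra k R] [Ring A] [Algebra k A]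
  {φ : R →ₐ[k] A} {t : A} {σ : R ≃ₐ[k] R}

/-- The variable of an Ore extension is left regular. The proof is that the module `R[t]` contains
the free module `A`, and that `t` shifts the coefficients of its elements. -/
theorem eq_zero_of_mul_eq_zero (h : IsOreExtension φ t σ) {a : A} (ha : t * a = 0) : a = 0 := by
  let Ψ : Induced h R →ₗ[A] A := Induced.lift h
    { (φ : R →+ A) with map_smul' := fun r s => by simp }
  have h1 : ∀ a : A, Ψ (a • Induced.single h 0 1) = a := fun a => by
    rw [map_smul, Induced.lift_single]
    change a • (t ^ 0 • φ 1) = a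
    simp
  rw [← h1 a]
  suffices a • Induced.single h 0 (1 : R) = 0 by rw [this, map_zero]
  have h2 : ∀ (f : Induced h R) (n : ℕ),
      Induced.coeff (n + 1) (t • f) = Induced.coeff n f := fun f n => by
    induction f using Induced.induction_on with
    | zero => simp
    | single m x => simp [Induced.smul_single, Induced.coeff_single]
    | add f g h1 h2 => simp only [smul_add, map_add, h1, h2]
  refine Induced.coeff_ext fun n => ?_
  rw [← h2, smul_smul, ha, zero_smul, map_zero, map_zero]

variable (h : IsOreExtension φ t σ)
include h

theorem eq_zero_of_mul_eq_zero' {a : A} (ha : a * t = 0) : a = 0 :=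
  MulOpposite.op_injective (h.op.eq_zero_of_mul_eq_zero (a := MulOpposite.op a)
    (congrArg MulOpposite.op ha))

/-- The homomorphism `R[t; σ] → R` that sends `t` to zero. -/
noncomputable def eval : A →ₐ[k] R :=
  (h.exists_lift (AlgHom.id k R) 0 (by simp)).choose

@[simp] theorem eval_map (r : R) : h.eval (φ r) = r :=
  (h.exists_lift (AlgHom.id k R) 0 (by simp)).choose_spec.1 r

@[simp] theorem eval_var : h.eval t = 0 :=
  (h.exists_lift (AlgHom.id k R) 0 (by simp)).choose_spec.2

/-- The automorphism `σ̂` of `R[t; σ]` that extends `σ` and fixes `t`. -/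
noncomputable def conj : A →ₐ[k] A :=
  (h.exists_lift (φ.comp (σ : R →ₐ[k] R)) t fun r => h.comm (σ r)).choose

@[simp] theorem conj_map (r : R) : h.conj (φ r) = φ (σ r) :=
  (h.exists_lift (φ.comp (σ : R →ₐ[k] R)) t fun r => h.comm (σ r)).choose_spec.1 r

@[simp] theorem conj_var : h.conj t = t :=
  (h.exists_lift (φ.comp (σ : R →ₐ[k] R)) t fun r => h.comm (σ r)).choose_spec.2

theorem mul_eq_conj_mul (a : A) : t * a = h.conj a * t := by
  induction a using h.induction with
  | hφ r => rw [conj_map, h.comm]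
  | ht => rw [conj_var]
  | add a b ha hb => rw [mul_add, ha, hb, map_add, add_mul]
  | mul a b ha hb => rw [← mul_assoc, ha, mul_assoc, hb, map_mul, mul_assoc]

theorem conj_injective : Function.Injective h.conj := by
  rw [injective_iff_map_eq_zero]
  intro a ha
  exact h.eq_zero_of_mul_eq_zero (by rw [h.mul_eq_conj_mul, ha, zero_mul])

theorem conj_surjective : Function.Surjective h.conj := by
  intro a
  induction a using h.induction with
  | hφ r => exact ⟨φ (σ.symm r), by simp⟩
  | ht => exact ⟨t, h.conj_var⟩
  | add a b ha hb =>
    obtain ⟨a, rfl⟩ := ha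
    obtain ⟨b, rfl⟩ := hb
    exact ⟨a + b, map_add _ _ _⟩
  | mul a b ha hb =>
    obtain ⟨a, rfl⟩ := ha
    obtain ⟨b, rfl⟩ := hb
    exact ⟨a * b, map_mul _ _ _⟩

theorem exists_eq_add_mul (a : A) : ∃ b, a = φ (h.eval a) + b * t := by
  induction a using h.induction with
  | hφ r => exact ⟨0, by simp⟩
  | ht => exact ⟨1, by simp⟩
  | add a b ha hb =>
    obtain ⟨a', ha⟩ := ha
    obtain ⟨b', hb⟩ := hb
    refine ⟨a' + b', ?_⟩
    rw [map_add, map_add, add_mul, add_add_add_comm, ← ha, ← hb]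
  | mul a b ha hb =>
    obtain ⟨a', ha⟩ := ha
    obtain ⟨b', hb⟩ := hb
    refine ⟨φ (h.eval a) * b' + a' * h.conj b, ?_⟩
    calc a * b = φ (h.eval a) * b + a' * t * b := by rw [← add_mul, ← ha]
      _ = φ (h.eval a) * (φ (h.eval b) + b' * t) + a' * (t * b) := by rw [← hb, mul_assoc]
      _ = _ := by rw [h.mul_eq_conj_mul, map_mul, map_mul]; noncomm_ring

theorem eval_eq_zero_iff {a : A} : h.eval a = 0 ↔ ∃ b, a = b * t := by
  constructor
  · intro ha
    obtain ⟨b, hb⟩ := h.exists_eq_add_mul a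
    exact ⟨b, by simpa [ha] using hb⟩
  · rintro ⟨b, rfl⟩
    simp

theorem eval_eq_zero_iff' {a : A} : h.eval a = 0 ↔ ∃ b, a = t * b := by
  rw [h.eval_eq_zero_iff]
  constructor
  · rintro ⟨b, rfl⟩
    obtain ⟨b, rfl⟩ := h.conj_surjective b
    exact ⟨b, (h.mul_eq_conj_mul b).symm⟩
  · rintro ⟨b, rfl⟩
    exact ⟨h.conj b, h.mul_eq_conj_mul b⟩

theorem eval_surjective : Function.Surjective h.eval := fun r => ⟨φ r, h.eval_map r⟩

end IsOreExtension

/-! ### Extension groups modulo a normal regular sequence -/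

section ExtCyclic

open CategoryTheory Abelian

variable {A : Type} [Ring A]

theorem rightMul_comp (a b : A) : rightMul a ≫ rightMul b = rightMul (a * b) := by
  ext; simp [rightMul]

theorem rightMul_sub (a b : A) : rightMul (a - b) = rightMul a - rightMul b := by
  ext; simp [rightMul]

theorem rightMul_add (a b : A) : rightMul (a + b) = rightMul a + rightMul b := by
  ext; simp [rightMul]

/-- The left module `A / I`. -/
abbrev quotModule (I : Ideal A) : ModuleCat.{0} A := ModuleCat.of A (A ⧸ I)

/-- Right multiplication by `b`, an endomorphism of the left module `A / I` when `I b ⊆ I`. -/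
def quotMul (I : Ideal A) (b : A) (hb : ∀ a ∈ I, a * b ∈ I) : quotModule I ⟶ quotModule I :=
  ModuleCat.ofHom (Submodule.mapQ I I (LinearMap.toSpanSingleton A A b) hb)

/-- The projection `A / I → A / I'`. -/
def quotProj {I I' : Ideal A} (hle : I ≤ I') : quotModule I ⟶ quotModule I' :=
  ModuleCat.ofHom (Submodule.factor hle)

theorem quotModule_hom_ext {I : Ideal A} {M : ModuleCat.{0} A} {f g : quotModule I ⟶ M}
    (h : ∀ a : A, f.hom (Submodule.Quotient.mk a) = g.hom (Submodule.Quotient.mk a)) : f = g := by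
  refine ModuleCat.hom_ext (LinearMap.ext fun x => ?_)
  obtain ⟨a, rfl⟩ := Submodule.Quotient.mk_surjective _ x
  exact h a

theorem quotMul_mk (I : Ideal A) (b : A) (hb : ∀ a ∈ I, a * b ∈ I) (a : A) :
    (quotMul I b hb).hom (Submodule.Quotient.mk a) = Submodule.Quotient.mk (a * b) := rfl

theorem quotProj_mk {I I' : Ideal A} (hle : I ≤ I') (a : A) :
    (quotProj hle).hom (Submodule.Quotient.mk a) = Submodule.Quotient.mk a := rfl

/-- The left ideal `I'` is `I + A x`, where `x` is a normal regular element modulo `I`, as far as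
multiplication from the right by `x` is concerned. -/
structure IsRegularStep (I : Ideal A) (x : A) (I' : Ideal A) : Prop where
  mul_mem : ∀ a ∈ I, a * x ∈ I
  regular : ∀ a, a * x ∈ I → a ∈ I
  le : I ≤ I'
  mem : x ∈ I'
  exists_sub_mem : ∀ a ∈ I', ∃ b, a - b * x ∈ I

namespace IsRegularStep

variable {I I' : Ideal A} {x : A} (s : IsRegularStep I x I')

/-- The complex `0 → A / I → A / I → A / I' → 0`, where the first map is multiplication by `x`. -/
abbrev complex : ShortComplex (ModuleCat.{0} A) :=
  ShortComplex.mk (quotMul I x s.mul_mem) (quotProj s.le) (quotModule_hom_ext fun a => by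
    change (quotProj s.le).hom (Submodule.Quotient.mk (a * x)) = 0
    rw [quotProj_mk, Submodule.Quotient.mk_eq_zero]
    exact I'.mul_mem_left a s.mem)

theorem shortExact : s.complex.ShortExact := by
  refine ShortComplex.ShortExact.mk' ?_ ((ModuleCat.mono_iff_injective _).2 ?_)
    ((ModuleCat.epi_iff_surjective _).2 ?_)
  · rw [ShortComplex.moduleCat_exact_iff]
    intro y hy
    obtain ⟨a, rfl⟩ := Submodule.Quotient.mk_surjective _ y
    have ha : a ∈ I' := (Submodule.Quotient.mk_eq_zero _).1 hy
    obtain ⟨b, hb⟩ := s.exists_sub_mem a ha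
    exact ⟨Submodule.Quotient.mk b, ((Submodule.Quotient.eq _).2 hb).symm⟩
  · have : Function.Injective (quotMul I x s.mul_mem).hom := by
      rw [injective_iff_map_eq_zero]
      intro y hy
      obtain ⟨a, rfl⟩ := Submodule.Quotient.mk_surjective _ y
      rw [quotMul_mk, Submodule.Quotient.mk_eq_zero] at hy
      exact (Submodule.Quotient.mk_eq_zero _).2 (s.regular a hy)
    exact this
  · intro y
    obtain ⟨a, rfl⟩ := Submodule.Quotient.mk_surjective _ y
    exact ⟨Submodule.Quotient.mk a, rfl⟩

end IsRegularStep

/-- The groups `Ext^i(A / I, A)` vanish for `i ≠ d`, and the right `A`-module `Ext^d(A / I, A)` is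
generated by `e`, with annihilator `J`. -/
structure IsExtGenerator {I : Ideal A} {d : ℕ} (e : Ext (quotModule I) (ModuleCat.of A A) d)
    (J : Set A) : Prop where
  vanish : ∀ i, i ≠ d → Subsingleton (Ext (quotModule I) (ModuleCat.of A A) i)
  exists_eq : ∀ z : Ext (quotModule I) (ModuleCat.of A A) d,
    ∃ a, z = e.comp (Ext.mk₀ (rightMul a)) (add_zero d)
  comp_eq_zero_iff : ∀ a, e.comp (Ext.mk₀ (rightMul a)) (add_zero d) = 0 ↔ a ∈ J

/-- The equation `b e = e b'` in `Ext^d(A / I, A)`, where `b` acts on `A / I` from the right. -/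
def Intertwines {I : Ideal A} {d : ℕ} (e : Ext (quotModule I) (ModuleCat.of A A) d) (b b' : A) :
    Prop :=
  ∃ hb : ∀ a ∈ I, a * b ∈ I,
    (Ext.mk₀ (quotMul I b hb)).comp e (zero_add d) = e.comp (Ext.mk₀ (rightMul b')) (add_zero d)

/-- The canonical generator of `Hom(A, A)`. -/
noncomputable def extGeneratorZero (A : Type) [Ring A] :
    Ext (quotModule (⊥ : Ideal A)) (ModuleCat.of A A) 0 :=
  Ext.mk₀ (ModuleCat.ofHom (Submodule.quotEquivOfEqBot (⊥ : Submodule A A) rfl).toLinearMap)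

theorem isExtGenerator_zero : IsExtGenerator (extGeneratorZero A) {0} where
  vanish i hi := by
    have : Module.Projective A (A ⧸ (⊥ : Ideal A)) :=
      .of_equiv (Submodule.quotEquivOfEqBot (⊥ : Submodule A A) rfl).symm
    have : Projective (quotModule (⊥ : Ideal A)) :=
      (IsProjective.iff_projective (R := A) (A ⧸ (⊥ : Ideal A))).1 this
    obtain ⟨j, rfl⟩ := Nat.exists_eq_succ_of_ne_zero hi
    exact subsingleton_of_forall_eq 0 fun z => Ext.eq_zero_of_projective z
  exists_eq z := by
    obtain ⟨f, rfl⟩ := (Ext.mk₀_bijective _ _).2 z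
    refine ⟨f.hom (Submodule.Quotient.mk 1), ?_⟩
    rw [extGeneratorZero, Ext.mk₀_comp_mk₀]
    congr 1
    refine quotModule_hom_ext fun a => ?_
    change _ = a • f.hom (Submodule.Quotient.mk 1)
    rw [← map_smul, ← Submodule.Quotient.mk_smul, smul_eq_mul, mul_one]
  comp_eq_zero_iff a := by
    rw [extGeneratorZero, Ext.mk₀_comp_mk₀, Ext.mk₀_eq_zero_iff]
    constructor
    · intro h
      have : (1 : A) * a = 0 := congr(($h).hom (Submodule.Quotient.mk 1))
      rwa [one_mul] at this
    · rintro rfl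
      refine quotModule_hom_ext fun b => ?_
      change b * 0 = 0
      exact mul_zero b

theorem intertwines_zero (b : A) : Intertwines (extGeneratorZero A) b b := by
  refine ⟨fun a ha => ?_, ?_⟩
  · rw [Ideal.mem_bot] at ha ⊢
    rw [ha, zero_mul]
  · rw [extGeneratorZero, Ext.mk₀_comp_mk₀, Ext.mk₀_comp_mk₀]
    exact congrArg _ (quotModule_hom_ext fun a => rfl)

namespace IsRegularStep

variable {I I' : Ideal A} {x : A} (s : IsRegularStep I x I') {d : ℕ}
  {e : Ext (quotModule I) (ModuleCat.of A A) d} {J : Set A}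

/-- The image of `e` under the connecting homomorphism `Ext^d(A / I, A) → Ext^(d+1)(A / I', A)`. -/
noncomputable def next (e : Ext (quotModule I) (ModuleCat.of A A) d) :
    Ext (quotModule I') (ModuleCat.of A A) (d + 1) :=
  s.shortExact.extClass.comp e (add_comm 1 d)

theorem next_comp (e : Ext (quotModule I) (ModuleCat.of A A) d) (a : A) :
    (s.next e).comp (Ext.mk₀ (rightMul a)) (add_zero (d + 1)) =
      s.next (e.comp (Ext.mk₀ (rightMul a)) (add_zero d)) :=
  Ext.comp_assoc_of_third_deg_zero _ _ _ _

/-- The long exact sequence of `0 → A / I → A / I → A / I' → 0`: if multiplication by `x` on `A / I`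
becomes left multiplication by `y` on `Ext^d(A / I, A) = A / J`, and `y` is regular on `A / J`, then
the cohomology of `A / I'` is `A / (J + y A)` in degree `d + 1`. -/
theorem isExtGenerator_next (he : IsExtGenerator e J) {y : A} (hy : Intertwines e x y)
    (hreg : ∀ a, y * a ∈ J → a ∈ J) {J' : Set A} (hJ' : ∀ a, a ∈ J' ↔ ∃ b, a - y * b ∈ J) :
    IsExtGenerator (s.next e) J' := by
  obtain ⟨hx, hy⟩ := hy
  have hf : ∀ a, (Ext.mk₀ s.complex.f).comp (e.comp (Ext.mk₀ (rightMul a)) (add_zero d))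
      (zero_add d) = e.comp (Ext.mk₀ (rightMul (y * a))) (add_zero d) := fun a => by
    rw [← rightMul_comp, ← Ext.mk₀_comp_mk₀, ← Ext.comp_assoc_of_second_deg_zero, ← hy,
      Ext.comp_assoc_of_third_deg_zero]
  have hg : ∀ i, i ≠ d + 1 → ∀ z : Ext (quotModule I') (ModuleCat.of A A) i,
      (Ext.mk₀ s.complex.g).comp z (zero_add i) = 0 := by
    intro i hi z
    by_cases hid : i = d
    · subst hid
      obtain ⟨a, ha⟩ := he.exists_eq ((Ext.mk₀ s.complex.g).comp z (zero_add i))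
      have h0 : (Ext.mk₀ s.complex.f).comp ((Ext.mk₀ s.complex.g).comp z (zero_add i))
          (zero_add i) = 0 := by
        rw [Ext.mk₀_comp_mk₀_assoc, s.complex.zero, Ext.mk₀_zero, Ext.zero_comp]
      rw [ha, hf, he.comp_eq_zero_iff] at h0
      rw [ha, he.comp_eq_zero_iff]
      exact hreg a h0
    · exact (he.vanish i hid).elim _ _
  refine ⟨fun i hi => subsingleton_of_forall_eq 0 fun z => ?_, fun z => ?_, fun a => ?_⟩
  · have := s.shortExact.epi_g
    rcases i with _ | i
    · apply Ext.precomp_mk₀_injective_of_epi _ s.complex.g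
      rw [map_zero]
      exact hg 0 hi z
    · obtain ⟨x₁, rfl⟩ := Ext.contravariant_sequence_exact₃ s.shortExact _ z (hg _ hi z)
        (add_comm 1 i)
      rw [(he.vanish i (by omega)).elim x₁ 0, Ext.comp_zero]
  · obtain ⟨x₁, rfl⟩ := Ext.contravariant_sequence_exact₃ s.shortExact _ z
      ((he.vanish (d + 1) (by omega)).elim _ _) (add_comm 1 d)
    obtain ⟨a, rfl⟩ := he.exists_eq x₁
    exact ⟨a, (s.next_comp e a).symm⟩
  · rw [s.next_comp, hJ']
    constructor
    · intro h
      obtain ⟨x₂, hx₂⟩ := Ext.contravariant_sequence_exact₁ s.shortExact _ _ (add_comm 1 d) h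
      obtain ⟨b, rfl⟩ := he.exists_eq x₂
      refine ⟨b, (he.comp_eq_zero_iff _).1 ?_⟩
      rw [rightMul_sub, sub_eq_add_neg, Ext.mk₀_add, Ext.comp_add, Ext.mk₀_neg, Ext.comp_neg,
        ← hx₂, hf, add_neg_cancel]
    · rintro ⟨b, hb⟩
      rw [← he.comp_eq_zero_iff, rightMul_sub, sub_eq_add_neg, Ext.mk₀_add, Ext.comp_add,
        Ext.mk₀_neg, Ext.comp_neg, ← sub_eq_add_neg, sub_eq_zero] at hb
      rw [hb, ← hf]
      exact s.shortExact.extClass_comp_assoc _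

theorem intertwines_next {b b₁ b' : A} (hb₁ : Intertwines e b₁ b') (hb : ∀ a ∈ I, a * b ∈ I)
    (hb' : ∀ a ∈ I', a * b ∈ I') (hx : x * b - b₁ * x ∈ I) : Intertwines (s.next e) b b' := by
  obtain ⟨h₁, he⟩ := hb₁
  refine ⟨hb', ?_⟩
  let f : s.complex ⟶ s.complex :=
    { τ₁ := quotMul I b₁ h₁
      τ₂ := quotMul I b hb
      τ₃ := quotMul I' b hb'
      comm₁₂ := quotModule_hom_ext fun a => ((Submodule.Quotient.eq _).2 (by
        have := I.mul_mem_left a hx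
        rwa [mul_sub, ← mul_assoc, ← mul_assoc] at this)).symm
      comm₂₃ := quotModule_hom_ext fun a => rfl }
  have h := ShortComplex.ShortExact.extClass_naturality s.shortExact s.shortExact f
  have h2 : (Ext.mk₀ (quotMul I' b hb')).comp (s.next e) (zero_add (d + 1)) =
      s.next ((Ext.mk₀ (quotMul I b₁ h₁)).comp e (zero_add d)) := by
    rw [next, next, ← Ext.comp_assoc_of_second_deg_zero]
    refine Eq.trans ?_ (congrArg (fun z => Ext.comp z e (add_comm 1 d)) h.symm)
    exact (Ext.comp_assoc _ _ _ (zero_add 1) (add_comm 1 d) (by omega)).symm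
  rw [h2, he, s.next_comp]

end IsRegularStep

end ExtCyclic

/-! ### Regularity of iterated Ore extensions -/

section OreTower

open CategoryTheory Abelian

/-- Reduction modulo the variable of an Ore extension `B` is a regular step in every algebra `A` that
is mapped onto `B`. -/
theorem IsOreExtension.isRegularStep {R B A : Type} [Ring R] [Algebra ℂ R] [Ring B] [Algebra ℂ B]
    [Ring A] [Algebra ℂ A] {φ : R →ₐ[ℂ] B} {t : B} {σ : R ≃ₐ[ℂ] R} (h : IsOreExtension φ t σ)
    {f : A →ₐ[ℂ] B} (hf : Function.Surjective f) {x : A} (hx : f x = t) {I I' : Ideal A}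
    (hI : ∀ a, a ∈ I ↔ f a = 0) (hI' : ∀ a, a ∈ I' ↔ h.eval (f a) = 0) : IsRegularStep I x I' where
  mul_mem a ha := by rw [hI] at ha ⊢; rw [map_mul, ha, zero_mul]
  regular a ha := by
    rw [hI, map_mul, hx] at ha
    exact (hI a).2 (h.eq_zero_of_mul_eq_zero' ha)
  le a ha := by rw [hI'] ; rw [hI] at ha; rw [ha, map_zero]
  mem := by rw [hI', hx, h.eval_var]
  exists_sub_mem a ha := by
    obtain ⟨b, hb⟩ := h.eval_eq_zero_iff.1 ((hI' a).1 ha)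
    obtain ⟨b, rfl⟩ := hf b
    exact ⟨b, by rw [hI, map_sub, map_mul, hx, hb, sub_self]⟩

variable {F R₁ R₂ A : Type} [DivisionRing F] [Algebra ℂ F] [Ring R₁] [Algebra ℂ R₁] [Ring R₂]
  [Algebra ℂ R₂] [Ring A] [Algebra ℂ A]

/-- A threefold iterated Ore extension `A = F[p; σ₁][q; σ₂][t; σ₃]` of a one-dimensional division
algebra `F`, in which `σ₂` rescales `p` and `σ₃` preserves the augmentation. -/
structure IsOreTower (φ₁ : F →ₐ[ℂ] R₁) (φ₂ : R₁ →ₐ[ℂ] R₂) (φ₃ : R₂ →ₐ[ℂ] A) (p : R₁) (q : R₂)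
    (t : A) (σ₁ : F ≃ₐ[ℂ] F) (σ₂ : R₁ ≃ₐ[ℂ] R₁) (σ₃ : R₂ ≃ₐ[ℂ] R₂) : Prop where
  fst : IsOreExtension φ₁ p σ₁
  snd : IsOreExtension φ₂ q σ₂
  trd : IsOreExtension φ₃ t σ₃
  finrank_eq_one : Module.finrank ℂ F = 1
  exists_smul : ∃ c : ℂ, c ≠ 0 ∧ σ₂ p = c • p
  eval_comp : ∀ r, fst.eval (snd.eval (σ₃ r)) = fst.eval (snd.eval r)

namespace IsOreTower

variable {φ₁ : F →ₐ[ℂ] R₁} {φ₂ : R₁ →ₐ[ℂ] R₂} {φ₃ : R₂ →ₐ[ℂ] A} {p : R₁} {q : R₂}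
  {t : A} {σ₁ : F ≃ₐ[ℂ] F} {σ₂ : R₁ ≃ₐ[ℂ] R₁} {σ₃ : R₂ ≃ₐ[ℂ] R₂}
  (T : IsOreTower φ₁ φ₂ φ₃ p q t σ₁ σ₂ σ₃)
include T

/-- The augmentation `A → F`. -/
noncomputable def aug : A →ₐ[ℂ] F := T.fst.eval.comp (T.snd.eval.comp T.trd.eval)

theorem aug_surjective : Function.Surjective T.aug :=
  T.fst.eval_surjective.comp (T.snd.eval_surjective.comp T.trd.eval_surjective)

theorem aug_conj (a : A) : T.aug (T.trd.conj a) = T.aug a := by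
  induction a using T.trd.induction with
  | hφ r =>
    simp only [aug, AlgHom.comp_apply, IsOreExtension.conj_map, IsOreExtension.eval_map]
    exact T.eval_comp r
  | ht => rw [IsOreExtension.conj_var]
  | add a b ha hb => rw [map_add, map_add, ha, hb, map_add]
  | mul a b ha hb => rw [map_mul, map_mul, ha, hb, map_mul]

theorem exists_eq_of_aug_eq_zero {a : A} (ha : T.aug a = 0) :
    ∃ b₁ b₂ b₃, a = b₁ * t + b₂ * φ₃ q + b₃ * φ₃ (φ₂ p) := by
  obtain ⟨b, hb⟩ := T.fst.eval_eq_zero_iff.1 (show T.fst.eval (T.snd.eval (T.trd.eval a)) = 0 from ha)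
  have h₂ : T.snd.eval (T.trd.eval (a - φ₃ (φ₂ b) * φ₃ (φ₂ p))) = 0 := by
    simp [hb]
  obtain ⟨c, hc⟩ := T.snd.eval_eq_zero_iff.1 h₂
  have h₃ : T.trd.eval (a - φ₃ (φ₂ b) * φ₃ (φ₂ p) - φ₃ c * φ₃ q) = 0 := by
    rw [map_sub, hc]
    simp
  obtain ⟨d, hd⟩ := T.trd.eval_eq_zero_iff.1 h₃
  exact ⟨d, φ₃ c, φ₃ (φ₂ b), by rw [← hd]; abel⟩

theorem hasProjectiveDimensionLE (M : ModuleCat.{0} A) : HasProjectiveDimensionLE M 3 :=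
  T.trd.hasProjectiveDimensionLE_succ
    (T.snd.hasProjectiveDimensionLE_succ (T.fst.hasProjectiveDimensionLE_succ fun N =>
      (projective_iff_hasProjectiveDimensionLE_zero _).1
        ((IsProjective.iff_projective (R := F) N).1 (Module.Projective.of_free (R := F))))) M

/-- The left ideals that are to be killed one after the other are the kernels of the projections of
`A` to `R₂`, `R₁` and `F`. On the side of the extension groups the automorphism `σ̂₃` of `A` with
`t a = σ̂₃(a) t` intervenes: up to it, the variables act on the generators of the extension groups as
they do on the quotients of `A`. -/
theorem exists_isExtGenerator {I : Ideal A} (hI : ∀ a, a ∈ I ↔ T.aug a = 0) :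
    ∃ e : Ext (quotModule I) (ModuleCat.of A A) 3, IsExtGenerator e {a | T.aug a = 0} := by
  -- The action of a variable on the cohomology of a quotient, in terms of `σ̂₃`.
  have dual : ∀ {R B : Type} [Ring R] [Algebra ℂ R] [Ring B] [Algebra ℂ B] {φ : R →ₐ[ℂ] B} {x : B}
      {σ : R ≃ₐ[ℂ] R} (h : IsOreExtension φ x σ) (f : A →ₐ[ℂ] B), Function.Surjective f →
      ∀ (y : A) (c : ℂ), c ≠ 0 → f y = c • x →
      (∀ a, T.trd.conj y * a ∈ T.trd.conj '' {a | f a = 0} → a ∈ T.trd.conj '' {a | f a = 0}) ∧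
      ∀ a, a ∈ T.trd.conj '' {a | h.eval (f a) = 0} ↔
        ∃ b, a - T.trd.conj y * b ∈ T.trd.conj '' {a | f a = 0} := by
    intro R B _ _ _ _ φ x σ h f hf y c hc hy
    have mem : ∀ {B : Type} [Ring B] [Algebra ℂ B] (f : A →ₐ[ℂ] B) (a : A),
        T.trd.conj a ∈ T.trd.conj '' {a | f a = 0} ↔ f a = 0 := fun f a =>
      T.trd.conj_injective.mem_set_image
    constructor
    · intro a ha
      obtain ⟨a, rfl⟩ := T.trd.conj_surjective a
      rw [← map_mul, mem, map_mul, hy, smul_mul_assoc, smul_eq_zero_iff_right hc] at ha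
      exact (mem f a).2 (h.eq_zero_of_mul_eq_zero ha)
    · intro a
      obtain ⟨a, rfl⟩ := T.trd.conj_surjective a
      refine (mem (h.eval.comp f) a).trans ((h.eval_eq_zero_iff' (a := f a)).trans ?_)
      constructor
      · rintro ⟨b, hb⟩
        obtain ⟨b, rfl⟩ := hf b
        refine ⟨T.trd.conj (c⁻¹ • b), ?_⟩
        rw [← map_mul, ← map_sub, mem, map_sub, map_mul, hy, map_smul, smul_mul_smul_comm,
          mul_inv_cancel₀ hc, one_smul, hb, sub_self]
      · rintro ⟨b, hb⟩
        obtain ⟨b, rfl⟩ := T.trd.conj_surjective b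
        rw [← map_mul, ← map_sub, mem, map_sub, map_mul, hy, sub_eq_zero] at hb
        exact ⟨c • f b, by rw [hb, smul_mul_assoc, mul_smul_comm]⟩
  let f₂ : A →ₐ[ℂ] R₁ := T.snd.eval.comp T.trd.eval
  have hf₂ : Function.Surjective f₂ := T.snd.eval_surjective.comp T.trd.eval_surjective
  let I₁ : Ideal A := RingHom.ker T.trd.eval
  let I₂ : Ideal A := RingHom.ker f₂
  have s₁ : IsRegularStep ⊥ t I₁ := T.trd.isRegularStep (f := AlgHom.id ℂ A)
    Function.surjective_id rfl (fun a => Ideal.mem_bot) (fun a => RingHom.mem_ker)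
  have s₂ : IsRegularStep I₁ (φ₃ q) I₂ := T.snd.isRegularStep T.trd.eval_surjective
    (T.trd.eval_map q) (fun a => RingHom.mem_ker) (fun a => RingHom.mem_ker)
  have s₃ : IsRegularStep I₂ (φ₃ (φ₂ p)) I := T.fst.isRegularStep hf₂
    (by simp [f₂]) (fun a => RingHom.mem_ker) hI
  obtain ⟨c, hc, hp⟩ := T.exists_smul
  -- First step: the variable `t` in `A`.
  have e₁ : IsExtGenerator (s₁.next (extGeneratorZero A)) (T.trd.conj '' {a | T.trd.eval a = 0}) := by
    obtain ⟨d₁, d₂⟩ := dual T.trd (AlgHom.id ℂ A) Function.surjective_id t 1 one_ne_zero (by simp)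
    have h0 : T.trd.conj '' {a | AlgHom.id ℂ A a = 0} = {0} := by
      have : {a | AlgHom.id ℂ A a = 0} = {0} := by ext; simp
      rw [this, Set.image_singleton, map_zero]
    rw [h0, T.trd.conj_var] at d₁ d₂
    exact s₁.isExtGenerator_next isExtGenerator_zero (intertwines_zero t) d₁ d₂
  have i₁ : ∀ r, Intertwines (s₁.next (extGeneratorZero A)) (φ₃ r) (T.trd.conj (φ₃ r)) := fun r => by
    refine s₁.intertwines_next (intertwines_zero (T.trd.conj (φ₃ r))) (fun a ha => ?_)
      (fun a ha => ?_) ?_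
    · rw [Ideal.mem_bot] at ha ⊢
      rw [ha, zero_mul]
    · exact Ideal.mul_mem_right _ (RingHom.ker T.trd.eval) ha
    · rw [T.trd.mul_eq_conj_mul, sub_self]
      exact zero_mem _
  -- Second step: the variable `q` in `R₂`.
  have e₂ : IsExtGenerator (s₂.next (s₁.next (extGeneratorZero A)))
      (T.trd.conj '' {a | f₂ a = 0}) := by
    obtain ⟨d₁, d₂⟩ := dual T.snd T.trd.eval T.trd.eval_surjective (φ₃ q) 1 one_ne_zero (by simp)
    exact s₂.isExtGenerator_next e₁ (i₁ q) d₁ d₂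
  have i₂ : Intertwines (s₂.next (s₁.next (extGeneratorZero A))) (φ₃ (φ₂ p))
      (T.trd.conj (φ₃ (φ₂ (σ₂ p)))) := by
    refine s₂.intertwines_next (i₁ (φ₂ (σ₂ p))) (fun a ha => ?_) (fun a ha => ?_) ?_
    · exact Ideal.mul_mem_right _ (RingHom.ker T.trd.eval) ha
    · exact Ideal.mul_mem_right _ (RingHom.ker f₂) ha
    · rw [← map_mul, ← map_mul, T.snd.comm, sub_self]
      exact zero_mem _
  -- Third step: the variable `p` in `R₁`.
  have e₃ : IsExtGenerator (s₃.next (s₂.next (s₁.next (extGeneratorZero A))))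
      (T.trd.conj '' {a | T.aug a = 0}) := by
    obtain ⟨d₁, d₂⟩ := dual T.fst f₂ hf₂ (φ₃ (φ₂ (σ₂ p))) c hc (by simp [f₂, hp])
    exact s₃.isExtGenerator_next e₂ i₂ d₁ d₂
  refine ⟨s₃.next (s₂.next (s₁.next (extGeneratorZero A))), ?_⟩
  convert e₃ using 1
  ext a
  obtain ⟨a, rfl⟩ := T.trd.conj_surjective a
  exact (T.trd.conj_injective.mem_set_image.trans (by
    change T.aug a = 0 ↔ T.aug (T.trd.conj a) = 0
    rw [T.aug_conj])).symm

omit T in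
theorem smul_eq_comp_rightMul {X : ModuleCat.{0} A} {n : ℕ} (z : Ext X (ModuleCat.of A A) n)
    (c : ℂ) : c • z = z.comp (Ext.mk₀ (rightMul (algebraMap ℂ A c))) (add_zero n) := by
  rw [Ext.smul_eq_comp_mk₀]
  congr 2
  refine ModuleCat.hom_ext (LinearMap.ext fun x => ?_)
  exact Algebra.commutes c x

omit T [Algebra ℂ A] in
theorem comp_rightMul_comp {X : ModuleCat.{0} A} {n : ℕ} (z : Ext X (ModuleCat.of A A) n)
    (a b : A) : (z.comp (Ext.mk₀ (rightMul a)) (add_zero n)).comp (Ext.mk₀ (rightMul b))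
      (add_zero n) = z.comp (Ext.mk₀ (rightMul (a * b))) (add_zero n) := by
  rw [Ext.comp_assoc_of_third_deg_zero, Ext.mk₀_comp_mk₀, rightMul_comp]

theorem isLeftASRegular {𝒜 : ℕ → Submodule ℂ A} (hc : IsConnectedGraded 𝒜) (hgk : gkDim A < ⊤)
    (haug : ∀ a, a ∈ augIdeal 𝒜 ↔ T.aug a = 0) : IsLeftASRegular 𝒜 where
  connected := hc
  globalDim := ⟨3, T.hasProjectiveDimensionLE⟩
  gkDim := hgk
  gorenstein := by
    obtain ⟨e, he⟩ := T.exists_isExtGenerator haug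
    let Ψ : A →ₗ[ℂ] Ext (trivialModule 𝒜) (ModuleCat.of A A) 3 :=
      { toFun := fun a => Ext.comp e (Ext.mk₀ (rightMul a)) (add_zero 3)
        map_add' := fun a b => by
          rw [rightMul_add, Ext.mk₀_add]
          exact Ext.comp_add _ _ _ _
        map_smul' := fun c a => by
          refine Eq.trans ?_ (smul_eq_comp_rightMul _ c).symm
          refine Eq.trans ?_ (comp_rightMul_comp e a _).symm
          rw [← Algebra.commutes, ← Algebra.smul_def] }
    have hΨ : Function.Surjective Ψ := fun z => (he.exists_eq z).imp fun a ha => ha.symm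
    have hker : LinearMap.ker Ψ = LinearMap.ker T.aug.toLinearMap := by
      ext a
      exact he.comp_eq_zero_iff a
    have hrank : Module.finrank ℂ (Ext (trivialModule 𝒜) (ModuleCat.of A A) 3) = 1 := by
      rw [← T.finrank_eq_one, ← (Ψ.quotKerEquivOfSurjective hΨ).finrank_eq, hker]
      exact (T.aug.toLinearMap.quotKerEquivOfSurjective T.aug_surjective).finrank_eq
    refine ⟨3, le_antisymm ?_ ?_, he.vanish, hrank, fun a ha z => ?_⟩
    · refine (injectiveDimension_le_iff _ _).2 (HasInjectiveDimensionLT.mk fun i hi Y x => ?_)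
      have := T.hasProjectiveDimensionLE Y
      exact Ext.eq_zero_of_hasProjectiveDimensionLT x 4 hi
    · refine (injectiveDimension_ge_iff _ _).2 fun h => ?_
      have := HasInjectiveDimensionLT.subsingleton (ModuleCat.of A A) 3 3 le_rfl (trivialModule 𝒜)
      rw [Module.finrank_zero_of_subsingleton] at hrank
      exact zero_ne_one hrank
    · obtain ⟨b, rfl⟩ := he.exists_eq z
      refine (comp_rightMul_comp e b a).trans ((he.comp_eq_zero_iff _).2 ?_)
      change T.aug (b * a) = 0
      rw [map_mul, (haug a).1 ha, mul_zero]

end IsOreTower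

end OreTower

/-! ### The opposite tower -/

namespace IsOreExtension

theorem eval_op {k : Type} [CommRing k] {R A : Type} [Ring R] [Algebra k R] [Ring A] [Algebra k A]
    {φ : R →ₐ[k] A} {t : A} {σ : R ≃ₐ[k] R} (h : IsOreExtension φ t σ) (a : A) :
    h.op.eval (MulOpposite.op a) = MulOpposite.op (h.eval a) := by
  induction a using h.induction with
  | hφ r => rw [h.eval_map]; exact h.op.eval_map (MulOpposite.op r)
  | ht => rw [h.eval_var]; exact h.op.eval_var
  | add a b ha hb => rw [MulOpposite.op_add, map_add, ha, hb, map_add, MulOpposite.op_add]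
  | mul a b ha hb => rw [MulOpposite.op_mul, map_mul, ha, hb, map_mul, MulOpposite.op_mul]

end IsOreExtension

namespace IsOreTower

variable {F R₁ R₂ A : Type} [DivisionRing F] [Algebra ℂ F] [Ring R₁] [Algebra ℂ R₁] [Ring R₂]
  [Algebra ℂ R₂] [Ring A] [Algebra ℂ A]
  {φ₁ : F →ₐ[ℂ] R₁} {φ₂ : R₁ →ₐ[ℂ] R₂} {φ₃ : R₂ →ₐ[ℂ] A} {p : R₁} {q : R₂}
  {t : A} {σ₁ : F ≃ₐ[ℂ] F} {σ₂ : R₁ ≃ₐ[ℂ] R₁} {σ₃ : R₂ ≃ₐ[ℂ] R₂}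
  (T : IsOreTower φ₁ φ₂ φ₃ p q t σ₁ σ₂ σ₃)
include T

theorem op : IsOreTower (AlgHom.op φ₁) (AlgHom.op φ₂) (AlgHom.op φ₃) (MulOpposite.op p)
    (MulOpposite.op q) (MulOpposite.op t) (AlgEquiv.op σ₁.symm) (AlgEquiv.op σ₂.symm)
    (AlgEquiv.op σ₃.symm) where
  fst := T.fst.op
  snd := T.snd.op
  trd := T.trd.op
  finrank_eq_one :=
    (MulOpposite.opLinearEquiv ℂ : F ≃ₗ[ℂ] Fᵐᵒᵖ).finrank_eq.symm.trans T.finrank_eq_one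
  exists_smul := by
    obtain ⟨c, hc, hp⟩ := T.exists_smul
    refine ⟨c⁻¹, inv_ne_zero hc, MulOpposite.unop_injective ?_⟩
    change σ₂.symm p = c⁻¹ • p
    rw [AlgEquiv.symm_apply_eq, map_smul, hp, smul_smul, inv_mul_cancel₀ hc, one_smul]
  eval_comp r := by
    change T.fst.op.eval (T.snd.op.eval (MulOpposite.op (σ₃.symm r.unop))) =
      T.fst.op.eval (T.snd.op.eval (MulOpposite.op r.unop))
    rw [T.snd.eval_op, T.snd.eval_op, T.fst.eval_op, T.fst.eval_op, ← T.eval_comp (σ₃.symm r.unop),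
      AlgEquiv.apply_symm_apply]

theorem aug_op (a : A) : T.op.aug (MulOpposite.op a) = MulOpposite.op (T.aug a) := by
  change T.fst.op.eval (T.snd.op.eval (T.trd.op.eval (MulOpposite.op a))) = _
  rw [T.trd.eval_op, T.snd.eval_op, T.fst.eval_op]
  rfl

/-- The ideal of elements of positive degree is the kernel of the augmentation, for a grading by the
powers of a space `W` that contains the three variables. -/
theorem mem_augIdeal_iff {𝒜 : ℕ → Submodule ℂ A} {W : Submodule ℂ A} (h𝒜 : ∀ n, 𝒜 n = W ^ n)
    (ht : t ∈ W) (hq : φ₃ q ∈ W) (hp : φ₃ (φ₂ p) ∈ W) (hW : ∀ w ∈ W, T.aug w = 0) (a : A) :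
    a ∈ augIdeal 𝒜 ↔ T.aug a = 0 := by
  constructor
  · intro ha
    have hle : augIdeal 𝒜 ≤ RingHom.ker T.aug := by
      refine Ideal.span_le.2 (Set.iUnion₂_subset fun n hn x hx => ?_)
      obtain ⟨m, rfl⟩ := Nat.exists_eq_add_of_le' (Set.mem_Ici.1 hn)
      rw [h𝒜, pow_succ] at hx
      have : W ^ m * W ≤ LinearMap.ker T.aug.toLinearMap :=
        Submodule.mul_le.2 fun y _ w hw => by
          rw [LinearMap.mem_ker, AlgHom.toLinearMap_apply, map_mul, hW w hw, mul_zero]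
      exact this hx
    exact hle ha
  · intro ha
    have hmem : ∀ w ∈ W, w ∈ augIdeal 𝒜 := fun w hw =>
      Ideal.subset_span (Set.mem_biUnion (Set.mem_Ici.2 (le_refl 1)) (by
        rw [h𝒜, pow_one]
        exact hw))
    obtain ⟨b₁, b₂, b₃, rfl⟩ := T.exists_eq_of_aug_eq_zero ha
    exact add_mem (add_mem (Ideal.mul_mem_left _ _ (hmem _ ht)) (Ideal.mul_mem_left _ _ (hmem _ hq)))
      (Ideal.mul_mem_left _ _ (hmem _ hp))

end IsOreTower

theorem IsConnectedGraded.op {A : Type} [Ring A] [Algebra ℂ A] {𝒜 : ℕ → Submodule ℂ A}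
    (h : IsConnectedGraded 𝒜) : IsConnectedGraded
      (fun n => (𝒜 n).map (MulOpposite.opLinearEquiv ℂ : A ≃ₗ[ℂ] Aᵐᵒᵖ).toLinearMap) := by
  obtain ⟨⟨hg⟩, hn, h0⟩ := h
  have hi := DirectSum.Decomposition.isInternal 𝒜
  rw [DirectSum.isInternal_submodule_iff_iSupIndep_and_iSup_eq_top] at hi
  have hi' : DirectSum.IsInternal
      (fun n => (𝒜 n).map (MulOpposite.opLinearEquiv ℂ : A ≃ₗ[ℂ] Aᵐᵒᵖ).toLinearMap) := by
    rw [DirectSum.isInternal_submodule_iff_iSupIndep_and_iSup_eq_top]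
    refine ⟨hi.1.map_orderIso
      (Submodule.orderIsoMapComap (MulOpposite.opLinearEquiv ℂ : A ≃ₗ[ℂ] Aᵐᵒᵖ)), ?_⟩
    rw [← Submodule.map_iSup, hi.2, Submodule.map_top, LinearEquiv.range]
  refine ⟨⟨{ hi'.chooseDecomposition with one_mem := ?_, mul_mem := ?_ }⟩, inferInstance, ?_⟩
  · exact Submodule.mem_map_of_mem (SetLike.GradedOne.one_mem (A := 𝒜))
  · rintro i j _ _ ⟨a, ha, rfl⟩ ⟨b, hb, rfl⟩
    rw [add_comm]
    exact Submodule.mem_map_of_mem (SetLike.GradedMul.mul_mem (A := 𝒜) hb ha)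
  · change Submodule.map _ (𝒜 0) = 1
    rw [h0]
    exact Submodule.map_op_one

/-! ### Gelfand–Kirillov dimension -/

theorem gkDim_op_le (A : Type) [Ring A] [Algebra ℂ A] : gkDim Aᵐᵒᵖ ≤ gkDim A := by
  refine iSup_le fun V => ?_
  obtain ⟨V, hV⟩ := V
  let e : A ≃ₗ[ℂ] Aᵐᵒᵖ := MulOpposite.opLinearEquiv ℂ
  let V' : Submodule ℂ A := V.map e.symm.toLinearMap
  refine le_iSup_of_le ⟨V', inferInstance⟩ (le_of_eq ?_)
  congr 1
  funext n
  have h1 : (1 ⊔ V : Submodule ℂ Aᵐᵒᵖ) = (1 ⊔ V').map e.toLinearMap := by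
    rw [Submodule.map_sup, ← Submodule.map_comp]
    congr 1
    · exact Submodule.map_op_one.symm
    · simp
  have h2 : ((1 ⊔ V : Submodule ℂ Aᵐᵒᵖ) ^ n) = ((1 ⊔ V') ^ n).map e.toLinearMap := by
    rw [h1]
    exact (Submodule.map_op_pow (R := ℂ) (A := A) n (M := 1 ⊔ V')).symm
  rw [h2]
  rw [LinearEquiv.finrank_map_eq e ((1 ⊔ V') ^ n)]

/-- An algebra of cubic growth has finite Gelfand–Kirillov dimension. -/
theorem gkDim_lt_top_of_finrank_le {A : Type} [Ring A] [Algebra ℂ A] (W : Submodule ℂ A)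
    [FiniteDimensional ℂ W] (hW : ∀ a, ∃ m, a ∈ (1 ⊔ W) ^ m)
    (hr : ∀ n, Module.finrank ℂ ↥((1 ⊔ W) ^ n) ≤ (n + 1) ^ 3) : gkDim A < ⊤ := by
  have h1 : (1 : Submodule ℂ A).FG := Submodule.one_eq_span (R := ℂ) (A := A) ▸
    Submodule.fg_span_singleton 1
  have hfin : ∀ n, FiniteDimensional ℂ ↥((1 ⊔ W) ^ n) := fun n =>
    Module.Finite.iff_fg.2 ((h1.sup (Module.Finite.iff_fg.1 inferInstance)).pow n)
  have hmono : Monotone fun n => (1 ⊔ W) ^ n := fun m n hmn => pow_le_pow_right₀ le_sup_left hmn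
  refine lt_of_le_of_lt (b := ((6 : ℝ) : EReal)) (iSup_le fun V => ?_) (EReal.coe_lt_top 6)
  obtain ⟨V, hV⟩ := V
  obtain ⟨m, hm⟩ : ∃ m, V ≤ (1 ⊔ W) ^ m := by
    obtain ⟨s, rfl⟩ := Module.Finite.iff_fg.1 hV
    choose m hm using hW
    exact ⟨s.sup m, Submodule.span_le.2 fun a ha => hmono (Finset.le_sup ha) (hm a)⟩
  have hle : ∀ n, ((1 ⊔ V) ^ n) ≤ (1 ⊔ W) ^ (m * n) := fun n => by
    rw [pow_mul]
    exact pow_le_pow_left' (sup_le (one_le_pow₀ le_sup_left) hm) n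
  refine Filter.limsup_le_of_le (h := Filter.eventually_atTop.2 ⟨m + 2, fun n hn => ?_⟩)
  have h1 : Module.finrank ℂ ↥((1 ⊔ V) ^ n) ≤ n ^ 6 := by
    have := hfin (m * n)
    calc _ ≤ Module.finrank ℂ ↥((1 ⊔ W) ^ (m * n)) := Submodule.finrank_mono (hle n)
      _ ≤ (m * n + 1) ^ 3 := hr _
      _ ≤ (n ^ 2) ^ 3 := Nat.pow_le_pow_left (by nlinarith) 3
      _ = n ^ 6 := by ring
  have hn1 : (1 : ℝ) < n := by exact_mod_cast (show 1 < n by omega)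
  rw [EReal.coe_le_coe_iff, div_le_iff₀ (Real.log_pos hn1)]
  rcases Nat.eq_zero_or_pos (Module.finrank ℂ ↥((1 ⊔ V) ^ n)) with h0 | h0
  · rw [h0]
    have := Real.log_pos hn1
    simp only [Nat.cast_zero, Real.log_zero]
    positivity
  · calc Real.log (Module.finrank ℂ ↥((1 ⊔ V) ^ n)) ≤ Real.log ((n : ℝ) ^ 6) :=
          Real.log_le_log (by exact_mod_cast h0) (by exact_mod_cast h1)
      _ = 6 * Real.log n := by rw [Real.log_pow]; norm_num

/-- Three elements `p, q, t` with `q p = l p q`, such that multiplication by `t` can be moved past the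
span of `p` and `q`: the ordered monomials span the algebra that they generate. -/
theorem finrank_pow_le {A : Type} [Ring A] [Algebra ℂ A] {p q t : A} {l : ℂ}
    (hqp : q * p = l • (p * q))
    (ht : ∀ w ∈ Submodule.span ℂ {p, q}, ∃ w' ∈ Submodule.span ℂ {p, q}, t * w = w' * t)
    {W : Submodule ℂ A} (hW : W = Submodule.span ℂ {p, q} ⊔ Submodule.span ℂ {t}) (n : ℕ) :
    Module.finrank ℂ ↥((1 ⊔ W) ^ n) ≤ (n + 1) ^ 3 := by
  classical
  let mon : ℕ × ℕ × ℕ → A := fun i => p ^ i.1 * q ^ i.2.1 * t ^ i.2.2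
  let S : ℕ → Submodule ℂ A := fun n =>
    Submodule.span ℂ (mon '' {i | i.1 + i.2.1 + i.2.2 ≤ n})
  have hqp' : ∀ j, q ^ j * p = l ^ j • (p * q ^ j) := fun j => by
    induction j with
    | zero => simp
    | succ j ih => 
      rw [pow_succ, mul_assoc, hqp, mul_smul_comm, ← mul_assoc, ih, smul_mul_assoc, smul_smul,
        mul_assoc, ← pow_succ']
  have ht' : ∀ k, ∀ w ∈ Submodule.span ℂ {p, q}, ∃ w' ∈ Submodule.span ℂ {p, q},
      t ^ k * w = w' * t ^ k := fun k => by
    induction k with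
    | zero => exact fun w hw => ⟨w, hw, by simp⟩
    | succ k ih =>
      intro w hw
      obtain ⟨w₁, h₁, e₁⟩ := ht w hw
      obtain ⟨w₂, h₂, e₂⟩ := ih w₁ h₁
      exact ⟨w₂, h₂, by rw [pow_succ, mul_assoc, e₁, ← mul_assoc, e₂, mul_assoc]⟩
  have hmem : ∀ {n i j k}, i + j + k ≤ n → p ^ i * q ^ j * t ^ k ∈ S n := fun {n i j k} h =>
    Submodule.subset_span ⟨(i, j, k), h, rfl⟩
  have hS : ∀ n, S n * (1 ⊔ W) ≤ S (n + 1) := by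
    intro n
    refine Submodule.mul_le.2 fun a ha w hw' => ?_
    induction ha using Submodule.span_induction with
    | zero => rw [zero_mul]; exact zero_mem _
    | add x y _ _ hx hy => rw [add_mul]; exact add_mem hx hy
    | smul c x _ hx => rw [smul_mul_assoc]; exact Submodule.smul_mem _ _ hx
    | mem x hx =>
      obtain ⟨⟨i, j, k⟩, hi, rfl⟩ := hx
      have hi' : i + j + k ≤ n := hi
      obtain ⟨_, h1, w, hw, rfl⟩ := Submodule.mem_sup.1 hw'
      obtain ⟨c, rfl⟩ := Submodule.mem_one.1 h1
      rw [mul_add]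
      refine add_mem ?_ ?_
      · change (p ^ i * q ^ j * t ^ k) * algebraMap ℂ A c ∈ _
        rw [← Algebra.commutes, ← Algebra.smul_def]
        exact Submodule.smul_mem _ _ (hmem (by omega))
      rw [hW] at hw
      obtain ⟨w, hwp, _, hc, rfl⟩ := Submodule.mem_sup.1 hw
      obtain ⟨c, rfl⟩ := Submodule.mem_span_singleton.1 hc
      rw [mul_add]
      refine add_mem ?_ ?_
      · obtain ⟨w', hw', e⟩ := ht' k w hwp
        obtain ⟨c, d, rfl⟩ := Submodule.mem_span_pair.1 hw'
        have : mon (i, j, k) * w = (c * l ^ j) • (p ^ (i + 1) * q ^ j * t ^ k) +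
            d • (p ^ i * q ^ (j + 1) * t ^ k) := by
          change p ^ i * q ^ j * t ^ k * w = _
          rw [mul_assoc, e, add_mul, mul_add, smul_mul_assoc, smul_mul_assoc, mul_smul_comm,
            mul_smul_comm, ← mul_assoc, mul_assoc (p ^ i), hqp', ← mul_assoc, mul_smul_comm,
            smul_mul_assoc, smul_smul, ← mul_assoc, ← pow_succ, mul_assoc (p ^ i) (q ^ j) q,
            ← pow_succ]
        rw [this]
        exact add_mem (Submodule.smul_mem _ _ (hmem (by omega)))
          (Submodule.smul_mem _ _ (hmem (by omega)))
      · have : mon (i, j, k) * c • t = c • (p ^ i * q ^ j * t ^ (k + 1)) := by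
          rw [mul_smul_comm, pow_succ, ← mul_assoc]
        rw [this]
        exact Submodule.smul_mem _ _ (hmem (by omega))
  have hle : ∀ n, (1 ⊔ W) ^ n ≤ S n := by
    intro n
    induction n with
    | zero =>
      rw [pow_zero, Submodule.one_le]
      simpa using hmem (n := 0) (i := 0) (j := 0) (k := 0) le_rfl
    | succ n ih =>
      rw [pow_succ]
      exact (mul_le_mul_left ih _).trans (hS n)
  let B : Finset (ℕ × ℕ × ℕ) := Finset.range (n + 1) ×ˢ Finset.range (n + 1) ×ˢ Finset.range (n + 1)
  have hSB : S n ≤ Submodule.span ℂ (B.image mon : Set A) := by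
    refine Submodule.span_mono ?_
    rintro _ ⟨⟨i, j, k⟩, hi, rfl⟩
    have hi' : i + j + k ≤ n := hi
    simp only [Finset.coe_image, Set.mem_image]
    exact ⟨(i, j, k), by simp [B]; omega, rfl⟩
  calc Module.finrank ℂ ↥((1 ⊔ W) ^ n)
      ≤ Module.finrank ℂ ↥(Submodule.span ℂ (B.image mon : Set A)) :=
        Submodule.finrank_mono ((hle n).trans hSB)
    _ ≤ (B.image mon).card := finrank_span_finset_le_card _
    _ ≤ B.card := Finset.card_image_le
    _ = (n + 1) ^ 3 := by simp [B]; ring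

/-! ### The quadratic algebras as quantum planes -/

section QuadAlg

namespace QuadRel

/-- The scalar `λ` such that the relation becomes `q p = λ p q` in suitable generators `p`, `q`. -/
noncomputable def ratio : QuadRel → ℂ
  | .uvAdd => Complex.I
  | .uvSub => -Complex.I
  | .sqAdd => -1
  | .sqSub => -1

theorem ratio_ne_zero (s : QuadRel) : s.ratio ≠ 0 := by
  cases s <;> simp [ratio]

section

variable {B C F : Type} [AddCommGroup B] [Module ℂ B] [AddCommGroup C] [Module ℂ C] [FunLike F B C]
  [LinearMapClass F ℂ B C]

/-- The linear combinations `p`, `q` of `u`, `v` in which the relation reads `q p = λ p q`. -/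
noncomputable def plane (s : QuadRel) (u v : B) : Fin 2 → B :=
  match s with
  | .uvAdd => ![u, v]
  | .uvSub => ![u, v]
  | .sqAdd => ![u + Complex.I • v, u - Complex.I • v]
  | .sqSub => ![u + v, u - v]

/-- The expression of `u`, `v` in terms of `p`, `q`. -/
noncomputable def unplane (s : QuadRel) (p q : B) : Fin 2 → B :=
  match s with
  | .uvAdd => ![p, q]
  | .uvSub => ![p, q]
  | .sqAdd => ![(1 / 2 : ℂ) • (p + q), (-Complex.I / 2) • (p - q)]
  | .sqSub => ![(1 / 2 : ℂ) • (p + q), (1 / 2 : ℂ) • (p - q)]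

theorem plane_unplane (s : QuadRel) (p q : B) :
    s.plane (s.unplane p q 0) (s.unplane p q 1) = ![p, q] := by
  have h : Complex.I * (-Complex.I / 2) = 1 / 2 := by
    rw [mul_div_assoc', mul_neg, Complex.I_mul_I, neg_neg]
  cases s
  · rfl
  · rfl
  · simp only [plane, unplane, Matrix.cons_val_zero, Matrix.cons_val_one, smul_smul, h]
    congr 1
    · module
    · congr 1
      module
  · simp only [plane, unplane, Matrix.cons_val_zero, Matrix.cons_val_one]
    congr 1
    · module
    · congr 1
      module

theorem unplane_plane (s : QuadRel) (u v : B) :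
    s.unplane (s.plane u v 0) (s.plane u v 1) = ![u, v] := by
  have h : ∀ w : B, (-Complex.I / 2) • (Complex.I • w) = (1 / 2 : ℂ) • w := fun w => by
    rw [smul_smul, div_mul_eq_mul_div, neg_mul, Complex.I_mul_I, neg_neg]
  cases s
  · rfl
  · rfl
  · simp only [plane, unplane, Matrix.cons_val_zero, Matrix.cons_val_one, smul_add, smul_sub, h]
    congr 1
    · module
    · congr 1
      module
  · simp only [plane, unplane, Matrix.cons_val_zero, Matrix.cons_val_one]
    congr 1
    · module
    · congr 1
      module

theorem map_plane (f : F) (s : QuadRel) (u v : B)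
    (k : Fin 2) : f (s.plane u v k) = s.plane (f u) (f v) k := by
  cases s <;> fin_cases k <;> simp [plane]

theorem map_unplane (f : F) (s : QuadRel) (u v : B)
    (k : Fin 2) : f (s.unplane u v k) = s.unplane (f u) (f v) k := by
  cases s <;> fin_cases k <;> simp [unplane]

theorem span_plane (s : QuadRel) (u v : B) :
    Submodule.span ℂ {s.plane u v 0, s.plane u v 1} = Submodule.span ℂ {u, v} := by
  have key : ∀ u v : B, ∀ k, s.plane u v k ∈ Submodule.span ℂ {u, v} := by
    intro u v k
    have hu : u ∈ Submodule.span ℂ {u, v} := Submodule.subset_span (by simp)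
    have hv : v ∈ Submodule.span ℂ {u, v} := Submodule.subset_span (by simp)
    cases s <;> fin_cases k
    exacts [hu, hv, hu, hv, add_mem hu (Submodule.smul_mem _ _ hv),
      sub_mem hu (Submodule.smul_mem _ _ hv), add_mem hu hv, sub_mem hu hv]
  have key' : ∀ u v : B, ∀ k, s.unplane u v k ∈ Submodule.span ℂ {u, v} := by
    intro u v k
    have hu : u ∈ Submodule.span ℂ {u, v} := Submodule.subset_span (by simp)
    have hv : v ∈ Submodule.span ℂ {u, v} := Submodule.subset_span (by simp)
    cases s <;> fin_cases k
    exacts [hu, hv, hu, hv, Submodule.smul_mem _ _ (add_mem hu hv),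
      Submodule.smul_mem _ _ (sub_mem hu hv), Submodule.smul_mem _ _ (add_mem hu hv),
      Submodule.smul_mem _ _ (sub_mem hu hv)]
  apply le_antisymm <;> rw [Submodule.span_le]
  · rintro _ (rfl | rfl)
    exacts [key _ _ 0, key _ _ 1]
  · have h := fun k => congrFun (unplane_plane s u v) k ▸ key' (s.plane u v 0) (s.plane u v 1) k
    rintro _ (rfl | rfl)
    exacts [h 0, h 1]

theorem lift_poly_eq_zero_iff {B : Type} [Ring B] [Algebra ℂ B] (s : QuadRel) (g : Fin 2 → B) :
    FreeAlgebra.lift ℂ g s.poly = 0 ↔ s.plane (g 0) (g 1) 1 * s.plane (g 0) (g 1) 0 =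
      s.ratio • (s.plane (g 0) (g 1) 0 * s.plane (g 0) (g 1) 1) := by
  have I2 : ∀ w : B, Complex.I • Complex.I • w = -w := fun w => by
    rw [smul_smul, Complex.I_mul_I, neg_one_smul]
  have key : ∃ c : ℂ, c ≠ 0 ∧ s.plane (g 0) (g 1) 1 * s.plane (g 0) (g 1) 0 -
      s.ratio • (s.plane (g 0) (g 1) 0 * s.plane (g 0) (g 1) 1) =
        c • FreeAlgebra.lift ℂ g s.poly := by
    cases s
    · refine ⟨-Complex.I, by simp, ?_⟩
      simp only [plane, ratio, poly, Matrix.cons_val_zero, Matrix.cons_val_one, map_add, map_mul,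
        map_smul, FreeAlgebra.lift_ι_apply, neg_smul, smul_add, I2]
      abel
    · refine ⟨Complex.I, by simp, ?_⟩
      simp only [plane, ratio, poly, Matrix.cons_val_zero, Matrix.cons_val_one, map_sub, map_mul,
        map_smul, FreeAlgebra.lift_ι_apply, neg_smul, smul_sub, I2]
      abel
    · refine ⟨2, by simp, ?_⟩
      simp only [plane, ratio, poly, Matrix.cons_val_zero, Matrix.cons_val_one, map_add, map_mul,
        FreeAlgebra.lift_ι_apply, mul_add, add_mul, mul_sub, sub_mul, smul_mul_assoc,
        mul_smul_comm, smul_add, smul_sub, I2, pow_two]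
      module
    · refine ⟨2, by simp, ?_⟩
      simp only [plane, ratio, poly, Matrix.cons_val_zero, Matrix.cons_val_one, map_sub, map_mul,
        FreeAlgebra.lift_ι_apply, mul_add, add_mul, mul_sub, sub_mul, pow_two]
      module
  obtain ⟨c, hc, h⟩ := key
  rw [← sub_eq_zero (b := s.ratio • _), h, smul_eq_zero_iff_right hc]

end

end QuadRel

namespace QuadAlg

variable {s : QuadRel} {B : Type} [Ring B] [Algebra ℂ B]

/-- The homomorphism given by the images of `u` and `v`. -/
noncomputable def lift (g : Fin 2 → B) (h : FreeAlgebra.lift ℂ g s.poly = 0) : QuadAlg s →ₐ[ℂ] B :=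
  RingQuot.liftAlgHom ℂ ⟨FreeAlgebra.lift ℂ g, by
    rintro p q ⟨rfl, rfl⟩
    rw [h, map_zero]⟩

@[simp] theorem lift_gen (g : Fin 2 → B) (h : FreeAlgebra.lift ℂ g s.poly = 0) (k : Fin 2) :
    lift g h (gen s k) = g k :=
  (RingQuot.liftAlgHom_mkAlgHom_apply ℂ _ _ _).trans (FreeAlgebra.lift_ι_apply g k)

theorem algHom_ext {f g : QuadAlg s →ₐ[ℂ] B} (h : ∀ k, f (gen s k) = g (gen s k)) : f = g := by
  refine RingQuot.ringQuot_ext' ℂ f g (FreeAlgebra.hom_ext ?_)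
  funext k
  exact h k

theorem adjoin_gen (s : QuadRel) : Algebra.adjoin ℂ (Set.range (gen s)) = ⊤ := by
  have h := congrArg (Subalgebra.map (mk s)) (FreeAlgebra.adjoin_range_ι ℂ (Fin 2))
  rw [AlgHom.map_adjoin, Algebra.map_top, ← Set.range_comp] at h
  exact h.trans ((AlgHom.range_eq_top _).2 (RingQuot.mkAlgHom_surjective ℂ s.Rel))

/-- The two generators of the quantum plane. -/
noncomputable def pq (s : QuadRel) : Fin 2 → QuadAlg s := s.plane (gen s 0) (gen s 1)

theorem pq_mul (s : QuadRel) : pq s 1 * pq s 0 = s.ratio • (pq s 0 * pq s 1) := by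
  refine (s.lift_poly_eq_zero_iff (gen s)).1 ?_
  have : FreeAlgebra.lift ℂ (gen s) = mk s := FreeAlgebra.hom_ext (by ext k; simp [gen])
  rw [this, mk_poly]

theorem gen_mem_adjoin (s : QuadRel) (k : Fin 2) : gen s k ∈ Algebra.adjoin ℂ {pq s 0, pq s 1} := by
  have h : gen s k ∈ Submodule.span ℂ {pq s 0, pq s 1} := by
    rw [pq, s.span_plane]
    fin_cases k <;> exact Submodule.subset_span (by simp)
  exact Algebra.span_le_adjoin ℂ _ h

/-- Rescaling of the variable of the polynomial ring. -/
noncomputable def rescale (c : ℂ) (hc : c ≠ 0) : Polynomial ℂ ≃ₐ[ℂ] Polynomial ℂ :=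
  AlgEquiv.ofAlgHom (Polynomial.aeval (c • Polynomial.X)) (Polynomial.aeval (c⁻¹ • Polynomial.X))
    (Polynomial.algHom_ext (by simp [smul_smul, inv_mul_cancel₀ hc]))
    (Polynomial.algHom_ext (by simp [smul_smul, mul_inv_cancel₀ hc]))

@[simp] theorem rescale_X (c : ℂ) (hc : c ≠ 0) :
    rescale c hc Polynomial.X = c • Polynomial.X := by simp [rescale]

/-- The algebra `ℂ⟨u, v⟩ / (r)` is an Ore extension of the polynomial ring `ℂ[p]`. -/
theorem isOreExtension (s : QuadRel) : IsOreExtension (Polynomial.aeval (R := ℂ) (pq s 0)) (pq s 1)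
    (rescale s.ratio s.ratio_ne_zero) where
  comm r := by
    induction r using Polynomial.induction_on' with
    | add f g hf hg => simp only [map_add, mul_add, add_mul, hf, hg]
    | monomial n c =>
      rw [← Polynomial.C_mul_X_pow_eq_monomial, ← Polynomial.smul_eq_C_mul]
      simp only [map_smul, mul_smul_comm, smul_mul_assoc, map_pow, rescale_X, Polynomial.aeval_X]
      congr 1
      induction n with
      | zero => simp
      | succ n ih => rw [pow_succ, ← mul_assoc, ih, mul_assoc, pq_mul, pow_succ, mul_assoc,
          smul_mul_assoc, mul_smul_comm]
  adjoin_eq_top := by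
    rw [eq_top_iff, ← adjoin_gen, Algebra.adjoin_le_iff]
    rintro _ ⟨k, rfl⟩
    refine Algebra.adjoin_mono ?_ (gen_mem_adjoin s k)
    rintro _ (rfl | rfl)
    · exact Or.inr ⟨Polynomial.X, by simp⟩
    · exact Or.inl rfl
  exists_lift {S} _ _ f x h := by
    have hU := s.plane_unplane (f Polynomial.X) x
    have h0 := congrFun hU 0
    have h1 := congrFun hU 1
    simp only [Matrix.cons_val_zero, Matrix.cons_val_one] at h0 h1
    have hg : FreeAlgebra.lift ℂ (s.unplane (f Polynomial.X) x) s.poly = 0 := by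
      rw [s.lift_poly_eq_zero_iff, h0, h1, h, rescale_X, map_smul, smul_mul_assoc]
    refine ⟨lift _ hg, fun r => ?_, ?_⟩
    · refine DFunLike.congr_fun (f := (lift _ hg).comp (Polynomial.aeval (pq s 0))) (g := f)
        (Polynomial.algHom_ext ?_) r
      simp [pq, s.map_plane, h0]
    · simp [pq, s.map_plane, h1]

theorem sigma_sigma (s : QuadRel) {α β : ℂ} (h : α * β = 1) (a : Fin 2) :
    (sigma s α a).comp (sigma s β a) = AlgHom.id ℂ _ := by
  refine algHom_ext fun k => ?_
  have e : ((-1 : ℂ) ^ ((a : ℕ) + 1)) * (-1) ^ ((a : ℕ) + 1) = 1 := by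
    rw [← pow_add, ← two_mul, pow_mul]; simp
  have : sigmaEntry β a k * sigmaEntry α a k = 1 := by
    fin_cases k
    · simpa [sigmaEntry, mul_comm] using h
    · change (-1) ^ ((a : ℕ) + 1) * β * ((-1) ^ ((a : ℕ) + 1) * α) = 1
      rw [mul_mul_mul_comm, e, mul_comm β, h, one_mul]
  rw [AlgHom.comp_apply, sigma_gen, map_smul, sigma_gen, smul_smul, this, one_smul,
    AlgHom.id_apply]

/-- The map `σ` as an automorphism. -/
noncomputable def sigmaEquiv (s : QuadRel) {α : ℂ} (hα : α ≠ 0) (a : Fin 2) :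
    QuadAlg s ≃ₐ[ℂ] QuadAlg s :=
  AlgEquiv.ofAlgHom (sigma s α a) (sigma s α⁻¹ a) (sigma_sigma s (mul_inv_cancel₀ hα) a)
    (sigma_sigma s (inv_mul_cancel₀ hα) a)

end QuadAlg

/-- A polynomial ring is an Ore extension. -/
theorem Polynomial.isOreExtension : IsOreExtension (Algebra.ofId ℂ (Polynomial ℂ)) Polynomial.X
    AlgEquiv.refl where
  comm r := (Algebra.commutes r _).symm
  adjoin_eq_top := by
    rw [eq_top_iff, ← Polynomial.adjoin_X]
    exact Algebra.adjoin_mono (by simp)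
  exists_lift f x _ := ⟨Polynomial.aeval x, fun r => by
    rw [Algebra.ofId_apply, AlgHom.commutes, ← AlgHom.commutes f]; rfl, Polynomial.aeval_X x⟩

end QuadAlg

/-! ### The algebra `A` as an iterated Ore extension -/

section ThreeAlg

namespace OreExt

variable {R : Type} [Ring R] [Algebra ℂ R]

/-- The inclusion of the coefficients. -/
noncomputable def coeffHom (σ : R →ₐ[ℂ] R) : R →ₐ[ℂ] OreExt σ where
  toFun r := SkewPolynomial.C (Twisted.of σ r)
  map_one' := rfl
  map_mul' _ _ := SkewPolynomial.C_mul
  map_zero' := SkewPolynomial.C_0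
  map_add' _ _ := SkewPolynomial.C_add
  commutes' _ := rfl

theorem isOreExtension (σ : R ≃ₐ[ℂ] R) :
    IsOreExtension (coeffHom (σ : R →ₐ[ℂ] R)) SkewPolynomial.X σ where
  comm r := OreExt.X_mul (σ : R →ₐ[ℂ] R) r
  adjoin_eq_top := by
    rw [eq_top_iff]
    rintro p -
    induction p using SkewPolynomial.induction with
    | h0 => exact zero_mem _
    | ha n r p _ _ hp =>
      refine add_mem ?_ hp
      rw [← SkewPolynomial.C_mul_X_pow_eq_monomial]
      have hr : coeffHom (σ : R →ₐ[ℂ] R) ((Twisted.of _).symm r) ∈ Algebra.adjoin ℂ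
          (insert SkewPolynomial.X (Set.range (coeffHom (σ : R →ₐ[ℂ] R)))) :=
        Algebra.subset_adjoin (Or.inr ⟨_, rfl⟩)
      have hX : (SkewPolynomial.X : OreExt (σ : R →ₐ[ℂ] R)) ∈ Algebra.adjoin ℂ
          (insert SkewPolynomial.X (Set.range (coeffHom (σ : R →ₐ[ℂ] R)))) :=
        Algebra.subset_adjoin (Or.inl rfl)
      exact mul_mem hr (pow_mem hX n)
  exists_lift {S} _ _ f x h := by
    have comm : ∀ (n : ℕ) (r : R), f (((σ : R →ₐ[ℂ] R) ^ n) r) * x ^ n = x ^ n * f r := by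
      intro n
      induction n with
      | zero => simp
      | succ n ih =>
        intro r
        rw [pow_succ x, mul_assoc _ x (f r), h, ← mul_assoc, ← mul_assoc, ← ih]
        rfl
    replace comm : ∀ (r : Twisted (σ : R →ₐ[ℂ] R)) (n : Multiplicative ℕ),
        f ((Twisted.of (σ : R →ₐ[ℂ] R)).symm (n • r)) * powersHom S x n =
          powersHom S x n * f ((Twisted.of (σ : R →ₐ[ℂ] R)).symm r) :=
      fun r n => comm n.toAdd r
    refine ⟨SkewMonoidAlgebra.liftNCAlgHom (f.comp (Twisted.of (σ : R →ₐ[ℂ] R)).symm.toAlgHom)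
      (powersHom S x) (fun {r n} => comm r n), fun r => ?_, ?_⟩
    · refine (SkewMonoidAlgebra.liftNC_single _ _ _ _).trans ?_
      simp
    · refine (SkewMonoidAlgebra.liftNC_single _ _ _ _).trans ?_
      simp

end OreExt

namespace ThreeAlg

variable (s : QuadRel) {α : ℂ} (hα : α ≠ 0) (a : Fin 2)

theorem isOreExtension : IsOreExtension (OreExt.coeffHom (sigma s α a)) (t s α a)
    (QuadAlg.sigmaEquiv s hα a) :=
  OreExt.isOreExtension (QuadAlg.sigmaEquiv s hα a)

/-- The algebra `A` is the iterated Ore extension `ℂ[p][q; σ₂][t; σ]`. -/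
theorem isOreTower : IsOreTower (Algebra.ofId ℂ (Polynomial ℂ))
    (Polynomial.aeval (R := ℂ) (QuadAlg.pq s 0)) (OreExt.coeffHom (sigma s α a)) Polynomial.X
    (QuadAlg.pq s 1) (t s α a) AlgEquiv.refl (QuadAlg.rescale s.ratio s.ratio_ne_zero)
    (QuadAlg.sigmaEquiv s hα a) where
  fst := Polynomial.isOreExtension
  snd := QuadAlg.isOreExtension s
  trd := isOreExtension s hα a
  finrank_eq_one := Module.finrank_self ℂ
  exists_smul := ⟨s.ratio, s.ratio_ne_zero, QuadAlg.rescale_X _ _⟩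
  eval_comp r := by
    let f : QuadAlg s →ₐ[ℂ] ℂ :=
      Polynomial.isOreExtension.eval.comp (QuadAlg.isOreExtension s).eval
    have hf : ∀ k, f (QuadAlg.pq s k) = 0 := by
      intro k
      fin_cases k
      · have h := (QuadAlg.isOreExtension s).eval_map Polynomial.X
        rw [Polynomial.aeval_X] at h
        exact (congrArg _ h).trans (IsOreExtension.eval_var _)
      · change Polynomial.isOreExtension.eval ((QuadAlg.isOreExtension s).eval (QuadAlg.pq s 1)) = 0
        rw [IsOreExtension.eval_var, map_zero]
    have hg : ∀ k, f (QuadAlg.gen s k) = 0 := by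
      intro k
      have h := congrFun (s.unplane_plane (QuadAlg.gen s 0) (QuadAlg.gen s 1)) k
      have h' := congrArg f h
      rw [s.map_unplane] at h'
      change s.unplane (f (QuadAlg.pq s 0)) (f (QuadAlg.pq s 1)) k = _ at h'
      rw [hf, hf] at h'
      have h0 : s.unplane (0 : ℂ) 0 k = 0 := by cases s <;> fin_cases k <;> simp [QuadRel.unplane]
      rw [h0] at h'
      refine Eq.trans ?_ h'.symm
      fin_cases k <;> rfl
    refine DFunLike.congr_fun (f := f.comp (sigma s α a)) (g := f)
      (QuadAlg.algHom_ext fun k => ?_) r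
    rw [AlgHom.comp_apply, sigma_gen, map_smul, hg, smul_zero]

variable {s a}

theorem t_mul_u (s : QuadRel) (α : ℂ) (a : Fin 2) :
    t s α a * u s α a = α • (u s α a * t s α a) := by
  have h : t s α a * u s α a = OreExt.coeffHom _ (sigma s α a (QuadAlg.gen s 0)) * t s α a :=
    OreExt.X_mul (sigma s α a) (QuadAlg.gen s 0)
  rw [h, sigma_gen, map_smul, smul_mul_assoc]
  rfl

theorem t_mul_v (s : QuadRel) (α : ℂ) (a : Fin 2) :
    t s α a * v s α a = ((-1) ^ ((a : ℕ) + 1) * α) • (v s α a * t s α a) := by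
  have h : t s α a * v s α a = OreExt.coeffHom _ (sigma s α a (QuadAlg.gen s 1)) * t s α a :=
    OreExt.X_mul (sigma s α a) (QuadAlg.gen s 1)
  rw [h, sigma_gen, map_smul, smul_mul_assoc]
  rfl

variable {B : Type} [Ring B] [Algebra ℂ B]

include hα in
/-- The universal property of the algebra `A`. -/
theorem exists_lift (g : Fin 2 → B) (x : B) (hg : FreeAlgebra.lift ℂ g s.poly = 0)
    (h₀ : x * g 0 = α • (g 0 * x)) (h₁ : x * g 1 = ((-1) ^ ((a : ℕ) + 1) * α) • (g 1 * x)) :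
    ∃ f : ThreeAlg s α a →ₐ[ℂ] B, f (u s α a) = g 0 ∧ f (v s α a) = g 1 ∧ f (t s α a) = x := by
  have key : ∀ r, x * QuadAlg.lift g hg r = QuadAlg.lift g hg (sigma s α a r) * x := by
    intro r
    have hr : r ∈ Algebra.adjoin ℂ (Set.range (QuadAlg.gen s)) := by
      rw [QuadAlg.adjoin_gen]; trivial
    induction hr using Algebra.adjoin_induction with
    | mem r hr =>
      obtain ⟨k, rfl⟩ := hr
      rw [sigma_gen, map_smul, QuadAlg.lift_gen, smul_mul_assoc]
      fin_cases k
      exacts [h₀, h₁]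
    | algebraMap c => rw [AlgHom.commutes, AlgHom.commutes, AlgHom.commutes, Algebra.commutes]
    | add r r' _ _ hr hr' => simp only [map_add, mul_add, add_mul, hr, hr']
    | mul r r' _ _ hr hr' => rw [map_mul, map_mul, map_mul, ← mul_assoc, hr, mul_assoc, hr',
        mul_assoc]
  obtain ⟨f, hf, hx⟩ := (isOreExtension s hα a).exists_lift (QuadAlg.lift g hg) x key
  exact ⟨f, (hf _).trans (QuadAlg.lift_gen _ _ _), (hf _).trans (QuadAlg.lift_gen _ _ _), hx⟩

variable (s a) in
include hα in
theorem adjoin_eq_top :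
    Algebra.adjoin ℂ {u s α a, v s α a, t s α a} = ⊤ := by
  rw [eq_top_iff]
  rintro p -
  have hr : ∀ r, OreExt.coeffHom (sigma s α a) r ∈ Algebra.adjoin ℂ {u s α a, v s α a, t s α a} := by
    intro r
    have hr : r ∈ Algebra.adjoin ℂ (Set.range (QuadAlg.gen s)) := by
      rw [QuadAlg.adjoin_gen]; trivial
    have h := (Subalgebra.mem_map (f := OreExt.coeffHom (sigma s α a))).2 ⟨r, hr, rfl⟩
    rw [AlgHom.map_adjoin] at h
    refine Algebra.adjoin_mono ?_ h
    rintro _ ⟨_, ⟨k, rfl⟩, rfl⟩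
    fin_cases k
    exacts [Or.inl rfl, Or.inr (Or.inl rfl)]
  induction p using (isOreExtension s hα a).induction with
  | hφ r => exact hr r
  | ht => exact Algebra.subset_adjoin (by simp)
  | add p q hp hq => exact add_mem hp hq
  | mul p q hp hq => exact mul_mem hp hq

end ThreeAlg

end ThreeAlg

/-! ### The grading of `A` and its regularity -/

section ThreeAlg

open DirectSum in
/-- An algebra generated by a set `E` is graded by the powers of the span `W` of `E`, provided that
it maps to the direct sum of these powers in such a way that the elements of `E` are placed in degree
one. For the construction of such a map it is made available that the quadratic relations between
elements of `W` hold in the direct sum. -/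
theorem nonempty_gradedAlgebra {A : Type} [Ring A] [Algebra ℂ A] {E : Set A}
    (hE : Algebra.adjoin ℂ E = ⊤)
    (h : ∀ ι : Submodule.span ℂ E →ₗ[ℂ] ⨁ n : ℕ, ↥(Submodule.span ℂ E ^ n),
      (∀ (w₁ w₂ w₃ w₄ : Submodule.span ℂ E) (c : ℂ), (w₁ : A) * w₂ = c • ((w₃ : A) * w₄) →
        ι w₁ * ι w₂ = c • (ι w₃ * ι w₄)) →
      ∃ f : A →ₐ[ℂ] ⨁ n : ℕ, ↥(Submodule.span ℂ E ^ n), ∀ (x : A) (hx : x ∈ Submodule.span ℂ E),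
        x ∈ E → f x = ι ⟨x, hx⟩) :
    Nonempty (GradedAlgebra fun n : ℕ => Submodule.span ℂ E ^ n) := by
  let ι : Submodule.span ℂ E →ₗ[ℂ] ⨁ n : ℕ, ↥(Submodule.span ℂ E ^ n) :=
    (DirectSum.lof ℂ ℕ (fun n => ↥(Submodule.span ℂ E ^ n)) 1).comp
      (Submodule.inclusion (pow_one _).ge)
  have hι : ∀ w, DirectSum.coeAlgHom (fun n => Submodule.span ℂ E ^ n) (ι w) = w := fun w =>
    DirectSum.coeAlgHom_of _ _ _
  obtain ⟨f, hf⟩ := h ι (by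
    intro w₁ w₂ w₃ w₄ c h
    simp only [ι, LinearMap.comp_apply, DirectSum.lof_eq_of, DirectSum.of_mul_of]
    rw [← DirectSum.lof_eq_of ℂ, ← DirectSum.lof_eq_of ℂ, ← map_smul]
    congr 1
    exact Subtype.ext h)
  have hf : ∀ (x : A) (hx : x ∈ Submodule.span ℂ E), f x = ι ⟨x, hx⟩ := by
    intro x hx
    induction hx using Submodule.span_induction with
    | mem x hxE => exact hf x _ hxE
    | zero => rw [map_zero]; exact (map_zero ι).symm
    | add x y _ _ ihx ihy => rw [map_add, ihx, ihy]; exact (map_add ι _ _).symm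
    | smul c x _ ihx => rw [map_smul, ihx]; exact (map_smul ι _ _).symm
  refine ⟨GradedAlgebra.ofAlgHom _ f ?_ ?_⟩
  · refine AlgHom.ext_of_adjoin_eq_top hE fun x hx => ?_
    exact (congrArg _ (hf x (Submodule.subset_span hx))).trans (hι _)
  · rintro i ⟨x, hx⟩
    induction hx using Submodule.pow_induction_on_left' with
    | algebraMap r => rw [AlgHom.commutes, DirectSum.algebraMap_apply]; rfl
    | add x y i hx hy ihx ihy => rw [map_add, ihx, ihy, ← map_add]; rfl
    | mem_mul m hm i x hx ih =>
      rw [map_mul, ih, hf m hm]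
      refine (DirectSum.of_mul_of _ _).trans ?_
      exact DirectSum.of_eq_of_gradedMonoid_eq (Sigma.subtype_ext (add_comm _ _) rfl)

namespace ThreeAlg

variable (s : QuadRel) {α : ℂ} (hα : α ≠ 0) (a : Fin 2)

/-- The generators of the quantum plane, in `A`. -/
noncomputable def pq (s : QuadRel) (α : ℂ) (a : Fin 2) (k : Fin 2) : ThreeAlg s α a :=
  s.plane (u s α a) (v s α a) k

theorem coeffHom_pq (s : QuadRel) (α : ℂ) (a : Fin 2) (k : Fin 2) :
    OreExt.coeffHom (sigma s α a) (QuadAlg.pq s k) = pq s α a k :=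
  s.map_plane _ _ _ k

theorem pq_mul (s : QuadRel) (α : ℂ) (a : Fin 2) :
    pq s α a 1 * pq s α a 0 = s.ratio • (pq s α a 0 * pq s α a 1) := by
  rw [← coeffHom_pq, ← coeffHom_pq, ← map_mul, QuadAlg.pq_mul, map_smul, map_mul]

theorem span_eq (s : QuadRel) (α : ℂ) (a : Fin 2) :
    Submodule.span ℂ {u s α a, v s α a, t s α a} =
      Submodule.span ℂ {pq s α a 0, pq s α a 1} ⊔ Submodule.span ℂ {t s α a} := by
  rw [pq, pq, s.span_plane, ← Submodule.span_union]
  congr 1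
  ext x
  simp only [Set.mem_insert_iff, Set.mem_singleton_iff, Set.mem_union, or_assoc]

theorem exists_t_mul (s : QuadRel) (α : ℂ) (a : Fin 2) {w : ThreeAlg s α a}
    (hw : w ∈ Submodule.span ℂ {pq s α a 0, pq s α a 1}) :
    ∃ w' ∈ Submodule.span ℂ {pq s α a 0, pq s α a 1}, t s α a * w = w' * t s α a := by
  rw [pq, pq, s.span_plane] at hw ⊢
  obtain ⟨c, d, rfl⟩ := Submodule.mem_span_pair.1 hw
  refine ⟨c • α • u s α a + d • ((-1) ^ ((a : ℕ) + 1) * α) • v s α a, ?_, ?_⟩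
  · exact Submodule.mem_span_pair.2 ⟨c * α, d * ((-1) ^ ((a : ℕ) + 1) * α), by
      rw [mul_smul, mul_smul]⟩
  · simp only [mul_add, add_mul, mul_smul_comm, smul_mul_assoc, t_mul_u, t_mul_v]

include hα in
theorem aug_eq_zero {w : ThreeAlg s α a} (hw : w ∈ Submodule.span ℂ {u s α a, v s α a, t s α a}) :
    (isOreTower s hα a).aug w = 0 := by
  rw [span_eq, ← Submodule.span_union] at hw
  refine (Submodule.span_le (p := LinearMap.ker (isOreTower s hα a).aug.toLinearMap)).2 ?_ hw
  rintro _ ((rfl | rfl) | rfl)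
  · have h := (QuadAlg.isOreExtension s).eval_map Polynomial.X
    rw [Polynomial.aeval_X] at h
    rw [← coeffHom_pq]
    refine (congrArg (fun r => IsOreExtension.eval _ (IsOreExtension.eval _ r))
      (IsOreExtension.eval_map _ _)).trans ?_
    exact (congrArg _ h).trans (IsOreExtension.eval_var _)
  · rw [← coeffHom_pq]
    refine (congrArg (fun r => IsOreExtension.eval _ (IsOreExtension.eval _ r))
      (IsOreExtension.eval_map _ _)).trans ?_
    refine (congrArg _ (IsOreExtension.eval_var _)).trans (map_zero _)
  · refine (congrArg (fun r => IsOreExtension.eval _ (IsOreExtension.eval _ r))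
      (IsOreExtension.eval_var _)).trans ?_
    exact (congrArg _ (map_zero _)).trans (map_zero _)

include hα in
/-- The generators `u`, `v`, `t` are linearly independent: this is seen in the square-zero
extension of `ℂ` by `ℂ³`. -/
theorem linearIndependent (p q r : ℂ) (h : p • u s α a + q • v s α a + r • t s α a = 0) :
    p = 0 ∧ q = 0 ∧ r = 0 := by
  let e : Fin 3 → TrivSqZeroExt ℂ (Fin 3 → ℂ) := fun k => TrivSqZeroExt.inr (Pi.single k 1)
  have he : ∀ k l, e k * e l = 0 := fun k l => TrivSqZeroExt.inr_mul_inr _ _ _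
  obtain ⟨f, hu, hv, ht⟩ := exists_lift (s := s) hα (a := a) ![e 0, e 1] (e 2)
    (by cases s <;> simp [QuadRel.poly, he, pow_two]) (by simp [he]) (by simp [he])
  have := congrArg TrivSqZeroExt.snd (congrArg f h)
  rw [map_add, map_add, map_smul, map_smul, map_smul, hu, hv, ht, map_zero] at this
  have h0 := congrFun this 0
  have h1 := congrFun this 1
  have h2 := congrFun this 2
  simp [e] at h0 h1 h2
  exact ⟨h0, h1, h2⟩

include hα in
theorem isConnectedGraded : IsConnectedGraded (deg s α a) := by
  have hu : u s α a ∈ Submodule.span ℂ {u s α a, v s α a, t s α a} :=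
    Submodule.subset_span (by simp)
  have hv : v s α a ∈ Submodule.span ℂ {u s α a, v s α a, t s α a} :=
    Submodule.subset_span (by simp)
  have ht : t s α a ∈ Submodule.span ℂ {u s α a, v s α a, t s α a} :=
    Submodule.subset_span (by simp)
  refine ⟨nonempty_gradedAlgebra (adjoin_eq_top s hα a) fun ι hι => ?_,
    (isOreTower s hα a).aug.toRingHom.domain_nontrivial, pow_zero _⟩
  obtain ⟨f, fu, fv, ft⟩ := exists_lift (s := s) hα (a := a) ![ι ⟨_, hu⟩, ι ⟨_, hv⟩] (ι ⟨_, ht⟩)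
    (by
      rw [s.lift_poly_eq_zero_iff]
      simp only [Matrix.cons_val_zero, Matrix.cons_val_one, ← s.map_plane]
      refine hι _ _ _ _ _ ?_
      have h : ∀ k, ((s.plane ⟨_, hu⟩ ⟨_, hv⟩ k : Submodule.span ℂ {u s α a, v s α a, t s α a}) :
          ThreeAlg s α a) = pq s α a k :=
        fun k => s.map_plane (Submodule.span ℂ {u s α a, v s α a, t s α a}).subtype _ _ k
      rw [h, h, pq_mul])
    (hι _ _ _ _ _ (t_mul_u s α a)) (hι _ _ _ _ _ (t_mul_v s α a))
  refine ⟨f, ?_⟩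
  rintro x hx (rfl | rfl | rfl)
  exacts [fu, fv, ft]

include hα in
theorem gkDim_lt_top : gkDim (ThreeAlg s α a) < ⊤ := by
  have : FiniteDimensional ℂ (Submodule.span ℂ {u s α a, v s α a, t s α a}) :=
    FiniteDimensional.span_of_finite ℂ (Set.toFinite _)
  refine gkDim_lt_top_of_finrank_le (Submodule.span ℂ {u s α a, v s α a, t s α a}) ?_
    (finrank_pow_le (pq_mul s α a) (fun w hw => exists_t_mul s α a hw) (span_eq s α a))
  intro p
  have hmono : Monotone fun n =>
      (1 ⊔ Submodule.span ℂ {u s α a, v s α a, t s α a} : Submodule ℂ (ThreeAlg s α a)) ^ n :=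
    fun m n hmn => pow_le_pow_right₀ le_sup_left hmn
  have hp : p ∈ Algebra.adjoin ℂ {u s α a, v s α a, t s α a} := by
    rw [adjoin_eq_top s hα a]; trivial
  induction hp using Algebra.adjoin_induction with
  | mem x hx =>
    refine ⟨1, ?_⟩
    rw [pow_one]
    exact Submodule.mem_sup_right (Submodule.subset_span hx)
  | algebraMap c =>
    refine ⟨0, ?_⟩
    rw [pow_zero]
    exact Submodule.algebraMap_mem c
  | add x y _ _ hx hy =>
    obtain ⟨m, hm⟩ := hx
    obtain ⟨n, hn⟩ := hy
    exact ⟨max m n, add_mem (hmono (le_max_left m n) hm) (hmono (le_max_right m n) hn)⟩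
  | mul x y _ _ hx hy =>
    obtain ⟨m, hm⟩ := hx
    obtain ⟨n, hn⟩ := hy
    exact ⟨m + n, by rw [pow_add]; exact Submodule.mul_mem_mul hm hn⟩

include hα in
theorem isASRegular : IsASRegular (deg s α a) := by
  have T := isOreTower s hα a
  have hc := isConnectedGraded s hα a
  have hgk := gkDim_lt_top s hα a
  have hk : ∀ k, pq s α a k ∈ Submodule.span ℂ {u s α a, v s α a, t s α a} := fun k => by
    rw [span_eq]
    exact Submodule.mem_sup_left (Submodule.subset_span (by fin_cases k <;> simp))
  have hq : OreExt.coeffHom (sigma s α a) (QuadAlg.pq s 1) ∈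
      Submodule.span ℂ {u s α a, v s α a, t s α a} := coeffHom_pq s α a 1 ▸ hk 1
  have hp : OreExt.coeffHom (sigma s α a)
      (Polynomial.aeval (R := ℂ) (QuadAlg.pq s 0) Polynomial.X) ∈
      Submodule.span ℂ {u s α a, v s α a, t s α a} := by
    rw [Polynomial.aeval_X, coeffHom_pq]
    exact hk 0
  have ht : t s α a ∈ Submodule.span ℂ {u s α a, v s α a, t s α a} :=
    Submodule.subset_span (by simp)
  have hW : ∀ w ∈ Submodule.span ℂ {u s α a, v s α a, t s α a}, T.aug w = 0 := fun w hw =>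
    aug_eq_zero s hα a hw
  constructor
  · exact T.isLeftASRegular hc hgk (T.mem_augIdeal_iff (fun _ => rfl) ht hq hp hW)
  · refine T.op.isLeftASRegular hc.op ((gkDim_op_le _).trans_lt hgk) ?_
    refine T.op.mem_augIdeal_iff (fun n => Submodule.map_op_pow _ n)
      (Submodule.mem_map_of_mem ht) (Submodule.mem_map_of_mem hq) (Submodule.mem_map_of_mem hp) ?_
    rintro _ ⟨w, hw, rfl⟩
    exact (T.aug_op w).trans (congrArg _ (hW w hw))

end ThreeAlg

end ThreeAlg

/-! ### Module algebras from the convolution algebra -/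

section ConvolutionAction

open WithConv

variable {H A : Type} [Ring H] [HopfAlgebra ℂ H] [Ring A] [Algebra ℂ A]

/-- The action of `H` on the convolution algebra of linear maps `H → A` by right translation of the
argument: `(h' . f) h = f (h h')`. -/
noncomputable def convTranslate (H A : Type) [Ring H] [HopfAlgebra ℂ H] [Ring A] [Algebra ℂ A] :
    H →ₐ[ℂ] Module.End ℂ (WithConv (H →ₗ[ℂ] A)) where
  toFun h' :=
    { toFun f := toConv (f.ofConv ∘ₗ LinearMap.mulRight ℂ h')
      map_add' _ _ := rfl
      map_smul' _ _ := rfl }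
  map_one' := by
    ext f h
    exact congrArg f.ofConv (mul_one h)
  map_mul' a b := by
    ext f h
    exact congrArg f.ofConv (mul_assoc h a b).symm
  map_zero' := by
    ext f h
    exact (congrArg f.ofConv (mul_zero h)).trans (map_zero f.ofConv)
  map_add' a b := by
    ext f h
    exact (congrArg f.ofConv (mul_add h a b)).trans (map_add f.ofConv _ _)
  commutes' c := by
    ext f h
    exact (congrArg f.ofConv (by simp [Algebra.algebraMap_eq_smul_one])).trans
      (map_smul f.ofConv c h)

@[simp] theorem convTranslate_apply (h h' : H) (f : WithConv (H →ₗ[ℂ] A)) :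
    (convTranslate H A h' f) h = f (h * h') := rfl

/-- The convolution algebra is an `H`-module algebra. -/
theorem isModuleAlgebra_convTranslate : IsModuleAlgebra (convTranslate H A) where
  act_one h' := by
    ext h
    simp only [convTranslate_apply, LinearMap.convOne_apply, LinearMap.convAlgebraMap_apply,
      Bialgebra.counit_mul, map_mul, Algebra.smul_def]
    exact (Algebra.commutes _ _)
  act_mul h' f g := by
    ext h
    rw [convTranslate_apply, LinearMap.convMul_apply, Bialgebra.comul_mul]
    generalize Coalgebra.comul (R := ℂ) h' = Q
    induction Q with
    | zero => simp
    | add P Q hP hQ => rw [mul_add, map_add, map_add, hP, hQ, map_add, map_add]; rfl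
    | tmul a b =>
      rw [TensorProduct.map_tmul, LinearMap.mul'_apply, LinearMap.convMul_apply]
      generalize Coalgebra.comul (R := ℂ) h = P
      induction P with
      | zero => simp
      | add P Q hP hQ => rw [add_mul, map_add, map_add, hP, hQ, map_add, map_add]
      | tmul c d => simp

/-- Evaluation at the unit of `H`. -/
noncomputable def convEvalOne (H A : Type) [Ring H] [HopfAlgebra ℂ H] [Ring A] [Algebra ℂ A] :
    WithConv (H →ₗ[ℂ] A) →ₐ[ℂ] A where
  toFun f := f 1
  map_one' := by simp
  map_mul' f g := by simp [Algebra.TensorProduct.one_def]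
  map_zero' := rfl
  map_add' _ _ := rfl
  commutes' c := by simp [Algebra.algebraMap_eq_smul_one]

@[simp] theorem convEvalOne_apply (f : WithConv (H →ₗ[ℂ] A)) : convEvalOne H A f = f 1 := rfl

/-- A subspace of the convolution algebra that is stable under translations and vanishes at `1` is
zero. -/
theorem eq_zero_of_convTranslate_mem {S : Submodule ℂ (WithConv (H →ₗ[ℂ] A))}
    (hS : ∀ h, ∀ f ∈ S, convTranslate H A h f ∈ S) (h1 : ∀ f ∈ S, convEvalOne H A f = 0)
    {f : WithConv (H →ₗ[ℂ] A)} (hf : f ∈ S) : f = 0 := by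
  ext h
  have := h1 _ (hS h f hf)
  rwa [convEvalOne_apply, convTranslate_apply, one_mul] at this

variable {V : Type} [AddCommGroup V] [Module ℂ V]

/-- The linear map `h ↦ j (h . e)`, for a vector `e` of a representation. -/
noncomputable def orbitMap (M : H →ₐ[ℂ] Module.End ℂ V) (j : V →ₗ[ℂ] A) :
    V →ₗ[ℂ] WithConv (H →ₗ[ℂ] A) :=
  (WithConv.linearEquiv ℂ (H →ₗ[ℂ] A)).symm.toLinearMap ∘ₗ
    (LinearMap.compRight ℂ j) ∘ₗ M.toLinearMap.flip

@[simp] theorem orbitMap_apply (M : H →ₐ[ℂ] Module.End ℂ V) (j : V →ₗ[ℂ] A) (e : V) (h : H) :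
    orbitMap M j e h = j (M h e) := rfl

theorem convTranslate_orbitMap (M : H →ₐ[ℂ] Module.End ℂ V) (j : V →ₗ[ℂ] A) (e : V) (h : H) :
    convTranslate H A h (orbitMap M j e) = orbitMap M j (M h e) := by
  ext h'
  simp

/-- If the orbit maps of a representation on a space of generators of `A` extend to a homomorphism
`δ` from `A` to the convolution algebra, then `h . a = δ(a)(h)` makes `A` a module algebra. -/
theorem exists_isModuleAlgebra (M : H →ₐ[ℂ] Module.End ℂ V) (j : V →ₗ[ℂ] A)
    (hj : Algebra.adjoin ℂ (Set.range j) = ⊤) (δ : A →ₐ[ℂ] WithConv (H →ₗ[ℂ] A))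
    (hδ : ∀ e, δ (j e) = orbitMap M j e) :
    ∃ ρ : H →ₐ[ℂ] Module.End ℂ A, IsModuleAlgebra ρ ∧ ∀ h e, ρ h (j e) = j (M h e) := by
  let r : H →ₗ[ℂ] Module.End ℂ A :=
    ((WithConv.linearEquiv ℂ (H →ₗ[ℂ] A)).toLinearMap ∘ₗ δ.toLinearMap).flip
  have hr : ∀ h a, r h a = δ a h := fun _ _ => rfl
  have mul_eq : ∀ (h : H) (a b : A), r h (a * b) = LinearMap.mul' ℂ A
      (TensorProduct.map (r.flip a) (r.flip b) (Coalgebra.comul h)) := fun h a b => by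
    rw [hr, map_mul]
    rfl
  have one_eq : ∀ (h : H) (c : ℂ), r h (algebraMap ℂ A c) = Coalgebra.counit (R := ℂ) h •
      algebraMap ℂ A c := fun h c => by
    rw [hr, AlgHom.commutes, LinearMap.convAlgebraMap_apply, Algebra.algebraMap_eq_smul_one,
      Algebra.algebraMap_eq_smul_one, smul_comm]
  have key : ∀ (a : A) (h : H), δ (r h a) = convTranslate H A h (δ a) := by
    intro a
    have ha : a ∈ Algebra.adjoin ℂ (Set.range j) := by rw [hj]; trivial
    induction ha using Algebra.adjoin_induction with
    | mem x hx =>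
      obtain ⟨e, rfl⟩ := hx
      intro h
      rw [hδ, convTranslate_orbitMap, hr, hδ, orbitMap_apply, hδ]
    | algebraMap c =>
      intro h
      rw [one_eq, map_smul, AlgHom.commutes, Algebra.algebraMap_eq_smul_one, map_smul,
        isModuleAlgebra_convTranslate.act_one, Algebra.algebraMap_eq_smul_one, smul_comm]
    | add a b _ _ ha hb =>
      intro h
      rw [map_add, map_add, ha, hb, map_add, map_add]
    | mul a b _ _ ha hb =>
      intro h
      rw [map_mul δ, isModuleAlgebra_convTranslate.act_mul, mul_eq]
      generalize Coalgebra.comul (R := ℂ) h = Q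
      induction Q with
      | zero => simp
      | add P Q hP hQ => simp only [map_add, hP, hQ]
      | tmul c d =>
        simp only [TensorProduct.map_tmul, LinearMap.mul'_apply, map_mul]
        exact congrArg₂ _ (ha c) (hb d)
  refine ⟨AlgHom.ofLinearMap r ?_ ?_, ⟨fun h => ?_, mul_eq⟩, fun h e => ?_⟩
  · refine LinearMap.ext fun a => ?_
    refine DFunLike.congr_fun (f := (convEvalOne H A).comp δ) (g := AlgHom.id ℂ A)
      (AlgHom.ext_of_adjoin_eq_top hj ?_) a
    rintro _ ⟨e, rfl⟩
    simp [hδ]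
  · intro h h'
    refine LinearMap.ext fun a => ?_
    have := DFunLike.congr_fun (congrArg WithConv.ofConv (key a h')) h
    exact this.symm
  · have := one_eq h 1
    rw [map_one, ← Algebra.algebraMap_eq_smul_one] at this
    exact this
  · exact DFunLike.congr_fun (congrArg WithConv.ofConv (hδ e)) h

/-- A module algebra structure respects the grading by powers of a stable subspace. -/
theorem IsModuleAlgebra.act_mem_pow {ρ : H →ₐ[ℂ] Module.End ℂ A} (hρ : IsModuleAlgebra ρ)
    {W : Submodule ℂ A} (hW : ∀ h, ∀ w ∈ W, ρ h w ∈ W) (n : ℕ) :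
    ∀ h, ∀ w ∈ W ^ n, ρ h w ∈ W ^ n := by
  induction n with
  | zero =>
    intro h w hw
    rw [pow_zero] at hw ⊢
    obtain ⟨c, rfl⟩ := Submodule.mem_one.1 hw
    rw [Algebra.algebraMap_eq_smul_one, map_smul, hρ.act_one]
    exact Submodule.smul_mem _ _ (Submodule.algebraMap_mem _)
  | succ n ih =>
    intro h w hw
    rw [pow_succ] at hw ⊢
    induction hw using Submodule.mul_induction_on' with
    | mem_mul_mem a ha b hb =>
      rw [hρ.act_mul]
      generalize Coalgebra.comul (R := ℂ) h = Q
      induction Q with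
      | zero => simp
      | add P Q hP hQ => rw [map_add, map_add]; exact add_mem hP hQ
      | tmul c d => exact Submodule.mul_mem_mul (ih c a ha) (hW d b hb)
    | add a _ b _ ha hb => rw [map_add]; exact add_mem ha hb

end ConvolutionAction

/-! ### The action of `H` -/

section KashinaAction

namespace Kashina

variable {K : Number} {B : Type} [Ring B] [Algebra ℂ B] {ρ : Alg K →ₐ[ℂ] Module.End ℂ B}

theorem act_x (hρ : IsModuleAlgebra ρ) (f g : B) :
    ρ (gen K .x) (f * g) = ρ (gen K .x) f * ρ (gen K .x) g := by simp [hρ.act_mul]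

theorem act_y (hρ : IsModuleAlgebra ρ) (f g : B) :
    ρ (gen K .y) (f * g) = ρ (gen K .y) f * ρ (gen K .y) g := by simp [hρ.act_mul]

theorem act_z (hρ : IsModuleAlgebra ρ) (f g : B) :
    ρ (gen K .z) (f * g) = ρ (gen K .z) f * ρ (gen K .z) g := by simp [hρ.act_mul]

/-- The eigenvalue of the factor `twist` on a tensor product `F ⊗ G` of weight vectors, where `F` has
the weights `η`, `ζ` for `y`, `z`, and `G` has the weights `ξ`, `θ` for `x`, `y`. -/
noncomputable def twistValue (η ζ ξ θ : ℂ) : ℂ :=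
  (1 / 4) * ∑ b : Fin 2, ∑ c : Fin 2, ∑ α : Fin 2, ∑ β : Fin 2,
    (-1) ^ (b * α + b * β + c * β : ℕ) * (η ^ (b : ℕ) * ζ ^ (c : ℕ) * (ξ ^ (α : ℕ) * θ ^ (β : ℕ)))

theorem act_w (hρ : IsModuleAlgebra ρ) {f g F G : B} (hf : ρ (gen K .w) f = F)
    (hg : ρ (gen K .w) g = G) {η ζ ξ θ : ℂ} (hη : ρ (gen K .y) F = η • F)
    (hζ : ρ (gen K .z) F = ζ • F) (hξ : ρ (gen K .x) G = ξ • G) (hθ : ρ (gen K .y) G = θ • G) :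
    ρ (gen K .w) (f * g) = twistValue η ζ ξ θ • (F * G) := by
  have hpow : ∀ (s : Gen) (F : B) (c : ℂ), ρ (gen K s) F = c • F → ∀ n : ℕ,
      ρ (gen K s ^ n) F = c ^ n • F := by
    intro s F c h n
    induction n with
    | zero => simp
    | succ n ih =>
      rw [pow_succ, map_mul, Module.End.mul_apply, h, map_smul, ih, smul_smul, pow_succ']
  rw [hρ.act_mul, comul_w, twist, twistValue]
  simp only [smul_mul_assoc, Finset.sum_mul, map_smul, map_sum,
    Algebra.TensorProduct.tmul_mul_tmul, TensorProduct.map_tmul, LinearMap.mul'_apply, mul_smul,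
    Finset.sum_smul]
  congr 1
  refine Finset.sum_congr rfl fun b _ => Finset.sum_congr rfl fun c _ =>
    Finset.sum_congr rfl fun α _ => Finset.sum_congr rfl fun β _ => ?_
  simp only [LinearMap.flip_apply, AlgHom.toLinearMap_apply, map_mul, Module.End.mul_apply, hf, hg,
    hpow _ _ _ hη, hpow _ _ _ hζ, hpow _ _ _ hξ, hpow _ _ _ hθ, map_smul, smul_mul_smul_comm]
  module

/-- Three elements of an `H`-module algebra that span the representation
`π_i(u, v) ⊕ T_{(-1)^a, (-1)^a, -1, γ}(t)`, written out on the generators of `H`. -/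
structure IsBasicTriple (ρ : Alg K →ₐ[ℂ] Module.End ℂ B) (U V T : B) (ε ζ κ γ : ℂ) : Prop where
  xU : ρ (gen K .x) U = (1 : ℂ) • U
  yU : ρ (gen K .y) U = (-1 : ℂ) • U
  zU : ρ (gen K .z) U = ζ • U
  wU : ρ (gen K .w) U = κ • V
  xV : ρ (gen K .x) V = (-1 : ℂ) • V
  yV : ρ (gen K .y) V = (1 : ℂ) • V
  zV : ρ (gen K .z) V = ζ • V
  wV : ρ (gen K .w) V = κ • U
  xT : ρ (gen K .x) T = ε • T
  yT : ρ (gen K .y) T = ε • T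
  zT : ρ (gen K .z) T = (-1 : ℂ) • T
  wT : ρ (gen K .w) T = γ • T

namespace IsBasicTriple

variable {U V T : B} {ε ζ κ γ : ℂ}

theorem smul_weight {s : Gen} {F : B} {c : ℂ} (h : ρ (gen K s) F = c • F) (d : ℂ) :
    ρ (gen K s) (d • F) = c • d • F := by
  rw [map_smul, h, smul_comm]

variable (hρ : IsModuleAlgebra ρ) (h : IsBasicTriple ρ U V T ε ζ κ γ)
include hρ h

theorem wUU (hζ : ζ = 1 ∨ ζ = -1) : ρ (gen K .w) (U * U) = (κ ^ 2 * ζ) • (V * V) := by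
  have hv : twistValue 1 ζ (-1) 1 = ζ := by
    rcases hζ with rfl | rfl <;>
      norm_num [twistValue, Fin.sum_univ_two]
  rw [act_w hρ h.wU h.wU (smul_weight h.yV _) (smul_weight h.zV _) (smul_weight h.xV _)
    (smul_weight h.yV _), smul_mul_smul_comm, hv]
  module

theorem wUV (hζ : ζ = 1 ∨ ζ = -1) : ρ (gen K .w) (U * V) = (κ ^ 2 * ζ) • (V * U) := by
  have hv : twistValue 1 ζ 1 (-1) = ζ := by
    rcases hζ with rfl | rfl <;>
      norm_num [twistValue, Fin.sum_univ_two]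
  rw [act_w hρ h.wU h.wV (smul_weight h.yV _) (smul_weight h.zV _) (smul_weight h.xU _)
    (smul_weight h.yU _), smul_mul_smul_comm, hv]
  module

theorem wVU (hζ : ζ = 1 ∨ ζ = -1) : ρ (gen K .w) (V * U) = (κ ^ 2 * (-ζ)) • (U * V) := by
  have hv : twistValue (-1) ζ (-1) 1 = -ζ := by
    rcases hζ with rfl | rfl <;>
      norm_num [twistValue, Fin.sum_univ_two]
  rw [act_w hρ h.wV h.wU (smul_weight h.yU _) (smul_weight h.zU _) (smul_weight h.xV _)
    (smul_weight h.yV _), smul_mul_smul_comm, hv]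
  module

theorem wVV (hζ : ζ = 1 ∨ ζ = -1) : ρ (gen K .w) (V * V) = (κ ^ 2 * ζ) • (U * U) := by
  have hv : twistValue (-1) ζ 1 (-1) = ζ := by
    rcases hζ with rfl | rfl <;>
      norm_num [twistValue, Fin.sum_univ_two]
  rw [act_w hρ h.wV h.wV (smul_weight h.yU _) (smul_weight h.zU _) (smul_weight h.xU _)
    (smul_weight h.yU _), smul_mul_smul_comm, hv]
  module

theorem wTU (hε : ε = 1 ∨ ε = -1) : ρ (gen K .w) (T * U) = (γ * κ * (-ε)) • (T * V) := by
  have hv : twistValue ε (-1) (-1) 1 = -ε := by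
    rcases hε with rfl | rfl <;>
      norm_num [twistValue, Fin.sum_univ_two]
  rw [act_w hρ h.wT h.wU (smul_weight h.yT _) (smul_weight h.zT _) (smul_weight h.xV _)
    (smul_weight h.yV _), smul_mul_smul_comm, hv]
  module

theorem wUT (hζ : ζ = 1 ∨ ζ = -1) (hε : ε = 1 ∨ ε = -1) :
    ρ (gen K .w) (U * T) = (γ * κ) • (V * T) := by
  have hv : twistValue 1 ζ ε ε = 1 := by
    rcases hζ with rfl | rfl <;> rcases hε with rfl | rfl <;>
      norm_num [twistValue, Fin.sum_univ_two]
  rw [act_w hρ h.wU h.wT (smul_weight h.yV _) (smul_weight h.zV _) (smul_weight h.xT _)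
    (smul_weight h.yT _), smul_mul_smul_comm, hv]
  module

theorem wTV (hε : ε = 1 ∨ ε = -1) : ρ (gen K .w) (T * V) = (γ * κ * (-1)) • (T * U) := by
  have hv : twistValue ε (-1) 1 (-1) = -1 := by
    rcases hε with rfl | rfl <;>
      norm_num [twistValue, Fin.sum_univ_two]
  rw [act_w hρ h.wT h.wV (smul_weight h.yT _) (smul_weight h.zT _) (smul_weight h.xU _)
    (smul_weight h.yU _), smul_mul_smul_comm, hv]
  module

theorem wVT (hζ : ζ = 1 ∨ ζ = -1) (hε : ε = 1 ∨ ε = -1) :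
    ρ (gen K .w) (V * T) = (γ * κ * ε) • (U * T) := by
  have hv : twistValue (-1) ζ ε ε = ε := by
    rcases hζ with rfl | rfl <;> rcases hε with rfl | rfl <;>
      norm_num [twistValue, Fin.sum_univ_two]
  rw [act_w hρ h.wV h.wT (smul_weight h.yU _) (smul_weight h.zU _) (smul_weight h.xT _)
    (smul_weight h.yT _), smul_mul_smul_comm, hv]
  module

end IsBasicTriple

/-- The three defining relations of the algebra `A`, evaluated at three elements. -/
noncomputable def relations (s : QuadRel) (α ε : ℂ) (U V T : B) : Fin 3 → B :=
  ![FreeAlgebra.lift ℂ ![U, V] s.poly, T * U - α • (U * T), T * V + (ε * α) • (V * T)]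

theorem map_relations {C : Type} [Ring C] [Algebra ℂ C] (f : B →ₐ[ℂ] C) (s : QuadRel) (α ε : ℂ)
    (U V T : B) (k : Fin 3) :
    f (relations s α ε U V T k) = relations s α ε (f U) (f V) (f T) k := by
  fin_cases k
  · cases s <;> simp [relations, QuadRel.poly]
  · simp [relations]
  · simp [relations]

/-- Every generator of `H` maps each of the three relations to a multiple of one of them: `w`
interchanges the two relations that involve `t`, up to scalars, and all other images are multiples of
the relation itself. -/
theorem IsBasicTriple.relations_mem {U V T : B} {ε ζ κ γ : ℂ} (hρ : IsModuleAlgebra ρ)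
    (h : IsBasicTriple ρ U V T ε ζ κ γ) (hε : ε = 1 ∨ ε = -1) (hζ : ζ = 1 ∨ ζ = -1)
    (s : QuadRel) (α : ℂ) (g : Gen) (k : Fin 3) :
    ∃ (c : ℂ) (l : Fin 3), ρ (gen K g) (relations s α ε U V T k) = c • relations s α ε U V T l := by
  have hεε : ε * ε = 1 := by rcases hε with rfl | rfl <;> norm_num
  have hI := Complex.I_mul_I
  cases g <;> fin_cases k
  · cases s
    · refine ⟨-1, 0, ?_⟩
      simp [relations, QuadRel.poly, act_x hρ, h.xU, h.xV]
    · refine ⟨-1, 0, ?_⟩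
      simp [relations, QuadRel.poly, act_x hρ, h.xU, h.xV]
      module
    · exact ⟨1, 0, by simp [relations, QuadRel.poly, pow_two, act_x hρ, h.xU, h.xV]⟩
    · exact ⟨1, 0, by simp [relations, QuadRel.poly, pow_two, act_x hρ, h.xU, h.xV]⟩
  · refine ⟨ε, 1, ?_⟩
    simp [relations, act_x hρ, h.xU, h.xT]
    module
  · refine ⟨-ε, 2, ?_⟩
    simp [relations, act_x hρ, h.xV, h.xT]
    module
  · cases s
    · refine ⟨-1, 0, ?_⟩
      simp [relations, QuadRel.poly, act_y hρ, h.yU, h.yV]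
    · refine ⟨-1, 0, ?_⟩
      simp [relations, QuadRel.poly, act_y hρ, h.yU, h.yV]
      module
    · exact ⟨1, 0, by simp [relations, QuadRel.poly, pow_two, act_y hρ, h.yU, h.yV]⟩
    · exact ⟨1, 0, by simp [relations, QuadRel.poly, pow_two, act_y hρ, h.yU, h.yV]⟩
  · refine ⟨-ε, 1, ?_⟩
    simp [relations, act_y hρ, h.yU, h.yT]
    module
  · refine ⟨ε, 2, ?_⟩
    simp [relations, act_y hρ, h.yV, h.yT]
    module
  · refine ⟨ζ ^ 2, 0, ?_⟩
    cases s <;> simp [relations, QuadRel.poly, pow_two, act_z hρ, h.zU, h.zV] <;> module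
  · refine ⟨-ζ, 1, ?_⟩
    simp [relations, act_z hρ, h.zU, h.zT]
    module
  · refine ⟨-ζ, 2, ?_⟩
    simp [relations, act_z hρ, h.zV, h.zT]
    module
  · cases s
    · refine ⟨-Complex.I * κ ^ 2 * ζ, 0, ?_⟩
      simp [relations, QuadRel.poly, h.wUV hρ hζ, h.wVU hρ hζ]
      match_scalars
      · linear_combination (κ ^ 2 * ζ) * hI
      · ring
    · refine ⟨Complex.I * κ ^ 2 * ζ, 0, ?_⟩
      simp [relations, QuadRel.poly, h.wUV hρ hζ, h.wVU hρ hζ]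
      match_scalars
      · linear_combination (κ ^ 2 * ζ) * hI
      · ring
    · refine ⟨κ ^ 2 * ζ, 0, ?_⟩
      simp [relations, QuadRel.poly, pow_two, h.wUU hρ hζ, h.wVV hρ hζ]
      module
    · refine ⟨-(κ ^ 2 * ζ), 0, ?_⟩
      simp [relations, QuadRel.poly, pow_two, h.wUU hρ hζ, h.wVV hρ hζ]
      module
  · refine ⟨-(ε * γ * κ), 2, ?_⟩
    simp [relations, h.wTU hρ hε, h.wUT hρ hζ hε]
    match_scalars
    · ring
    · linear_combination (α * γ * κ) * hεε
  · refine ⟨-(γ * κ), 1, ?_⟩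
    simp [relations, h.wTV hρ hε, h.wVT hρ hζ hε]
    match_scalars
    · ring
    · linear_combination (α * γ * κ) * hεε

/-- The representation `π_i(u, v) ⊕ T_{(-1)^a, (-1)^a, -1, γ}(t)`. -/
noncomputable def basicRep (K : Number) (i a c : Fin 2) :
    Alg K →ₐ[ℂ] Module.End ℂ ((Fin 2 → ℂ) × ℂ) :=
  (LinearMap.prodMapAlgHom ℂ (Fin 2 → ℂ) ℂ).comp
    ((Matrix.toLinAlgEquiv'.toAlgHom.comp (piRep K i)).prod
      ((Algebra.lmul ℂ ℂ).comp (charRep K a 1 c)))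

theorem basicRep_apply (K : Number) (i a c : Fin 2) (h : Alg K) (p : (Fin 2 → ℂ) × ℂ) :
    basicRep K i a c h p = ((piRep K i h).mulVec p.1, charRep K a 1 c h * p.2) := rfl

/-- An equivariant linear map from the basic representation to a module algebra gives a triple of
elements on which the generators of `H` act as prescribed. -/
theorem isBasicTriple (K : Number) (i a c : Fin 2) {ρ : Alg K →ₐ[ℂ] Module.End ℂ B}
    (j : (Fin 2 → ℂ) × ℂ →ₗ[ℂ] B) (hj : ∀ h p, ρ h (j p) = j (basicRep K i a c h p)) :
    IsBasicTriple ρ (j (![1, 0], 0)) (j (![0, 1], 0)) (j (0, 1)) ((-1) ^ (a : ℕ)) ((-1) ^ (i : ℕ))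
      (Complex.I ^ (i * K.zExp : ℕ)) ((-1) ^ (c : ℕ) * Complex.I ^ (a + 1 * K.zExp : ℕ)) := by
  constructor <;> rw [hj, ← map_smul, basicRep_apply] <;>
    simp [piRep, charRep] <;> refine congrArg (fun e => j (e, 0)) (funext fun k => ?_) <;>
    fin_cases k <;> rfl

end Kashina

end KashinaAction

section

open Kashina

namespace ThreeAlg

variable (K : Number) (s : QuadRel) {α : ℂ} (hα : α ≠ 0) (i a c : Fin 2)

/-- The inclusion of the space of generators. -/
noncomputable def incl (s : QuadRel) (α : ℂ) (a : Fin 2) : (Fin 2 → ℂ) × ℂ →ₗ[ℂ] ThreeAlg s α a where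
  toFun p := p.1 0 • u s α a + p.1 1 • v s α a + p.2 • t s α a
  map_add' p q := by
    simp only [Prod.fst_add, Prod.snd_add, Pi.add_apply]
    module
  map_smul' c p := by
    simp only [Prod.smul_fst, Prod.smul_snd, Pi.smul_apply, smul_eq_mul, RingHom.id_apply]
    module

theorem incl_apply (s : QuadRel) (α : ℂ) (a : Fin 2) (p : (Fin 2 → ℂ) × ℂ) :
    incl s α a p = p.1 0 • u s α a + p.1 1 • v s α a + p.2 • t s α a := rfl

theorem range_incl (s : QuadRel) (α : ℂ) (a : Fin 2) :
    LinearMap.range (incl s α a) = Submodule.span ℂ {u s α a, v s α a, t s α a} := by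
  apply le_antisymm
  · rintro _ ⟨p, rfl⟩
    exact add_mem (add_mem (Submodule.smul_mem _ _ (Submodule.subset_span (by simp)))
      (Submodule.smul_mem _ _ (Submodule.subset_span (by simp))))
      (Submodule.smul_mem _ _ (Submodule.subset_span (by simp)))
  · rw [Submodule.span_le]
    rintro _ (rfl | rfl | rfl)
    · exact ⟨(![1, 0], 0), by simp [incl_apply]⟩
    · exact ⟨(![0, 1], 0), by simp [incl_apply]⟩
    · exact ⟨(0, 1), by simp [incl_apply]⟩

include hα in
theorem incl_injective : Function.Injective (incl s α a) := by
  rw [injective_iff_map_eq_zero]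
  intro p hp
  obtain ⟨h0, h1, h2⟩ := linearIndependent s hα a _ _ _ hp
  refine Prod.ext (funext fun k => ?_) h2
  fin_cases k
  exacts [h0, h1]

/-- The space of generators is the component of degree one. -/
noncomputable def inclEquiv : ((Fin 2 → ℂ) × ℂ) ≃ₗ[ℂ] deg s α a 1 :=
  (LinearEquiv.ofInjective (incl s α a) (incl_injective s hα a)).trans
    (LinearEquiv.ofEq _ _ ((range_incl s α a).trans (pow_one _).symm))

theorem relations_eq_zero (s : QuadRel) (α : ℂ) (a : Fin 2) (k : Fin 3) :
    relations s α ((-1) ^ (a : ℕ)) (u s α a) (v s α a) (t s α a) k = 0 := by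
  fin_cases k
  · change FreeAlgebra.lift ℂ ![u s α a, v s α a] s.poly = 0
    rw [s.lift_poly_eq_zero_iff]
    exact pq_mul s α a
  · exact sub_eq_zero.2 (t_mul_u s α a)
  · refine (congrArg (· + _) (t_mul_v s α a)).trans ?_
    rw [pow_succ, mul_neg_one, neg_mul, neg_smul]
    exact neg_add_cancel _

include hα in
/-- The orbit maps of the generators satisfy the relations of `A`: the subspace spanned by the
relations is stable under translations, and it vanishes at the unit of `H`. -/
theorem exists_conv : ∃ δ : ThreeAlg s α a →ₐ[ℂ] WithConv (Alg K →ₗ[ℂ] ThreeAlg s α a),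
    ∀ p, δ (incl s α a p) = orbitMap (basicRep K i a c) (incl s α a) p := by
  let j := orbitMap (basicRep K i a c) (incl s α a)
  have hB : IsBasicTriple _ _ _ _ _ _ _ _ := isBasicTriple K i a c j fun h p =>
    convTranslate_orbitMap (basicRep K i a c) (incl s α a) p h
  have h1 : ∀ p, convEvalOne (Alg K) (ThreeAlg s α a) (j p) = incl s α a p := by
    intro p
    simp [j]
  let S := Submodule.span ℂ (Set.range (relations s α ((-1) ^ (a : ℕ)) (j (![1, 0], 0))
    (j (![0, 1], 0)) (j (0, 1))))
  have hsign : ∀ k : Fin 2, (-1 : ℂ) ^ (k : ℕ) = 1 ∨ (-1 : ℂ) ^ (k : ℕ) = -1 := fun k =>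
    neg_one_pow_eq_or ℂ k
  have hgen : ∀ g, ∀ f ∈ S, convTranslate (Alg K) _ (gen K g) f ∈ S := by
    intro g
    refine Submodule.span_le (p := S.comap (convTranslate (Alg K) _ (gen K g))).2 ?_
    rintro _ ⟨k, rfl⟩
    obtain ⟨d, l, h⟩ := hB.relations_mem isModuleAlgebra_convTranslate (hsign a) (hsign i) s α g k
    change convTranslate (Alg K) _ (gen K g) _ ∈ S
    rw [h]
    exact Submodule.smul_mem _ _ (Submodule.subset_span ⟨l, rfl⟩)
  have hS : ∀ h, ∀ f ∈ S, convTranslate (Alg K) _ h f ∈ S := by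
    intro h
    induction h using induct with
    | hc d =>
      intro f hf
      rw [AlgHom.commutes]
      exact Submodule.smul_mem _ _ hf
    | hg g => exact hgen g
    | ha h h' hh hh' =>
      intro f hf
      rw [map_add]
      exact add_mem (hh f hf) (hh' f hf)
    | hm h h' hh hh' =>
      intro f hf
      rw [map_mul]
      exact hh _ (hh' f hf)
  have hS1 : ∀ f ∈ S, convEvalOne (Alg K) (ThreeAlg s α a) f = 0 := by
    refine Submodule.span_le (p := LinearMap.ker (convEvalOne _ _).toLinearMap).2 ?_
    rintro _ ⟨k, rfl⟩
    change convEvalOne _ _ _ = 0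
    rw [map_relations, h1, h1, h1]
    convert relations_eq_zero s α a k using 2 <;> simp [incl_apply]
  have hrel := fun k => eq_zero_of_convTranslate_mem hS hS1 (Submodule.subset_span ⟨k, rfl⟩)
  obtain ⟨δ, hu, hv, ht⟩ := exists_lift (s := s) hα (a := a) ![j (![1, 0], 0), j (![0, 1], 0)]
    (j (0, 1)) (hrel 0) (sub_eq_zero.1 (hrel 1)) (by
      refine (eq_neg_of_add_eq_zero_left (hrel 2)).trans ?_
      rw [pow_succ, mul_neg_one, neg_mul, neg_smul]
      rfl)
  refine ⟨δ, fun p => ?_⟩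
  have hp : p = p.1 0 • (![1, 0], 0) + p.1 1 • (![0, 1], 0) + p.2 • (0, 1) := by
    refine Prod.ext (funext fun k => ?_) ?_
    · fin_cases k <;> simp
    · simp
  rw [incl_apply, map_add, map_add, map_smul, map_smul, map_smul, hu, hv, ht]
  change _ = j p
  conv_rhs => rw [hp, map_add, map_add, map_smul, map_smul, map_smul]
  rfl

include hα in
theorem exists_action : ∃ ρ : Alg K →ₐ[ℂ] Module.End ℂ (ThreeAlg s α a), IsModuleAlgebra ρ ∧
    ∀ h p, ρ h (incl s α a p) = incl s α a (basicRep K i a c h p) := by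
  obtain ⟨δ, hδ⟩ := exists_conv K s hα i a c
  refine exists_isModuleAlgebra (basicRep K i a c) (incl s α a) ?_ δ hδ
  rw [← LinearMap.coe_range, range_incl, Algebra.adjoin_span, adjoin_eq_top s hα a]

end ThreeAlg

end

/-! ### Hopf ideals and weight functionals -/

section InnerFaithful

namespace Kashina

variable {K : Number}

/-- The subalgebra generated by the grouplike elements `x`, `y`, `z`. -/
noncomputable def groupPart (K : Number) : Subalgebra ℂ (Alg K) :=
  Algebra.adjoin ℂ {gen K .x, gen K .y, gen K .z}

theorem x_mem (K : Number) : gen K .x ∈ groupPart K := Algebra.subset_adjoin (by simp)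

theorem y_mem (K : Number) : gen K .y ∈ groupPart K := Algebra.subset_adjoin (by simp)

theorem z_mem (K : Number) : gen K .z ∈ groupPart K := Algebra.subset_adjoin (by simp)

/-- The eight monomials in the grouplike elements `x`, `y`, `z`. -/
noncomputable def groupMon (K : Number) (e : Fin 2 × Fin 2 × Fin 2) : Alg K :=
  gen K .x ^ (e.1 : ℕ) * (gen K .y ^ (e.2.1 : ℕ) * gen K .z ^ (e.2.2 : ℕ))

theorem exists_sum_groupMon {g : Alg K} (hg : g ∈ groupPart K) :
    ∃ c : Fin 2 × Fin 2 × Fin 2 → ℂ, ∑ e, c e • groupMon K e = g := by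
  rw [← Submodule.mem_span_range_iff_exists_fun]
  suffices h : ∀ m ∈ Submodule.span ℂ (Set.range (groupMon K)),
      g * m ∈ Submodule.span ℂ (Set.range (groupMon K)) by
    simpa using h 1 (Submodule.subset_span ⟨0, by simp [groupMon]⟩)
  have hs : ∀ r : Alg K, (∀ e, ∃ e', r * groupMon K e = groupMon K e') →
      ∀ m ∈ Submodule.span ℂ (Set.range (groupMon K)),
        r * m ∈ Submodule.span ℂ (Set.range (groupMon K)) := by
    intro r hr m hm
    induction hm using Submodule.span_induction with
    | mem m hm =>
      obtain ⟨e, rfl⟩ := hm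
      obtain ⟨e', he⟩ := hr e
      exact he ▸ Submodule.subset_span ⟨e', rfl⟩
    | zero => rw [mul_zero]; exact zero_mem _
    | add m n _ _ hm hn => rw [mul_add]; exact add_mem hm hn
    | smul c m _ hm => rw [mul_smul_comm]; exact Submodule.smul_mem _ _ hm
  induction hg using Algebra.adjoin_induction with
  | mem r hr =>
    refine hs r ?_
    rintro ⟨a, b, c⟩
    obtain rfl | rfl | rfl := hr
    · exact ⟨(a + 1, b, c), by fin_cases a <;> simp [groupMon]⟩
    · exact ⟨(a, b + 1, c), by fin_cases a <;> fin_cases b <;> simp [groupMon]⟩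
    · exact ⟨(a, b, c + 1), by
        fin_cases a <;> fin_cases b <;> fin_cases c <;> simp [groupMon]⟩
  | algebraMap c =>
    intro m hm
    rw [← Algebra.smul_def]
    exact Submodule.smul_mem _ _ hm
  | add g g' _ _ hg hg' =>
    intro m hm
    rw [add_mul]
    exact add_mem (hg m hm) (hg' m hm)
  | mul g g' _ _ hg hg' =>
    intro m hm
    rw [mul_assoc]
    exact hg _ (hg' m hm)

theorem exists_w_mul {g : Alg K} (hg : g ∈ groupPart K) :
    ∃ g' ∈ groupPart K, gen K .w * g = g' * gen K .w := by
  induction hg using Algebra.adjoin_induction with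
  | mem r hr =>
    obtain rfl | rfl | rfl := hr
    exacts [⟨_, y_mem K, wx K⟩, ⟨_, x_mem K, wy K⟩, ⟨_, z_mem K, wz K⟩]
  | algebraMap c => exact ⟨_, algebraMap_mem _ c, (Algebra.commutes _ _).symm⟩
  | add g g' _ _ hg hg' =>
    obtain ⟨k, hk, h⟩ := hg
    obtain ⟨k', hk', h'⟩ := hg'
    exact ⟨k + k', add_mem hk hk', by rw [mul_add, h, h', add_mul]⟩
  | mul g g' _ _ hg hg' =>
    obtain ⟨k, hk, h⟩ := hg
    obtain ⟨k', hk', h'⟩ := hg'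
    exact ⟨k * k', mul_mem hk hk', by rw [← mul_assoc, h, mul_assoc, h', mul_assoc]⟩

theorem ww_mem (K : Number) : gen K .w * gen K .w ∈ groupPart K := by
  rw [ww]
  exact mul_mem (Subalgebra.smul_mem _ (sub_mem (add_mem (add_mem (one_mem _) (x_mem K)) (y_mem K))
    (mul_mem (x_mem K) (y_mem K))) _) (pow_mem (z_mem K) _)

theorem w_pow_four (K : Number) : gen K .w * gen K .w * (gen K .w * gen K .w) = 1 := by
  cases K <;> simp [ww, Number.zExp, mul_add, add_mul, mul_sub, sub_mul, mul_assoc] <;> module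

theorem exists_add_mul_w (h : Alg K) :
    ∃ g₁ ∈ groupPart K, ∃ g₂ ∈ groupPart K, h = g₁ + g₂ * gen K .w := by
  induction h using induct with
  | hc c => exact ⟨_, algebraMap_mem _ c, 0, zero_mem _, by simp⟩
  | hg s =>
    cases s
    · exact ⟨_, x_mem K, 0, zero_mem _, by simp⟩
    · exact ⟨_, y_mem K, 0, zero_mem _, by simp⟩
    · exact ⟨_, z_mem K, 0, zero_mem _, by simp⟩
    · exact ⟨0, zero_mem _, 1, one_mem _, by simp⟩
  | ha h h' hh hh' =>
    obtain ⟨g₁, hg₁, g₂, hg₂, rfl⟩ := hh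
    obtain ⟨k₁, hk₁, k₂, hk₂, rfl⟩ := hh'
    exact ⟨_, add_mem hg₁ hk₁, _, add_mem hg₂ hk₂, by rw [add_mul]; abel⟩
  | hm h h' hh hh' =>
    obtain ⟨g₁, hg₁, g₂, hg₂, rfl⟩ := hh
    obtain ⟨k₁, hk₁, k₂, hk₂, rfl⟩ := hh'
    obtain ⟨l₁, hl₁, h₁⟩ := exists_w_mul hk₁
    obtain ⟨l₂, hl₂, h₂⟩ := exists_w_mul hk₂
    refine ⟨_, add_mem (mul_mem hg₁ hk₁) (mul_mem (mul_mem hg₂ hl₂) (ww_mem K)), _,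
      add_mem (mul_mem hg₁ hk₂) (mul_mem hg₂ hl₁), ?_⟩
    rw [add_mul, mul_add, mul_add, mul_assoc g₂ _ k₁, h₁, mul_assoc g₂ _ (k₂ * _),
      ← mul_assoc (gen K .w) k₂, h₂]
    noncomm_ring

open WithConv

/-- A functional that is annihilated by the ideal `I`, takes the value `1` at the unit, and is
multiplied by `ξ`, `η`, `ζ` under translation by `x`, `y`, `z`. -/
structure IsWeightFunctional (I : Ideal (Alg K)) (f : WithConv (Alg K →ₗ[ℂ] ℂ)) (ξ η ζ : ℂ) :
    Prop where
  eq_zero : ∀ h ∈ I, f h = 0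
  one : f 1 = 1
  x : ∀ h, f (gen K .x * h) = ξ * f h
  y : ∀ h, f (gen K .y * h) = η * f h
  z : ∀ h, f (gen K .z * h) = ζ * f h

namespace IsWeightFunctional

variable {I : Ideal (Alg K)} {f g : WithConv (Alg K →ₗ[ℂ] ℂ)} {ξ η ζ ξ' η' ζ' : ℂ}

/-- The convolution product of weight functionals. It vanishes on a Hopf ideal because the
comultiplication descends to the quotient. -/
theorem mul [I.IsHopfIdeal ℂ] (hf : IsWeightFunctional I f ξ η ζ)
    (hg : IsWeightFunctional I g ξ' η' ζ') :
    IsWeightFunctional I (f * g) (ξ * ξ') (η * η') (ζ * ζ') where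
  eq_zero h hh := by
    let J : Submodule ℂ (Alg K) := I.restrictScalars ℂ
    have hJ := Submodule.IsCoideal.map_mkQ_comul_eq_zero (I := J) hh
    have hf' : J ≤ LinearMap.ker f.ofConv := hf.eq_zero
    have hg' : J ≤ LinearMap.ker g.ofConv := hg.eq_zero
    have e : TensorProduct.map f.ofConv g.ofConv =
        TensorProduct.map (J.liftQ f.ofConv hf') (J.liftQ g.ofConv hg') ∘ₗ
          TensorProduct.map J.mkQ J.mkQ := by
      rw [← TensorProduct.map_comp, Submodule.liftQ_mkQ, Submodule.liftQ_mkQ]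
    rw [LinearMap.convMul_apply, e, LinearMap.comp_apply, hJ, map_zero, map_zero]
  one := by simp [Algebra.TensorProduct.one_def, hf.one, hg.one]
  x h := by
    rw [LinearMap.convMul_apply, LinearMap.convMul_apply, Bialgebra.comul_mul, comul_x]
    generalize Coalgebra.comul (R := ℂ) h = P
    induction P with
    | zero => simp
    | add P Q hP hQ => rw [mul_add, map_add, map_add, hP, hQ, map_add, map_add, mul_add]
    | tmul a b =>
      simp only [Algebra.TensorProduct.tmul_mul_tmul, TensorProduct.map_tmul,
        LinearMap.mul'_apply, hf.x, hg.x]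
      ring
  y h := by
    rw [LinearMap.convMul_apply, LinearMap.convMul_apply, Bialgebra.comul_mul, comul_y]
    generalize Coalgebra.comul (R := ℂ) h = P
    induction P with
    | zero => simp
    | add P Q hP hQ => rw [mul_add, map_add, map_add, hP, hQ, map_add, map_add, mul_add]
    | tmul a b =>
      simp only [Algebra.TensorProduct.tmul_mul_tmul, TensorProduct.map_tmul,
        LinearMap.mul'_apply, hf.y, hg.y]
      ring
  z h := by
    rw [LinearMap.convMul_apply, LinearMap.convMul_apply, Bialgebra.comul_mul, comul_z]
    generalize Coalgebra.comul (R := ℂ) h = P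
    induction P with
    | zero => simp
    | add P Q hP hQ => rw [mul_add, map_add, map_add, hP, hQ, map_add, map_add, mul_add]
    | tmul a b =>
      simp only [Algebra.TensorProduct.tmul_mul_tmul, TensorProduct.map_tmul,
        LinearMap.mul'_apply, hf.z, hg.z]
      ring

theorem mul_w (hf : IsWeightFunctional I f ξ η ζ) (hw : f (gen K .w) = 0)
    (g : WithConv (Alg K →ₗ[ℂ] ℂ)) : (f * g) (gen K .w) = 0 := by
  simp [LinearMap.convMul_apply, comul_w, twist, Fin.sum_univ_two, add_mul, mul_assoc, hf.y, hf.z,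
    hw]

theorem groupPart_mul_w (hf : IsWeightFunctional I f ξ η ζ) (hw : f (gen K .w) = 0) {k : Alg K}
    (hk : k ∈ groupPart K) : f (k * gen K .w) = 0 := by
  suffices h : ∀ m, f m = 0 → f (k * m) = 0 from h _ hw
  induction hk using Algebra.adjoin_induction with
  | mem r hr =>
    intro m hm
    obtain rfl | rfl | rfl := hr
    · rw [hf.x, hm, mul_zero]
    · rw [hf.y, hm, mul_zero]
    · rw [hf.z, hm, mul_zero]
  | algebraMap c =>
    intro m hm
    rw [← Algebra.smul_def, map_smul, hm, smul_zero]
  | add g g' _ _ hg hg' =>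
    intro m hm
    rw [add_mul, map_add, hg m hm, hg' m hm, add_zero]
  | mul g g' _ _ hg hg' =>
    intro m hm
    rw [mul_assoc]
    exact hg _ (hg' m hm)

theorem apply_groupMon (hf : IsWeightFunctional I f ξ η ζ) (e : Fin 2 × Fin 2 × Fin 2) :
    f (groupMon K e) = ξ ^ (e.1 : ℕ) * (η ^ (e.2.1 : ℕ) * ζ ^ (e.2.2 : ℕ)) := by
  have hz := hf.z 1
  have hy := hf.y 1
  have hx := hf.x 1
  rw [mul_one, hf.one, mul_one] at hx hy hz
  obtain ⟨a, b, c⟩ := e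
  fin_cases a <;> fin_cases b <;> fin_cases c <;> simp [groupMon, hf.x, hf.y, hx, hy, hz, hf.one]

end IsWeightFunctional

/-- If all eight characters of the group `{x^a y^b z^c}` are weights of functionals that vanish at
`w` and on the ideal `I`, then `I` meets the group algebra trivially, and so it is zero. -/
theorem eq_bot_of_isWeightFunctional {I : Ideal (Alg K)} [I.IsTwoSided]
    (hI : ∀ ξ η ζ : ℂ, ξ = 1 ∨ ξ = -1 → η = 1 ∨ η = -1 → ζ = 1 ∨ ζ = -1 →
      ∃ f, IsWeightFunctional I f ξ η ζ ∧ f (gen K .w) = 0) : I = ⊥ := by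
  have key : ∀ g₁ ∈ groupPart K, ∀ g₂ ∈ groupPart K, g₁ + g₂ * gen K .w ∈ I → g₁ = 0 := by
    intro g₁ hg₁ g₂ hg₂ h
    obtain ⟨c, rfl⟩ := exists_sum_groupMon hg₁
    have hc : ∀ ξ η ζ : ℂ, ξ = 1 ∨ ξ = -1 → η = 1 ∨ η = -1 → ζ = 1 ∨ ζ = -1 →
        ∑ e : Fin 2 × Fin 2 × Fin 2,
          c e * (ξ ^ (e.1 : ℕ) * (η ^ (e.2.1 : ℕ) * ζ ^ (e.2.2 : ℕ))) = 0 := by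
      intro ξ η ζ hξ hη hζ
      obtain ⟨f, hf, hw⟩ := hI ξ η ζ hξ hη hζ
      have := hf.eq_zero _ h
      rw [map_add, hf.groupPart_mul_w hw hg₂, add_zero, map_sum] at this
      simpa [hf.apply_groupMon] using this
    have hc0 : ∀ e, c e = 0 := by
      have h000 := hc 1 1 1 (by simp) (by simp) (by simp)
      have h001 := hc 1 1 (-1) (by simp) (by simp) (by simp)
      have h010 := hc 1 (-1) 1 (by simp) (by simp) (by simp)
      have h011 := hc 1 (-1) (-1) (by simp) (by simp) (by simp)
      have h100 := hc (-1) 1 1 (by simp) (by simp) (by simp)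
      have h101 := hc (-1) 1 (-1) (by simp) (by simp) (by simp)
      have h110 := hc (-1) (-1) 1 (by simp) (by simp) (by simp)
      have h111 := hc (-1) (-1) (-1) (by simp) (by simp) (by simp)
      simp only [Fintype.sum_prod_type, Fin.sum_univ_two, Fin.val_zero, Fin.val_one, pow_zero,
        pow_one, mul_one, mul_neg, neg_neg] at h000 h001 h010 h011 h100 h101 h110 h111
      rintro ⟨a, b, d⟩
      fin_cases a <;> fin_cases b <;> fin_cases d <;> simp only [Fin.zero_eta, Fin.mk_one] <;> grind
    simp [hc0]
  rw [eq_bot_iff]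
  intro h hh
  obtain ⟨g₁, hg₁, g₂, hg₂, rfl⟩ := exists_add_mul_w h
  have h₁ := key g₁ hg₁ g₂ hg₂ hh
  subst h₁
  rw [zero_add] at hh ⊢
  have h₂ : g₂ * (gen K .w * gen K .w) + 0 * gen K .w ∈ I := by
    rw [zero_mul, add_zero, ← mul_assoc]
    exact I.mul_mem_right _ hh
  have h₃ := key _ (mul_mem hg₂ (ww_mem K)) 0 (zero_mem _) h₂
  have h₄ : g₂ = 0 := by
    rw [← mul_one g₂, ← w_pow_four, ← mul_assoc, h₃, zero_mul]
  rw [h₄, zero_mul]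
  exact zero_mem _

/-- A Hopf ideal that annihilates the representation `π_i ⊕ T_{(-1)^a, (-1)^a, -1, γ}` is zero: the
diagonal matrix entries of `π_i` and the character of `T` generate all characters of the group. -/
theorem eq_bot_of_basicRep (i a c : Fin 2) {I : Ideal (Alg K)} [I.IsTwoSided] [I.IsHopfIdeal ℂ]
    (hI : ∀ h ∈ I, basicRep K i a c h = 0) : I = ⊥ := by
  let p : Fin 2 → WithConv (Alg K →ₗ[ℂ] ℂ) := fun k =>
    toConv (Matrix.entryLinearMap ℂ ℂ k k ∘ₗ (piRep K i).toLinearMap)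
  let χ : WithConv (Alg K →ₗ[ℂ] ℂ) := toConv (charRep K a 1 c).toLinearMap
  have hI₁ : ∀ h ∈ I, piRep K i h = 0 := by
    intro h hh
    refine Matrix.toLin'.injective (LinearMap.ext fun e => ?_)
    have := congrArg Prod.fst (DFunLike.congr_fun (hI h hh) (e, 0))
    simpa [basicRep_apply] using this
  have hI₂ : ∀ h ∈ I, charRep K a 1 c h = 0 := by
    intro h hh
    have := congrArg Prod.snd (DFunLike.congr_fun (hI h hh) (0, 1))
    simpa [basicRep_apply] using this
  have hp₀ : IsWeightFunctional I (p 0) 1 (-1) ((-1) ^ (i : ℕ)) := by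
    constructor
    · intro h hh
      simp [p, hI₁ h hh]
    all_goals simp [p, piRep, Matrix.vecMul, dotProduct]
  have hp₁ : IsWeightFunctional I (p 1) (-1) 1 ((-1) ^ (i : ℕ)) := by
    constructor
    · intro h hh
      simp [p, hI₁ h hh]
    all_goals simp [p, piRep, Matrix.vecMul, dotProduct]
  have hχ : IsWeightFunctional I χ ((-1) ^ (a : ℕ)) ((-1) ^ (a : ℕ)) (-1) := by
    constructor
    · intro h hh
      simp [χ, hI₂ h hh]
    all_goals simp [χ, charRep]
  have hw : ∀ k, p k (gen K .w) = 0 := by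
    intro k
    fin_cases k <;> simp [p, piRep]
  -- The functionals supported on the group algebra.
  let P : ℂ → ℂ → ℂ → Prop := fun ξ η ζ =>
    ∃ f, IsWeightFunctional I f ξ η ζ ∧ f (gen K .w) = 0
  have q₁ : P _ _ _ := ⟨_, hp₀, hw 0⟩
  have q₂ : P _ _ _ := ⟨_, hp₁, hw 1⟩
  have q₃ : P _ _ _ := ⟨_, hp₀.mul hp₀, hp₀.mul_w (hw 0) _⟩
  have q₄ : P _ _ _ := ⟨_, hp₀.mul hp₁, hp₀.mul_w (hw 0) _⟩
  have mul_χ : ∀ {ξ η ζ}, P ξ η ζ → P (ξ * (-1) ^ (a : ℕ)) (η * (-1) ^ (a : ℕ)) (ζ * -1) :=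
    fun ⟨_, hf, hfw⟩ => ⟨_, hf.mul hχ, hf.mul_w hfw _⟩
  have r₁ := mul_χ q₁
  have r₂ := mul_χ q₂
  have r₃ := mul_χ q₃
  have r₄ := mul_χ q₄
  refine eq_bot_of_isWeightFunctional fun ξ η ζ hξ hη hζ => ?_
  change P ξ η ζ
  obtain hi | hi := neg_one_pow_eq_or ℂ (i : ℕ) <;> obtain ha | ha := neg_one_pow_eq_or ℂ (a : ℕ) <;>
    simp only [hi, ha, mul_one, mul_neg, neg_neg] at q₁ q₂ q₃ q₄ r₁ r₂ r₃ r₄ <;>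
    rcases hξ with rfl | rfl <;> rcases hη with rfl | rfl <;> rcases hζ with rfl | rfl <;>
    assumption

end Kashina

end InnerFaithful

/-! ### The regular algebra with its inner-faithful action -/

theorem mainTheorem9 (K : Kashina.Number) (s : QuadRel) (α : ℂ) (hα : α ≠ 0) (i a c : Fin 2) :
    IsASRegular (ThreeAlg.deg s α a) ∧
    ∃ ρ : Kashina.Alg K →ₐ[ℂ] Module.End ℂ (ThreeAlg s α a),
      IsModuleAlgebra ρ ∧
      (∀ (h : Kashina.Alg K) (n : ℕ), ∀ p ∈ ThreeAlg.deg s α a n, ρ h p ∈ ThreeAlg.deg s α a n) ∧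
      (∃ φ : ((Fin 2 → ℂ) × ℂ) ≃ₗ[ℂ] ThreeAlg.deg s α a 1,
        (∀ p : (Fin 2 → ℂ) × ℂ, (φ p : ThreeAlg s α a) =
          p.1 0 • ThreeAlg.u s α a + p.1 1 • ThreeAlg.v s α a + p.2 • ThreeAlg.t s α a) ∧
        ∀ (h : Kashina.Alg K) (p : (Fin 2 → ℂ) × ℂ), ρ h (φ p : ThreeAlg s α a) =
          φ ((Kashina.piRep K i h).mulVec p.1, Kashina.charRep K a 1 c h * p.2)) ∧
      IsInnerFaithful ρ := by
  obtain ⟨ρ, hρ, hact⟩ := ThreeAlg.exists_action K s hα i a c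
  refine ⟨ThreeAlg.isASRegular s hα a, ρ, hρ, fun h n => ?_,
    ⟨ThreeAlg.inclEquiv s hα a, fun _ => rfl, hact⟩, fun I _ _ hI => ?_⟩
  · refine hρ.act_mem_pow (fun h w hw => ?_) n h
    rw [← ThreeAlg.range_incl] at hw ⊢
    obtain ⟨p, rfl⟩ := hw
    exact ⟨_, (hact h p).symm⟩
  · refine Kashina.eq_bot_of_basicRep i a c fun h hh => LinearMap.ext fun p => ?_
    refine ThreeAlg.incl_injective s hα a ?_
    rw [← hact, hI h hh]
    simp
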